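/- Let $k$ be a field and $G$ a group. A $k$-category is a small category whose morphism sets are $k$-vector spaces and whose composition is $k$-bilinear. A $G$-$k$-category is a $k$-category $\mathcal C$ with a (strict) action of $G$ by $k$-linear automorphisms of $\mathcal C$: $G$ acts on the set $\mathcal C_0$ of objects, and there are $k$-linear maps $\mathrm{Hom}(x,y)\to \mathrm{Hom}(sx,sy)$, $f\mapsto sf$, with $s(gf)=(sg)(sf)$, $s1_x=1_{sx}$, $1f=f$ and $(st)f=s(tf)$. *Cochains.* For a $k$-category $\mathcal B$, $C^n(\mathcal B)$ is the space of families $\varphi=(\varphi_{(x_{n+1},\dots,x_1)})$, indexed by the sequences of $n+1$ objects, of $k$-multilinear maps sending $(f_n,\dots,f_1)$, where $f_i\in\mathrm{Hom}(x_i,x_{i+1})$, to a morphism $\varphi(f_n,\dots,f_1)\in \mathrm{Hom}(x_1,x_{n+1})$ (so $C^0(\mathcal B)=\prod_x\mathrm{Hom}(x,x)$). The coboundary is $$(d\varphi)(f_{n+1},\dots,f_1)=\varphi(f_{n+1},\dots,f_2)f_1+\sum_{i=1}^{n}(-1)^i\varphi(f_{n+1},\dots,f_{i+1}f_i,\dots,f_1)+(-1)^{n+1}f_{n+1}\varphi(f_n,\dots,f_1),$$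 and for $\psi\in C^m(\mathcal B)$, $\varphi\in C^n(\mathcal B)$ the cup product is $(\psi\smile\varphi)(f_{m+n},\dots,f_1)=\psi(f_{m+n},\dots,f_{n+1})\,\varphi(f_n,\dots,f_1)$. With these $C^\bullet(\mathcal B)$ is a differential graded (DG) algebra, with the Leibniz rule $d(\psi\smile\varphi)=\psi\smile d\varphi+(-1)^{n}\,d\psi\smile\varphi$; its cohomology algebra is $HH^*(\mathcal B)=\bigoplus_n HH^n(\mathcal B)$. *Class $\{1\}$.* Let $\mathcal B$ be $G$-graded: $\mathrm{Hom}(x,y)=\bigoplus_{s\in G}\mathrm{Hom}(x,y)^s$, with composition mapping $\mathrm{Hom}(y,z)^t\times\mathrm{Hom}(x,y)^s$ to $\mathrm{Hom}(x,z)^{ts}$. The cochains $\varphi$ such that $\varphi(f_n,\dots,f_1)$ is homogeneous of degree $s_n\cdots s_1$ whenever the $f_i$ are homogeneous of degrees $s_i$ (for $n=0$: of degree $1$) form a DG-subalgebra $C^\bullet_{\{1\}}(\mathcal B)$ of $C^\bullet(\mathcal B)$. Put $HH^*_{\{1\}}(\mathcal B)=H^*(C^\bullet_{\{1\}}(\mathcal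 B))$. *Skew category.* $\mathcal C[G]$ has the objects of $\mathcal C$ and $\mathrm{Hom}_{\mathcal C[G]}(x,y)=\bigoplus_{s\in G}\mathrm{Hom}_{\mathcal C}(sx,y)$, where $\mathrm{Hom}_{\mathcal C}(sx,y)$ is the part of degree $s$; the composite of $f\in\mathrm{Hom}_{\mathcal C}(sx,y)$ and $g\in\mathrm{Hom}_{\mathcal C}(ty,z)$ is $g\circ(tf)\in\mathrm{Hom}_{\mathcal C}(tsx,z)$, of degree $ts$. For $T\subseteq\mathcal C_0$, $\mathcal C_T[G]$ is the full ($G$-graded) subcategory of $\mathcal C[G]$ with set of objects $T$. A transversal is a subset $T$ of $\mathcal C_0$ containing exactly one element of each $G$-orbit. *Invariants.* $G$ acts on $C^\bullet(\mathcal C)$ by DG-algebra automorphisms: $(s\varphi)(f_n,\dots,f_1)=s\,\varphi(s^{-1}f_n,\dots,s^{-1}f_1)$, hence on $HH^*(\mathcal C)$ by algebra automorphisms. The invariant cochains form a DG-subalgebra $(C^\bullet(\mathcal C))^G$. **Theorem.** Let $\mathcal C$ be a $G$-$k$-category such that $G$ acts freely on $\mathcal C_0$: $sx=x$ only if $s=1$.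 There is an isomorphism of $k$-algebras, preserving the cohomological degree, $$e\colon HH^*_{\{1\}}(\mathcal C[G])\xrightarrow{\ \sim\ }H^*\big((C^\bullet(\mathcal C))^G\big)$$ with the following properties. 1. For every transversal $T$ of the action of $G$ on $\mathcal C_0$ there are mutually inverse DG-algebra morphisms $$(C^\bullet(\mathcal C))^G\ \underset{B}{\overset{A}{\rightleftarrows}}\ C^\bullet_{\{1\}}(\mathcal C_T[G])$$ such that $H^*(A)\circ e$ is the map $HH^*_{\{1\}}(\mathcal C[G])\to HH^*_{\{1\}}(\mathcal C_T[G])$ induced by restricting cochains to $\mathcal C_T[G]$. 2. If the invariants functor $(\ )^G$ from $kG$-modules to $k$-vector spaces is exact, then the composite of $e$ with the map $H^*((C^\bullet(\mathcal C))^G)\to HH^*(\mathcal C)$ induced by the inclusion is an isomorphism of $k$-algebras from $HH^*_{\{1\}}(\mathcal C[G])$ onto the invariant subalgebra $HH^*(\mathcal C)^G$. -/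

import Mathlib

open CategoryTheory DirectSum

universe uk uG u v w w'

namespace HochschildMitchell

/-! ### Differential graded algebras and their cohomology algebras -/

/-- A (cochain) differential graded `k`-algebra `X 0 ⟶ X 1 ⟶ ⋯`. Equalities between elements of
`X m` and `X n` for provably equal `m`, `n` are heterogeneous equalities or use a cast. The Leibniz
rule is `d (a b) = a (d b) + (-1)^n (d a) b` for `b` of degree `n`. -/
structure DGAlgebra (k : Type uk) [Field k] where
  X : ℕ → Type w
  [addCommGroup : ∀ n, AddCommGroup (X n)]
  [module : ∀ n, Module k (X n)]
  d : ∀ n, X n →ₗ[k] X (n + 1)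
  one : X 0
  mul : ∀ {m n : ℕ}, X m →ₗ[k] X n →ₗ[k] X (m + n)
  one_mul : ∀ {n : ℕ} (a : X n), HEq (mul one a) a
  mul_one : ∀ {n : ℕ} (a : X n), HEq (mul a one) a
  mul_assoc : ∀ {l m n : ℕ} (a : X l) (b : X m) (c : X n),
    HEq (mul (mul a b) c) (mul a (mul b c))
  d_d : ∀ (n : ℕ) (a : X n), d (n + 1) (d n a) = 0
  d_mul : ∀ {m n : ℕ} (a : X m) (b : X n),
    d (m + n) (mul a b) = mul a (d n b) +
      (-1 : k) ^ n • cast (congrArg X (Nat.add_right_comm m 1 n)) (mul (d m a) b)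

namespace DGAlgebra

attribute [instance] DGAlgebra.addCommGroup DGAlgebra.module

variable {k : Type uk} [Field k] (A : DGAlgebra.{uk, w} k)

/-- The cocycles of degree `n`. -/
def Z (n : ℕ) : Submodule k (A.X n) := LinearMap.ker (A.d n)

/-- The coboundaries of degree `n`. -/
def Bd : ∀ n : ℕ, Submodule k (A.X n)
  | 0 => ⊥
  | n + 1 => LinearMap.range (A.d n)

/-- The cohomology `H^n` of a differential graded algebra. -/
abbrev H (n : ℕ) : Type w := A.Z n ⧸ (A.Bd n).submoduleOf (A.Z n)

/-- The cohomology class of a cocycle. -/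
def cls (n : ℕ) : A.Z n →ₗ[k] A.H n := Submodule.mkQ _

theorem cls_surjective (n : ℕ) : Function.Surjective (A.cls n) := Submodule.mkQ_surjective _

theorem cls_eq_zero {n : ℕ} (z : A.Z n) (h : (z : A.X n) ∈ A.Bd n) : A.cls n z = 0 :=
  (Submodule.Quotient.mk_eq_zero _).2 h

theorem cast_mem_Bd {i j : ℕ} (h : i = j) (z : A.X i) :
    cast (congrArg A.X h) z ∈ A.Bd j ↔ z ∈ A.Bd i := by
  subst h; rfl

theorem cast_zero {i j : ℕ} (h : i = j) : cast (congrArg A.X h) (0 : A.X i) = 0 := by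
  subst h; rfl

theorem d_one : A.d 0 A.one = 0 := by
  have h := A.d_mul A.one A.one
  have h1 : A.mul A.one A.one = A.one := eq_of_heq (A.one_mul A.one)
  have h2 : A.mul A.one (A.d 0 A.one) = A.d 0 A.one := by
    have e := A.one_mul (A.d 0 A.one)
    have e' : HEq (A.mul A.one (A.d 0 A.one)) (A.d 0 A.one) := e
    exact eq_of_heq e'
  have h3 : A.mul (A.d 0 A.one) A.one = A.d 0 A.one := eq_of_heq (A.mul_one _)
  have h4 : A.d (0 + 0) (A.mul A.one A.one) = A.d 0 A.one := congrArg (A.d 0) h1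
  have h5 := h4.symm.trans h
  rw [pow_zero, one_smul] at h5
  have h6 : A.d 0 A.one = A.d 0 A.one + A.d 0 A.one :=
    h5.trans (congrArg₂ (· + ·) h2 h3)
  simpa using h6

theorem mul_mem_Z {m n : ℕ} {a : A.X m} {b : A.X n} (ha : a ∈ A.Z m) (hb : b ∈ A.Z n) :
    A.mul a b ∈ A.Z (m + n) := by
  have ha' : A.d m a = 0 := ha
  have hb' : A.d n b = 0 := hb
  change A.d (m + n) (A.mul a b) = 0
  rw [A.d_mul, ha', hb', map_zero, map_zero, LinearMap.zero_apply,
    A.cast_zero (Nat.add_right_comm m 1 n), smul_zero, add_zero]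

theorem mul_mem_Bd_right {m n : ℕ} {a : A.X m} {b : A.X n} (ha : a ∈ A.Z m) (hb : b ∈ A.Bd n) :
    A.mul a b ∈ A.Bd (m + n) := by
  have ha' : A.d m a = 0 := ha
  cases n with
  | zero =>
    obtain rfl : b = 0 := hb
    rw [map_zero]; exact Submodule.zero_mem _
  | succ n =>
    obtain ⟨c, rfl⟩ := hb
    refine ⟨A.mul a c, (A.d_mul a c).trans ?_⟩
    rw [ha', map_zero, LinearMap.zero_apply,
      A.cast_zero (Nat.add_right_comm m 1 n), smul_zero, add_zero]

theorem mul_mem_Bd_left {m n : ℕ} {a : A.X m} {b : A.X n} (ha : a ∈ A.Bd m) (hb : b ∈ A.Z n) :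
    A.mul a b ∈ A.Bd (m + n) := by
  have hb' : A.d n b = 0 := hb
  cases m with
  | zero =>
    obtain rfl : a = 0 := ha
    rw [map_zero, LinearMap.zero_apply]; exact Submodule.zero_mem _
  | succ m =>
    obtain ⟨c, rfl⟩ := ha
    rw [← A.cast_mem_Bd (Nat.add_right_comm m 1 n)]
    refine ⟨(-1 : k) ^ n • A.mul c b, ?_⟩
    rw [map_smul, A.d_mul, hb', map_zero, zero_add, smul_smul, ← mul_pow, neg_one_mul, neg_neg,
      one_pow, one_smul]

/-- The product of cocycles. -/
def mulZ {m n : ℕ} : A.Z m →ₗ[k] A.Z n →ₗ[k] A.Z (m + n) :=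
  LinearMap.mk₂ k (fun a b => ⟨A.mul a.1 b.1, A.mul_mem_Z a.2 b.2⟩)
    (fun a a' b => Subtype.ext (by simp)) (fun c a b => Subtype.ext (by simp))
    (fun a b b' => Subtype.ext (by simp)) (fun c a b => Subtype.ext (by simp))

/-- The product of cohomology classes, `[a] [b] = [a b]`. -/
def mulH {m n : ℕ} : A.H m →ₗ[k] A.H n →ₗ[k] A.H (m + n) :=
  Submodule.liftQ _
    { toFun := fun a => Submodule.liftQ _ ((A.cls (m + n)).comp (A.mulZ a)) (fun b hb =>
        A.cls_eq_zero _ (A.mul_mem_Bd_right a.2 hb))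
      map_add' := fun a a' => by
        refine LinearMap.ext fun y => ?_
        obtain ⟨b, rfl⟩ := A.cls_surjective _ y
        simp [cls]
      map_smul' := fun c a => by
        refine LinearMap.ext fun y => ?_
        obtain ⟨b, rfl⟩ := A.cls_surjective _ y
        simp [cls] }
    (fun a ha => by
      refine LinearMap.ext fun y => ?_
      obtain ⟨b, rfl⟩ := A.cls_surjective _ y
      exact A.cls_eq_zero _ (A.mul_mem_Bd_left ha b.2))

theorem mulH_cls {m n : ℕ} (a : A.Z m) (b : A.Z n) :
    A.mulH (A.cls m a) (A.cls n b) = A.cls (m + n) (A.mulZ a b) := rfl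

/-- The unit of the cohomology algebra. -/
def oneH : A.H 0 := A.cls 0 ⟨A.one, A.d_one⟩

theorem mk_cls_eq {i j : ℕ} (h : i = j) (z : A.Z i) (z' : A.Z j)
    (hz : HEq (z : A.X i) (z' : A.X j)) :
    GradedMonoid.mk i (A.cls i z) = GradedMonoid.mk j (A.cls j z') := by
  subst h
  rw [Subtype.ext (eq_of_heq hz)]

instance : GradedMonoid.GMul A.H := ⟨fun a b => A.mulH a b⟩

instance : GradedMonoid.GOne A.H := ⟨A.oneH⟩

instance : DirectSum.GRing A.H where
  mul a b := A.mulH a b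
  mul_zero a := map_zero _
  zero_mul b := by rw [map_zero, LinearMap.zero_apply]
  mul_add a b c := map_add _ _ _
  add_mul a b c := by rw [map_add, LinearMap.add_apply]
  one_mul := by
    rintro ⟨n, a⟩
    obtain ⟨a, rfl⟩ := A.cls_surjective _ a
    exact A.mk_cls_eq (Nat.zero_add n) _ _ (A.one_mul a.1)
  mul_one := by
    rintro ⟨n, a⟩
    obtain ⟨a, rfl⟩ := A.cls_surjective _ a
    exact A.mk_cls_eq (Nat.add_zero n) _ _ (A.mul_one a.1)
  mul_assoc := by
    rintro ⟨l, a⟩ ⟨m, b⟩ ⟨n, c⟩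
    obtain ⟨a, rfl⟩ := A.cls_surjective _ a
    obtain ⟨b, rfl⟩ := A.cls_surjective _ b
    obtain ⟨c, rfl⟩ := A.cls_surjective _ c
    exact A.mk_cls_eq (Nat.add_assoc l m n) _ _ (A.mul_assoc a.1 b.1 c.1)
  natCast n := n • A.oneH
  natCast_zero := zero_smul _ _
  natCast_succ n := succ_nsmul _ _
  intCast n := n • A.oneH
  intCast_ofNat n := natCast_zsmul _ _
  intCast_negSucc_ofNat n := negSucc_zsmul _ _

theorem mk_oneH_mul {n : ℕ} (a : A.H n) :
    GradedMonoid.mk _ (A.mulH A.oneH a) = GradedMonoid.mk n a :=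
  GradedMonoid.GMonoid.one_mul (GradedMonoid.mk n a)

theorem mk_mul_oneH {n : ℕ} (a : A.H n) :
    GradedMonoid.mk _ (A.mulH a A.oneH) = GradedMonoid.mk n a :=
  GradedMonoid.GMonoid.mul_one (GradedMonoid.mk n a)

theorem mk_smul_eq {i j : ℕ} (r : k) {a : A.H i} {b : A.H j}
    (h : GradedMonoid.mk i a = GradedMonoid.mk j b) :
    GradedMonoid.mk i (r • a) = GradedMonoid.mk j (r • b) :=
  congrArg (fun t : GradedMonoid A.H => GradedMonoid.mk t.1 (r • t.2)) h

instance : DirectSum.GAlgebra k A.H where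
  toFun := (LinearMap.toSpanSingleton k (A.H 0) A.oneH).toAddMonoidHom
  map_one := one_smul k A.oneH
  map_mul r s := by
    change GradedMonoid.mk 0 ((r * s) • A.oneH) =
      GradedMonoid.mk _ (A.mulH (r • A.oneH) (s • A.oneH))
    rw [map_smul, map_smul, LinearMap.smul_apply, smul_smul, mul_comm r s]
    exact A.mk_smul_eq _ (A.mk_oneH_mul _).symm
  commutes := by
    rintro r ⟨n, a⟩
    change GradedMonoid.mk _ (A.mulH (r • A.oneH) a) = GradedMonoid.mk _ (A.mulH a (r • A.oneH))
    rw [map_smul, LinearMap.smul_apply, map_smul]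
    exact A.mk_smul_eq _ ((A.mk_oneH_mul a).trans (A.mk_mul_oneH a).symm)
  smul_def := by
    rintro r ⟨n, a⟩
    change GradedMonoid.mk n (r • a) = GradedMonoid.mk _ (A.mulH (r • A.oneH) a)
    rw [map_smul, LinearMap.smul_apply]
    exact A.mk_smul_eq _ (A.mk_oneH_mul a).symm

/-- The cohomology algebra `H^* = ⨁ n, H^n` of a differential graded algebra. -/
abbrev HAlg : Type w := ⨁ n, A.H n

/-- A graded subspace stable under the structure of a DG-algebra. -/
structure SubDG where
  S : ∀ n, Submodule k (A.X n)
  one_mem : A.one ∈ S 0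
  d_mem : ∀ (n : ℕ) (a : A.X n), a ∈ S n → A.d n a ∈ S (n + 1)
  mul_mem : ∀ {m n : ℕ} (a : A.X m) (b : A.X n), a ∈ S m → b ∈ S n → A.mul a b ∈ S (m + n)

/-- A sub-DG-algebra, as a DG-algebra. -/
def sub (P : SubDG A) : DGAlgebra.{uk, w} k where
  X n := P.S n
  d n := (A.d n).restrict (P.d_mem n)
  one := ⟨A.one, P.one_mem⟩
  mul := LinearMap.mk₂ k (fun a b => ⟨A.mul a.1 b.1, P.mul_mem _ _ a.2 b.2⟩)
    (fun a a' b => Subtype.ext (by simp)) (fun c a b => Subtype.ext (by simp))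
    (fun a b b' => Subtype.ext (by simp)) (fun c a b => Subtype.ext (by simp))
  one_mul {n} a := heq_sub P.S (Nat.zero_add n) (A.one_mul a.1)
  mul_one {n} a := heq_sub P.S (Nat.add_zero n) (A.mul_one a.1)
  mul_assoc {l m n} a b c := heq_sub P.S (Nat.add_assoc l m n) (A.mul_assoc a.1 b.1 c.1)
  d_d n a := Subtype.ext (A.d_d n a.1)
  d_mul {m n} a b := Subtype.ext <| by
    have := A.d_mul a.1 b.1
    refine this.trans ?_
    rw [Submodule.coe_add, Submodule.coe_smul, coe_cast_sub P.S (Nat.add_right_comm m 1 n)]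
    rfl
where
  heq_sub (S : ∀ n, Submodule k (A.X n)) {i j : ℕ} (h : i = j) {a : S i} {b : S j}
      (hab : HEq (a : A.X i) (b : A.X j)) : HEq a b := by
    subst h; exact heq_of_eq (Subtype.ext (eq_of_heq hab))
  coe_cast_sub (S : ∀ n, Submodule k (A.X n)) {i j : ℕ} (h : i = j) (a : S i) :
      ((cast (congrArg (fun n => (S n : Type w)) h) a : S j) : A.X j) =
        cast (congrArg A.X h) (a : A.X i) := by
    subst h; rfl

end DGAlgebra

/-- Morphisms of differential graded algebras. -/
@[ext]
structure DGHom {k : Type uk} [Field k] (A : DGAlgebra.{uk, w} k) (B : DGAlgebra.{uk, w'} k) where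
  f : ∀ n, A.X n →ₗ[k] B.X n
  map_d : ∀ (n : ℕ) (a : A.X n), f (n + 1) (A.d n a) = B.d n (f n a)
  map_one : f 0 A.one = B.one
  map_mul : ∀ {m n : ℕ} (a : A.X m) (b : A.X n), f (m + n) (A.mul a b) = B.mul (f m a) (f n b)

namespace DGHom

variable {k : Type uk} [Field k] {A : DGAlgebra.{uk, w} k} {B : DGAlgebra.{uk, w'} k}

/-- The linear map induced by a morphism of DG-algebras on cohomology in degree `n`. -/
def mapH (F : DGHom A B) (n : ℕ) : A.H n →ₗ[k] B.H n :=
  Submodule.mapQ _ _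
    ((F.f n).restrict (p := A.Z n) (q := B.Z n) (fun a ha => by
      have ha' : A.d n a = 0 := ha
      change B.d n (F.f n a) = 0
      rw [← F.map_d, ha', map_zero]))
    (by
      rintro ⟨a, hz⟩ ha
      change a ∈ A.Bd n at ha
      change F.f n a ∈ B.Bd n
      cases n with
      | zero =>
        obtain rfl : a = 0 := ha
        rw [map_zero]; exact Submodule.zero_mem _
      | succ n =>
        obtain ⟨c, rfl⟩ := ha
        exact ⟨F.f n c, (F.map_d n c).symm⟩)

/-- The algebra morphism `H^*(A) → H^*(B)` induced by a morphism of DG-algebras. -/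
noncomputable def mapHAlg (F : DGHom A B) : A.HAlg →ₐ[k] B.HAlg :=
  DirectSum.toAlgebra k A.H (fun n => (DirectSum.lof k ℕ B.H n).comp (F.mapH n))
    (by
      rw [DirectSum.one_def]
      refine congrArg (DirectSum.of B.H 0) ?_
      exact congrArg (B.cls 0) (Subtype.ext F.map_one))
    (by
      intro m n a b
      refine Eq.trans ?_ (DirectSum.of_mul_of (A := B.H) (F.mapH m a) (F.mapH n b)).symm
      refine congrArg (DirectSum.of B.H (m + n)) ?_
      obtain ⟨a, rfl⟩ := A.cls_surjective _ a
      obtain ⟨b, rfl⟩ := A.cls_surjective _ b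
      exact congrArg (B.cls (m + n)) (Subtype.ext (F.map_mul a.1 b.1)))

theorem mapHAlg_of (F : DGHom A B) (n : ℕ) (a : A.H n) :
    F.mapHAlg (DirectSum.of A.H n a) = DirectSum.of B.H n (F.mapH n a) :=
  DirectSum.toAddMonoid_of _ _ _

end DGHom

namespace DGAlgebra

variable {k : Type uk} [Field k] (A : DGAlgebra.{uk, w} k)

/-- The inclusion of a sub-DG-algebra. -/
def subIncl (P : SubDG A) : DGHom (A.sub P) A where
  f n := (P.S n).subtype
  map_d _ _ := rfl
  map_one := rfl
  map_mul _ _ := rfl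

end DGAlgebra

namespace DGHom

variable {k : Type uk} [Field k]

/-- The identity morphism. -/
def id (A : DGAlgebra.{uk, w} k) : DGHom A A where
  f _ := LinearMap.id
  map_d _ _ := rfl
  map_one := rfl
  map_mul _ _ := rfl

/-- The composite `g ∘ f`. -/
def comp {A : DGAlgebra.{uk, w} k} {B : DGAlgebra.{uk, w'} k} {E : DGAlgebra.{uk, v} k}
    (g : DGHom B E) (f : DGHom A B) : DGHom A E where
  f n := (g.f n).comp (f.f n)
  map_d n a := by simp only [LinearMap.comp_apply, f.map_d, g.map_d]
  map_one := by simp only [LinearMap.comp_apply, f.map_one, g.map_one]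
  map_mul a b := by simp only [LinearMap.comp_apply, f.map_mul, g.map_mul]

/-- The restriction of a morphism to sub-DG-algebras. -/
def restrict {A : DGAlgebra.{uk, w} k} {B : DGAlgebra.{uk, w'} k} (F : DGHom A B)
    (P : A.SubDG) (Q : B.SubDG) (h : ∀ (n : ℕ) (a : A.X n), a ∈ P.S n → F.f n a ∈ Q.S n) :
    DGHom (A.sub P) (B.sub Q) where
  f n := (F.f n).restrict (h n)
  map_d n a := Subtype.ext (F.map_d n a.1)
  map_one := Subtype.ext F.map_one
  map_mul a b := Subtype.ext (F.map_mul a.1 b.1)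

end DGHom


section Strings

variable {C : Type u} [Category.{v} C]

/-- Strings of `n` composable morphisms `x 0 ⟶ x 1 ⟶ ⋯ ⟶ x n` along a sequence of objects. -/
abbrev Str {n : ℕ} (x : Fin (n + 1) → C) : Type v :=
  ∀ i : Fin n, x i.castSucc ⟶ x i.succ

/-- The composite `x a ⟶ x b` (for `a ≤ b`) of the morphisms `f a, …, f (b - 1)` of a string;
it is the identity for `a = b`. -/
noncomputable def chain {n : ℕ} (x : Fin (n + 1) → C) (f : Str x) {a b : Fin (n + 1)}
    (h : a ≤ b) : x a ⟶ x b :=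
  (ComposableArrows.mkOfObjOfMapSucc x f).map (homOfLE h)

theorem chain_self {n : ℕ} (x : Fin (n + 1) → C) (f : Str x) {a : Fin (n + 1)} (h : a ≤ a) :
    chain x f h = 𝟙 (x a) :=
  (ComposableArrows.mkOfObjOfMapSucc x f).map_id a

theorem chain_comp {n : ℕ} (x : Fin (n + 1) → C) (f : Str x) {a b c : Fin (n + 1)}
    (h : a ≤ b) (h' : b ≤ c) : chain x f h ≫ chain x f h' = chain x f (h.trans h') :=
  ((ComposableArrows.mkOfObjOfMapSucc x f).map_comp (homOfLE h) (homOfLE h')).symm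

theorem chain_succ {n : ℕ} (x : Fin (n + 1) → C) (f : Str x) (i : Fin n)
    (h : i.castSucc ≤ i.succ) : chain x f h = f i :=
  ComposableArrows.mkOfObjOfMapSucc_map_succ x f i.1 i.2

theorem chain_eq_eqToHom {N : ℕ} (x : Fin (N + 1) → C) (f : Str x) {a b : Fin (N + 1)}
    (h : a = b) : chain x f h.le = eqToHom (congrArg x h) := by
  subst h; rw [chain_self, eqToHom_refl]

/-- To prove a multiplicative property of all composites `chain x f h`, check it for identities
and for extension by one morphism. -/
theorem chain_induction {n : ℕ} (x : Fin (n + 1) → C) (f : Str x) (a : Fin (n + 1))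
    (P : ∀ b, a ≤ b → (x a ⟶ x b) → Prop) (hid : P a le_rfl (𝟙 _))
    (hs : ∀ (i : Fin n) (h : a ≤ i.castSucc) (h' : a ≤ i.succ),
      P i.castSucc h (chain x f h) → P i.succ h' (chain x f h ≫ f i))
    {b : Fin (n + 1)} (h : a ≤ b) : P b h (chain x f h) := by
  induction b using Fin.induction with
  | zero =>
    obtain rfl : a = 0 := le_antisymm h (Fin.zero_le _)
    rw [chain_self]; exact hid
  | succ i ih =>
    rcases h.eq_or_lt with rfl | hlt
    · rw [chain_self]; exact hid
    · have hle : a ≤ i.castSucc := by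
        rw [Fin.le_def]; rw [Fin.lt_def] at hlt; simp at hlt ⊢; omega
      have := hs i hle h (ih hle)
      rwa [← chain_succ x f i (Fin.castSucc_lt_succ).le, chain_comp] at this

theorem mono {m n : ℕ} (σ : Fin (n + 1) →o Fin (m + 1)) {i j : Fin (n + 1)} (h : i ≤ j) :
    σ i ≤ σ j := σ.monotone h

theorem map_le_comp {l m n : ℕ} (τ : Fin (m + 1) →o Fin (l + 1)) {σ : Fin (n + 1) →o Fin (m + 1)}
    {a : Fin (m + 1)} {i : Fin (n + 1)} (h : a ≤ σ i) : τ a ≤ (τ.comp σ) i := τ.monotone h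

theorem comp_le_map {l m n : ℕ} (τ : Fin (m + 1) →o Fin (l + 1)) {σ : Fin (n + 1) →o Fin (m + 1)}
    {b : Fin (m + 1)} {i : Fin (n + 1)} (h : σ i ≤ b) : (τ.comp σ) i ≤ τ b := τ.monotone h

theorem le_comp {l m n : ℕ} {τ : Fin (m + 1) →o Fin (l + 1)} (σ : Fin (n + 1) →o Fin (m + 1))
    {a : Fin (l + 1)} (i : Fin (n + 1)) (h : a ≤ τ 0) : a ≤ (τ.comp σ) i :=
  h.trans (τ.monotone (Fin.zero_le _))

theorem comp_le {l m n : ℕ} {τ : Fin (m + 1) →o Fin (l + 1)} (σ : Fin (n + 1) →o Fin (m + 1))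
    {b : Fin (l + 1)} (i : Fin (n + 1)) (h : τ (Fin.last m) ≤ b) : (τ.comp σ) i ≤ b :=
  (τ.monotone (Fin.le_last _)).trans h

/-- The string obtained from `(x, f)` by keeping only the objects `x (σ 0), …, x (σ n)` and
composing the morphisms in between. -/
noncomputable def pull {m n : ℕ} (σ : Fin (n + 1) →o Fin (m + 1)) (x : Fin (m + 1) → C)
    (f : Str x) : Str (fun i => x (σ i)) :=
  fun i => chain x f (mono σ (Fin.castSucc_lt_succ (i := i)).le)

theorem chain_pull {m n : ℕ} (σ : Fin (n + 1) →o Fin (m + 1)) (x : Fin (m + 1) → C)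
    (f : Str x) {a b : Fin (n + 1)} (h : a ≤ b) :
    chain (fun i => x (σ i)) (pull σ x f) h = chain x f (mono σ h) := by
  refine chain_induction (fun i => x (σ i)) (pull σ x f) a
    (fun b h g => g = chain x f (mono σ h)) ?_ ?_ h
  · rw [chain_self]
  · intro i h h' ih
    rw [ih, pull, chain_comp]

theorem pull_pull {l m n : ℕ} (σ : Fin (n + 1) →o Fin (m + 1)) (τ : Fin (m + 1) →o Fin (l + 1))
    (x : Fin (l + 1) → C) (f : Str x) :
    pull σ (fun i => x (τ i)) (pull τ x f) = pull (τ.comp σ) x f := by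
  funext i
  exact chain_pull τ x f _

section Update

variable {n : ℕ} (x : Fin (n + 1) → C) (f : Str x)

theorem chain_congr {f g : Str x} {a b : Fin (n + 1)} (h : a ≤ b)
    (hfg : ∀ i : Fin n, a ≤ i.castSucc → i.succ ≤ b → f i = g i) :
    chain x f h = chain x g h := by
  revert hfg
  refine chain_induction x f a (fun b h q =>
    (∀ i : Fin n, a ≤ i.castSucc → i.succ ≤ b → f i = g i) → q = chain x g h) ?_ ?_ h
  · intro _; rw [chain_self]
  · intro i h h' ih hfg
    rw [ih (fun j hj hj' => hfg j hj (hj'.trans (Fin.castSucc_lt_succ).le)), hfg i h le_rfl,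
      ← chain_succ x g i (Fin.castSucc_lt_succ).le, chain_comp]

theorem chain_update_of_not (j : Fin n) (q : x j.castSucc ⟶ x j.succ) {a b : Fin (n + 1)}
    (h : a ≤ b) (hj : ¬ (a ≤ j.castSucc ∧ j.succ ≤ b)) :
    chain x (Function.update f j q) h = chain x f h := by
  refine chain_congr x h fun i hi hi' => Function.update_of_ne ?_ _ _
  rintro rfl
  exact hj ⟨hi, hi'⟩

theorem chain_update (j : Fin n) (q : x j.castSucc ⟶ x j.succ) {a b : Fin (n + 1)}
    (ha : a ≤ j.castSucc) (hb : j.succ ≤ b) :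
    chain x (Function.update f j q) ((ha.trans (Fin.castSucc_lt_succ).le).trans hb) =
      chain x f ha ≫ q ≫ chain x f hb := by
  rw [← chain_comp x _ (ha.trans (Fin.castSucc_lt_succ).le) hb,
    ← chain_comp x _ ha (Fin.castSucc_lt_succ).le, chain_succ, Function.update_self,
    chain_update_of_not, chain_update_of_not, Category.assoc]
  · rintro ⟨h, -⟩
    exact absurd h (not_le.2 Fin.castSucc_lt_succ)
  · rintro ⟨-, h⟩
    exact absurd h (not_le.2 Fin.castSucc_lt_succ)

/-- Every morphism of a string enters exactly one of the composites cut out by `σ`. -/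
theorem exists_gap {m n : ℕ} (σ : Fin (n + 1) →o Fin (m + 1)) (j : Fin m)
    (h0 : σ 0 ≤ j.castSucc) (h1 : j.succ ≤ σ (Fin.last n)) :
    ∃ l : Fin n, σ l.castSucc ≤ j.castSucc ∧ j.succ ≤ σ l.succ := by
  by_contra! hcon
  have : ∀ i : Fin (n + 1), σ i ≤ j.castSucc := by
    intro i
    induction i using Fin.induction with
    | zero => exact h0
    | succ i ih =>
      have := hcon i ih
      rw [Fin.lt_def] at this
      rw [Fin.le_def]
      simp at this ⊢
      omega
  exact absurd (h1.trans (this (Fin.last n))) (not_le.2 Fin.castSucc_lt_succ)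

theorem pull_update_of_not {m n : ℕ} (σ : Fin (n + 1) →o Fin (m + 1)) (x : Fin (m + 1) → C)
    (f : Str x) (j : Fin m) (q : x j.castSucc ⟶ x j.succ)
    (hj : ¬ (σ 0 ≤ j.castSucc ∧ j.succ ≤ σ (Fin.last n))) :
    pull σ x (Function.update f j q) = pull σ x f := by
  funext i
  refine chain_update_of_not x f j q _ fun h => hj ⟨?_, ?_⟩
  · exact (σ.monotone (Fin.zero_le _)).trans h.1
  · exact h.2.trans (σ.monotone (Fin.le_last _))

theorem pull_update {m n : ℕ} (σ : Fin (n + 1) →o Fin (m + 1)) (x : Fin (m + 1) → C)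
    (f : Str x) (j : Fin m) (l : Fin n) (ha : σ l.castSucc ≤ j.castSucc) (hb : j.succ ≤ σ l.succ)
    (q : x j.castSucc ⟶ x j.succ) :
    pull σ x (Function.update f j q) =
      Function.update (pull σ x f) l (chain x f ha ≫ q ≫ chain x f hb) := by
  funext i
  by_cases hi : i = l
  · subst hi
    rw [Function.update_self]
    exact chain_update x f j q ha hb
  · rw [Function.update_of_ne hi]
    refine chain_update_of_not x f j q _ ?_
    rintro ⟨h, h'⟩
    rcases lt_or_gt_of_ne hi with hlt | hlt
    · have : σ i.succ ≤ σ l.castSucc := σ.monotone (by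
        rw [Fin.le_def]; rw [Fin.lt_def] at hlt; simp; omega)
      exact absurd ((h'.trans this).trans ha) (not_le.2 Fin.castSucc_lt_succ)
    · have : σ l.succ ≤ σ i.castSucc := σ.monotone (by
        rw [Fin.le_def]; rw [Fin.lt_def] at hlt; simp; omega)
      exact absurd ((hb.trans this).trans h) (not_le.2 Fin.castSucc_lt_succ)

end Update

end Strings

section Cochains

variable (k : Type uk) [Field k] (C : Type u) [Category.{v} C] [Preadditive C] [Linear k C]

/-- Hochschild-Mitchell `n`-cochains of a `k`-category: families, indexed by the sequences
`x 0, …, x n` of objects, of `k`-multilinear maps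
`Hom(x 0, x 1) × ⋯ × Hom(x (n-1), x n) → Hom(x 0, x n)`.
For `n = 0` this is the product of the spaces `Hom(x, x)`. -/
abbrev Cochain (n : ℕ) : Type (max u v) :=
  ∀ x : Fin (n + 1) → C,
    MultilinearMap k (fun i : Fin n => (x i.castSucc ⟶ x i.succ)) (x 0 ⟶ x (Fin.last n))

variable {k C}

/-- The morphism
`(x a ⟶ x (ρ 0)) ≫ φ (x ∘ ρ, f composed along ρ) ≫ (x (ρ n) ⟶ x b)`
attached to a cochain `φ`, a string `(x, f)` of length `N` and a monotone map
`ρ : {0, …, n} → {a, …, b} ⊆ {0, …, N}`. -/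
noncomputable def seg {n N : ℕ} (φ : Cochain k C n) (ρ : Fin (n + 1) →o Fin (N + 1))
    {a b : Fin (N + 1)} (ha : a ≤ ρ 0) (hb : ρ (Fin.last n) ≤ b) (x : Fin (N + 1) → C)
    (f : Str x) : x a ⟶ x b :=
  chain x f ha ≫ φ (fun i => x (ρ i)) (pull ρ x f) ≫ chain x f hb

theorem chain_seg {n N : ℕ} (φ : Cochain k C n) (ρ : Fin (n + 1) →o Fin (N + 1))
    {c a b : Fin (N + 1)} (hc : c ≤ a) (ha : a ≤ ρ 0) (hb : ρ (Fin.last n) ≤ b)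
    (x : Fin (N + 1) → C) (f : Str x) :
    chain x f hc ≫ seg φ ρ ha hb x f = seg φ ρ (hc.trans ha) hb x f := by
  rw [seg, seg, ← Category.assoc, chain_comp]

theorem seg_chain {n N : ℕ} (φ : Cochain k C n) (ρ : Fin (n + 1) →o Fin (N + 1))
    {a b c : Fin (N + 1)} (ha : a ≤ ρ 0) (hb : ρ (Fin.last n) ≤ b) (hc : b ≤ c)
    (x : Fin (N + 1) → C) (f : Str x) :
    seg φ ρ ha hb x f ≫ chain x f hc = seg φ ρ ha (hb.trans hc) x f := by
  rw [seg, seg, Category.assoc, Category.assoc, chain_comp]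

theorem seg_pull {l m n : ℕ} (φ : Cochain k C n) (σ : Fin (n + 1) →o Fin (m + 1))
    (τ : Fin (m + 1) →o Fin (l + 1)) {a b : Fin (m + 1)} (ha : a ≤ σ 0)
    (hb : σ (Fin.last n) ≤ b) (x : Fin (l + 1) → C) (f : Str x) :
    seg φ σ ha hb (fun i => x (τ i)) (pull τ x f) =
      seg φ (τ.comp σ) (map_le_comp τ ha) (comp_le_map τ hb) x f := by
  rw [seg, chain_pull, chain_pull, pull_pull]
  rfl

theorem seg_congr {n N : ℕ} (φ : Cochain k C n) {ρ σ : Fin (n + 1) →o Fin (N + 1)}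
    (e : ∀ i, (ρ i : ℕ) = σ i) {a b : Fin (N + 1)} (ha : a ≤ ρ 0) (hb : ρ (Fin.last n) ≤ b)
    (ha' : a ≤ σ 0) (hb' : σ (Fin.last n) ≤ b) (x : Fin (N + 1) → C) (f : Str x) :
    seg φ ρ ha hb x f = seg φ σ ha' hb' x f := by
  obtain rfl : ρ = σ := OrderHom.ext _ _ (funext fun i => Fin.ext (e i))
  rfl

theorem seg_update_of_not {n N : ℕ} (φ : Cochain k C n) (ρ : Fin (n + 1) →o Fin (N + 1))
    {a b : Fin (N + 1)} (ha : a ≤ ρ 0) (hb : ρ (Fin.last n) ≤ b) (x : Fin (N + 1) → C)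
    (f : Str x) (j : Fin N) (q : x j.castSucc ⟶ x j.succ)
    (hj : ¬ (a ≤ j.castSucc ∧ j.succ ≤ b)) :
    seg φ ρ ha hb x (Function.update f j q) = seg φ ρ ha hb x f := by
  have h0 := ρ.monotone (Fin.zero_le (Fin.last n))
  rw [seg, seg, chain_update_of_not, chain_update_of_not, pull_update_of_not]
  · exact fun h => hj ⟨ha.trans h.1, h.2.trans hb⟩
  · exact fun h => hj ⟨(ha.trans h0).trans h.1, h.2⟩
  · exact fun h => hj ⟨h.1, (h.2.trans h0).trans hb⟩

/-- `seg` depends linearly on each morphism of the string between `a` and `b`. -/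
theorem seg_update_linear {n N : ℕ} (φ : Cochain k C n) (ρ : Fin (n + 1) →o Fin (N + 1))
    {a b : Fin (N + 1)} (ha : a ≤ ρ 0) (hb : ρ (Fin.last n) ≤ b) (x : Fin (N + 1) → C)
    (f : Str x) (j : Fin N) (hja : a ≤ j.castSucc) (hjb : j.succ ≤ b) :
    IsLinearMap k (fun q => seg φ ρ ha hb x (Function.update f j q)) := by
  by_cases h0 : ρ 0 ≤ j.castSucc
  · have e0 : ∀ q, chain x (Function.update f j q) ha = chain x f ha := fun q =>
      chain_update_of_not x f j q _ (fun h => absurd (h.2.trans h0) (not_le.2 Fin.castSucc_lt_succ))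
    by_cases h1 : j.succ ≤ ρ (Fin.last n)
    · obtain ⟨l, hl, hl'⟩ := exists_gap ρ j h0 h1
      have e1 : ∀ q, chain x (Function.update f j q) hb = chain x f hb := fun q =>
        chain_update_of_not x f j q _
          (fun h => absurd (h1.trans h.1) (not_le.2 Fin.castSucc_lt_succ))
      constructor
      · intro p q
        simp only [seg, e0, e1, pull_update ρ x f j l hl hl', Preadditive.add_comp,
            Preadditive.comp_add, MultilinearMap.map_update_add]
      · intro c q
        simp only [seg, e0, e1, pull_update ρ x f j l hl hl', Linear.smul_comp,
            Linear.comp_smul, MultilinearMap.map_update_smul]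
    · have hj : ρ (Fin.last n) ≤ j.castSucc := by
        rw [Fin.le_def] at h1 ⊢; simp at h1 ⊢; omega
      have e1 : ∀ q, chain x (Function.update f j q) hb =
          chain x f hj ≫ q ≫ chain x f hjb := fun q => chain_update x f j q hj hjb
      constructor
      · intro p q
        simp only [seg, e0, e1, pull_update_of_not ρ x f j _ (fun h => h1 h.2),
          Preadditive.add_comp, Preadditive.comp_add]
      · intro c q
        simp only [seg, e0, e1, pull_update_of_not ρ x f j _ (fun h => h1 h.2), Linear.smul_comp,
          Linear.comp_smul]
  · have hj : j.succ ≤ ρ 0 := by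
      rw [Fin.le_def] at h0 ⊢; simp at h0 ⊢; omega
    have e1 : ∀ q, chain x (Function.update f j q) hb = chain x f hb := fun q =>
      chain_update_of_not x f j q _ (fun h => h0 ((ρ.monotone (Fin.zero_le _)).trans h.1))
    have e0 : ∀ q, chain x (Function.update f j q) ha =
        chain x f hja ≫ q ≫ chain x f hj := fun q => chain_update x f j q hja hj
    constructor
    · intro p q
      simp only [seg, e0, e1, pull_update_of_not ρ x f j _ (fun h => h0 h.1),
        Preadditive.add_comp, Preadditive.comp_add]
    · intro c q
      simp only [seg, e0, e1, pull_update_of_not ρ x f j _ (fun h => h0 h.1), Linear.smul_comp,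
        Linear.comp_smul]

/-- The operator on cochains attached to a monotone map `σ : {0, …, n} → {0, …, m}`: it sends
`φ` to the cochain
`(x, f) ↦ (x 0 ⟶ x (σ 0)) ≫ φ (x ∘ σ, f composed along σ) ≫ (x (σ n) ⟶ x m)`. -/
noncomputable def op {m n : ℕ} (σ : Fin (n + 1) →o Fin (m + 1)) :
    Cochain k C n →ₗ[k] Cochain k C m where
  toFun φ := fun x => MultilinearMap.mk'
    (fun f => seg φ σ (Fin.zero_le _) (Fin.le_last _) x f)
    (fun f j p q =>
      (seg_update_linear φ σ _ _ x f j (Fin.zero_le _) (Fin.le_last _)).map_add p q)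
    (fun f j c q =>
      (seg_update_linear φ σ _ _ x f j (Fin.zero_le _) (Fin.le_last _)).map_smul c q)
  map_add' φ ψ := by
    funext x; ext f
    simp [MultilinearMap.mk', seg]
  map_smul' c φ := by
    funext x; ext f
    simp [MultilinearMap.mk', seg]

theorem op_apply {m n : ℕ} (σ : Fin (n + 1) →o Fin (m + 1)) (φ : Cochain k C n)
    (x : Fin (m + 1) → C) (f : Str x) :
    op σ φ x f = seg φ σ (Fin.zero_le _) (Fin.le_last _) x f := rfl

theorem op_id {n : ℕ} (φ : Cochain k C n) : op (OrderHom.id) φ = φ := by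
  funext x; ext f
  have : pull OrderHom.id x f = f := by
    funext i; exact chain_succ x f i _
  rw [op_apply, seg, this]
  exact (congrArg₂ (fun a b => a ≫ φ x f ≫ b) (chain_self x f _) (chain_self x f _)).trans
    (by rw [Category.comp_id, Category.id_comp])

theorem seg_op {m n N : ℕ} (φ : Cochain k C n) (τ : Fin (n + 1) →o Fin (m + 1))
    (ρ : Fin (m + 1) →o Fin (N + 1)) {a b : Fin (N + 1)} (ha : a ≤ ρ 0)
    (hb : ρ (Fin.last m) ≤ b) (x : Fin (N + 1) → C) (f : Str x) :
    seg (op τ φ) ρ ha hb x f = seg φ (ρ.comp τ) (le_comp τ 0 ha) (comp_le τ _ hb) x f := by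
  rw [seg, op_apply, seg_pull, seg_chain, chain_seg]

theorem op_comp {l m n : ℕ} (σ : Fin (n + 1) →o Fin (m + 1)) (τ : Fin (m + 1) →o Fin (l + 1))
    (φ : Cochain k C n) : op (τ.comp σ) φ = op τ (op σ φ) := by
  funext x; ext f
  rw [op_apply, op_apply, seg_op]

/-- The monotone map `{0, …, n} → {0, …, n + 1}` that skips `i`. -/
def skip {n : ℕ} (i : Fin (n + 2)) : Fin (n + 1) →o Fin (n + 2) :=
  ⟨i.succAbove, (Fin.strictMono_succAbove i).monotone⟩

/-- The Hochschild coboundary `dφ = ∑ (-1)^i δ_i φ`, `0 ≤ i ≤ n + 1`, where `δ_i φ` evaluates `φ`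
on the string from which the object `x i` is removed. Explicitly, on `(f 0, …, f n)`:
`δ_0 φ` is `φ (f 1, …, f n) ∘ f 0`; for `0 < i < n + 1`, `δ_i φ` is
`φ (f 0, …, f i ∘ f (i-1), …, f n)`; and `δ_{n+1} φ` is `f n ∘ φ (f 0, …, f (n-1))`. -/
noncomputable def coboundary (n : ℕ) : Cochain k C n →ₗ[k] Cochain k C (n + 1) :=
  ∑ i : Fin (n + 2), (-1 : k) ^ (i : ℕ) • op (skip i)

/-- The cochains as a cosimplicial `k`-module. -/
noncomputable def cosimp : CosimplicialObject (ModuleCat.{max u v} k) where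
  obj n := ModuleCat.of k (Cochain k C n.len)
  map σ := ModuleCat.ofHom (op (SimplexCategory.Hom.toOrderHom σ))
  map_id n := by
    refine ModuleCat.hom_ext (LinearMap.ext fun φ => ?_)
    exact op_id φ
  map_comp σ τ := by
    refine ModuleCat.hom_ext (LinearMap.ext fun φ => ?_)
    exact op_comp _ _ φ

theorem hom_altSum {M N : ModuleCat.{w} k} (m : ℕ) (g : Fin m → (M ⟶ N)) :
    (∑ i : Fin m, (-1 : ℤ) ^ (i : ℕ) • g i).hom = ∑ i : Fin m, (-1 : k) ^ (i : ℕ) • (g i).hom := by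
  rw [ModuleCat.hom_sum]
  refine Finset.sum_congr rfl fun i _ => ?_
  have : ((-1 : k) ^ (i : ℕ)) = (((-1 : ℤ) ^ (i : ℕ) : ℤ) : k) := by push_cast; rfl
  rw [this, Int.cast_smul_eq_zsmul, ModuleCat.hom_zsmul]

theorem coboundary_eq (n : ℕ) : coboundary (k := k) (C := C) n =
    (AlgebraicTopology.AlternatingCofaceMapComplex.objD (cosimp (k := k) (C := C)) n).hom :=
  (hom_altSum (n + 2) fun i => (cosimp (k := k) (C := C)).δ i).symm

theorem coboundary_coboundary (n : ℕ) (φ : Cochain k C n) :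
    coboundary (n + 1) (coboundary n φ) = 0 := by
  have h := AlgebraicTopology.AlternatingCofaceMapComplex.d_squared (cosimp (k := k) (C := C)) n
  rw [coboundary_eq, coboundary_eq]
  exact congrArg (fun t => t.hom φ) h

end Cochains

section Cup

variable {k : Type uk} [Field k] {C : Type u} [Category.{v} C] [Preadditive C] [Linear k C]

/-- The inclusion of `{0, …, n}` as the first `n + 1` elements of `{0, …, m + n}`. -/
def front (m n : ℕ) : Fin (n + 1) →o Fin (m + n + 1) :=
  ⟨fun i => ⟨i.1, by omega⟩, fun _ _ h => h⟩

/-- The inclusion of `{0, …, m}` as the last `m + 1` elements of `{0, …, m + n}`. -/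
def back (m n : ℕ) : Fin (m + 1) →o Fin (m + n + 1) :=
  ⟨fun i => ⟨n + i.1, by omega⟩, fun _ _ h => Nat.add_le_add_left h n⟩

/-- The element of `{0, …, m + n}` at which the front and the back part meet. -/
def mid (m n : ℕ) : Fin (m + n + 1) := ⟨n, by omega⟩

theorem front_last_le (m n : ℕ) : front m n (Fin.last n) ≤ mid m n := le_rfl

theorem mid_le_back (m n : ℕ) : mid m n ≤ back m n 0 := le_rfl

theorem back_last (m n : ℕ) : back m n (Fin.last m) = Fin.last (m + n) :=
  Fin.ext (show n + m = m + n from Nat.add_comm n m)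

/-- The cup product
`(ψ ⌣ φ)(f 0, …, f (m+n-1)) = ψ (f n, …, f (m+n-1)) ∘ φ (f 0, …, f (n-1))`; the value of `φ` is
a morphism `x 0 ⟶ x n` and the value of `ψ` is a morphism `x n ⟶ x (m + n)`
(see `cupFun_eq` for the formula without `seg`). -/
noncomputable def cupFun {m n : ℕ} (ψ : Cochain k C m) (φ : Cochain k C n) :
    Cochain k C (m + n) := fun x => MultilinearMap.mk'
  (fun f : Str x =>
    seg φ (front m n) (Fin.zero_le _) (front_last_le m n) x f ≫
      seg ψ (back m n) (mid_le_back m n) (Fin.le_last _) x f)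
  (by
    intro f j p q
    by_cases hj : j.succ ≤ mid m n
    · have hn : ¬ (mid m n ≤ j.castSucc ∧ j.succ ≤ Fin.last (m + n)) := fun h =>
        absurd (hj.trans h.1) (not_le.2 Fin.castSucc_lt_succ)
      simp only [seg_update_of_not ψ _ _ _ x f j _ hn]
      rw [← Preadditive.add_comp]
      exact congrArg (· ≫ _) ((seg_update_linear φ _ _ _ x f j (Fin.zero_le _) hj).map_add p q)
    · have hj' : mid m n ≤ j.castSucc := by
        rw [Fin.le_def] at hj ⊢; simp at hj ⊢; omega
      simp only [seg_update_of_not φ _ _ _ x f j _ (fun h => hj h.2)]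
      rw [← Preadditive.comp_add]
      exact congrArg (_ ≫ ·) ((seg_update_linear ψ _ _ _ x f j hj' (Fin.le_last _)).map_add p q))
  (by
    intro f j c q
    by_cases hj : j.succ ≤ mid m n
    · have hn : ¬ (mid m n ≤ j.castSucc ∧ j.succ ≤ Fin.last (m + n)) := fun h =>
        absurd (hj.trans h.1) (not_le.2 Fin.castSucc_lt_succ)
      simp only [seg_update_of_not ψ _ _ _ x f j _ hn]
      rw [← Linear.smul_comp]
      exact congrArg (· ≫ _) ((seg_update_linear φ _ _ _ x f j (Fin.zero_le _) hj).map_smul c q)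
    · have hj' : mid m n ≤ j.castSucc := by
        rw [Fin.le_def] at hj ⊢; simp at hj ⊢; omega
      simp only [seg_update_of_not φ _ _ _ x f j _ (fun h => hj h.2)]
      rw [← Linear.comp_smul]
      exact congrArg (_ ≫ ·) ((seg_update_linear ψ _ _ _ x f j hj' (Fin.le_last _)).map_smul c q))

theorem cupFun_apply {m n : ℕ} (ψ : Cochain k C m) (φ : Cochain k C n)
    (x : Fin (m + n + 1) → C) (f : Str x) :
    cupFun ψ φ x f = seg φ (front m n) (Fin.zero_le _) (front_last_le m n) x f ≫
      seg ψ (back m n) (mid_le_back m n) (Fin.le_last _) x f := rfl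

/-- The cup product, explicitly; the final `eqToHom` identifies `x (n + m)` with `x (m + n)`. -/
theorem cupFun_eq {m n : ℕ} (ψ : Cochain k C m) (φ : Cochain k C n)
    (x : Fin (m + n + 1) → C) (f : Str x) :
    cupFun ψ φ x f =
      (φ (fun i => x ⟨i.1, by omega⟩) (fun i => f ⟨i.1, by omega⟩) :
          x 0 ⟶ x ⟨n, by omega⟩) ≫
        (ψ (fun i => x ⟨n + i.1, by omega⟩) (fun i => f ⟨n + i.1, by omega⟩) :
          x ⟨n, by omega⟩ ⟶ x ⟨n + m, by omega⟩) ≫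
        eqToHom (congrArg x (back_last m n)) := by
  have hf : pull (front m n) x f = fun i : Fin n => f ⟨i.1, by omega⟩ := by
    funext i
    exact chain_succ x f ⟨i.1, by omega⟩ _
  have hb : pull (back m n) x f = fun i : Fin m => f ⟨n + i.1, by omega⟩ := by
    funext i
    exact chain_succ x f ⟨n + i.1, by omega⟩ _
  have e : ∀ {X Y Z W : C} (p : X ⟶ Y) (q : Y ⟶ Z) (r : Z ⟶ W),
      (𝟙 X ≫ p ≫ 𝟙 Y) ≫ (𝟙 Y ≫ q ≫ r) = p ≫ q ≫ r := by
    intros; simp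
  rw [cupFun_apply, seg, seg, hf, hb,
    chain_eq_eqToHom x f (a := back m n (Fin.last m)) (b := Fin.last (m + n))
      (back_last m n)]
  refine Eq.trans ?_ (e (X := x 0) (Y := x ⟨n, by omega⟩) (Z := x ⟨n + m, by omega⟩)
    (φ (fun i => x ⟨i.1, by omega⟩) (fun i => f ⟨i.1, by omega⟩))
    (ψ (fun i => x ⟨n + i.1, by omega⟩) (fun i => f ⟨n + i.1, by omega⟩))
    (eqToHom (congrArg x (back_last m n))))
  rw [← chain_self x f (le_refl (0 : Fin (m + n + 1))),
    ← chain_self x f (le_refl (⟨n, by omega⟩ : Fin (m + n + 1)))]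
  rfl

theorem seg_cup {m n N : ℕ} (ψ : Cochain k C m) (φ : Cochain k C n)
    (ρ : Fin (m + n + 1) →o Fin (N + 1)) {a b : Fin (N + 1)} (ha : a ≤ ρ 0)
    (hb : ρ (Fin.last (m + n)) ≤ b) (x : Fin (N + 1) → C) (f : Str x) :
    seg (cupFun ψ φ) ρ ha hb x f =
      seg φ (ρ.comp (front m n)) (le_comp _ _ ha) (comp_le_map ρ (front_last_le m n)) x f ≫
      seg ψ (ρ.comp (back m n)) (map_le_comp ρ (mid_le_back m n)) (comp_le _ _ hb) x f := by
  rw [seg, cupFun_apply, seg_pull, seg_pull, Category.assoc, seg_chain, ← Category.assoc,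
    chain_seg]

/-- The composite of a `φ`-segment and a `ψ`-segment does not depend on the choice of the
intermediate object, and depends on the monotone maps only through their values. -/
theorem seg_seg_congr {m n N : ℕ} (ψ : Cochain k C m) (φ : Cochain k C n)
    {ρ σ : Fin (n + 1) →o Fin (N + 1)} {ρ' σ' : Fin (m + 1) →o Fin (N + 1)}
    (e : ∀ i, (ρ i : ℕ) = σ i) (e' : ∀ i, (ρ' i : ℕ) = σ' i) {a b c d : Fin (N + 1)}
    (ha : a ≤ ρ 0) (hc : ρ (Fin.last n) ≤ c) (hc' : c ≤ ρ' 0) (hb : ρ' (Fin.last m) ≤ b)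
    (ha' : a ≤ σ 0) (hd : σ (Fin.last n) ≤ d) (hd' : d ≤ σ' 0) (hb' : σ' (Fin.last m) ≤ b)
    (x : Fin (N + 1) → C) (f : Str x) :
    seg φ ρ ha hc x f ≫ seg ψ ρ' hc' hb x f = seg φ σ ha' hd x f ≫ seg ψ σ' hd' hb' x f := by
  obtain rfl : ρ = σ := OrderHom.ext _ _ (funext fun i => Fin.ext (e i))
  obtain rfl : ρ' = σ' := OrderHom.ext _ _ (funext fun i => Fin.ext (e' i))
  rw [← seg_chain φ ρ ha le_rfl hc, ← seg_chain φ ρ ha le_rfl hd, Category.assoc, Category.assoc,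
    chain_seg, chain_seg]

/-- The identification `{0, …, a} = {0, …, b}` for `a = b`. -/
def castHom {a b : ℕ} (h : a = b) : Fin (a + 1) →o Fin (b + 1) :=
  ⟨fun i => ⟨i.1, by omega⟩, fun _ _ h => h⟩

theorem cast_eq_op {a b : ℕ} (h : a = b) (Φ : Cochain k C a) :
    cast (congrArg (Cochain k C) h) Φ = op (castHom h) Φ := by
  subst h; exact (op_id Φ).symm

theorem heq_of_op {a b : ℕ} (h : a = b) {Φ : Cochain k C a} {Ψ : Cochain k C b}
    (e : op (castHom h) Φ = Ψ) : HEq Φ Ψ := by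
  subst h; rw [← e]; exact heq_of_eq (op_id Φ).symm

variable (k C) in
/-- The cup product as a bilinear map. -/
noncomputable def cup {m n : ℕ} : Cochain k C m →ₗ[k] Cochain k C n →ₗ[k] Cochain k C (m + n) :=
  LinearMap.mk₂ k cupFun
    (fun ψ ψ' φ => by funext x; ext f; simp [cupFun, seg])
    (fun c ψ φ => by funext x; ext f; simp [cupFun, seg])
    (fun ψ φ φ' => by funext x; ext f; simp [cupFun, seg])
    (fun c ψ φ => by funext x; ext f; simp [cupFun, seg])

theorem cup_apply {m n : ℕ} (ψ : Cochain k C m) (φ : Cochain k C n) :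
    cup k C ψ φ = cupFun ψ φ := rfl

variable (k C) in
/-- The unit of the cup product: the family of identities. -/
noncomputable def unitCochain : Cochain k C 0 := fun x =>
  MultilinearMap.constOfIsEmpty k _ (𝟙 (x 0))

theorem seg_unit {N : ℕ} (ρ : Fin (0 + 1) →o Fin (N + 1)) {a b : Fin (N + 1)} (ha : a ≤ ρ 0)
    (hb : ρ 0 ≤ b) (x : Fin (N + 1) → C) (f : Str x) :
    seg (unitCochain k C) ρ ha hb x f = chain x f (ha.trans hb) := by
  rw [← chain_comp x f ha hb]
  refine Eq.trans ?_ (congrArg (chain x f ha ≫ ·) (Category.id_comp (chain x f hb)))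
  rfl

theorem unit_cup {n : ℕ} (φ : Cochain k C n) : HEq (cup k C (unitCochain k C) φ) φ := by
  refine heq_of_op (Nat.zero_add n) ?_
  rw [cup_apply]
  refine Eq.trans ?_ (op_id φ)
  funext x; ext f
  rw [op_apply, seg_cup, seg_unit, seg_chain, op_apply]
  exact seg_congr φ (fun _ => rfl) _ _ _ _ x f

theorem cup_unit {n : ℕ} (φ : Cochain k C n) : HEq (cup k C φ (unitCochain k C)) φ := by
  refine heq_of_op (Nat.add_zero n) ?_
  rw [cup_apply]
  refine Eq.trans ?_ (op_id φ)
  funext x; ext f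
  rw [op_apply, seg_cup, seg_unit, chain_seg, op_apply]
  exact seg_congr φ (fun i => Nat.zero_add i) _ _ _ _ x f

theorem seg_seg_seg_congr {l m n N : ℕ} (a : Cochain k C l) (b : Cochain k C m)
    (c : Cochain k C n) {ρ σ : Fin (n + 1) →o Fin (N + 1)} {ρ' σ' : Fin (m + 1) →o Fin (N + 1)}
    {ρ'' σ'' : Fin (l + 1) →o Fin (N + 1)} (e : ∀ i, (ρ i : ℕ) = σ i)
    (e' : ∀ i, (ρ' i : ℕ) = σ' i) (e'' : ∀ i, (ρ'' i : ℕ) = σ'' i)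
    {s t p q p' q' : Fin (N + 1)} (hp : (p : ℕ) = p') (hq : (q : ℕ) = q')
    (h1 : s ≤ ρ 0) (h2 : ρ (Fin.last n) ≤ p) (h3 : p ≤ ρ' 0) (h4 : ρ' (Fin.last m) ≤ q)
    (h5 : q ≤ ρ'' 0) (h6 : ρ'' (Fin.last l) ≤ t)
    (h1' : s ≤ σ 0) (h2' : σ (Fin.last n) ≤ p') (h3' : p' ≤ σ' 0) (h4' : σ' (Fin.last m) ≤ q')
    (h5' : q' ≤ σ'' 0) (h6' : σ'' (Fin.last l) ≤ t)
    (x : Fin (N + 1) → C) (f : Str x) :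
    seg c ρ h1 h2 x f ≫ seg b ρ' h3 h4 x f ≫ seg a ρ'' h5 h6 x f =
      (seg c σ h1' h2' x f ≫ seg b σ' h3' h4' x f) ≫ seg a σ'' h5' h6' x f := by
  obtain rfl : ρ = σ := OrderHom.ext _ _ (funext fun i => Fin.ext (e i))
  obtain rfl : ρ' = σ' := OrderHom.ext _ _ (funext fun i => Fin.ext (e' i))
  obtain rfl : ρ'' = σ'' := OrderHom.ext _ _ (funext fun i => Fin.ext (e'' i))
  obtain rfl : p = p' := Fin.ext hp
  obtain rfl : q = q' := Fin.ext hq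
  rw [Category.assoc]

theorem cup_assoc {l m n : ℕ} (a : Cochain k C l) (b : Cochain k C m) (c : Cochain k C n) :
    HEq (cup k C (cup k C a b) c) (cup k C a (cup k C b c)) := by
  refine heq_of_op (Nat.add_assoc l m n) ?_
  simp only [cup_apply]
  funext x; ext f
  rw [op_apply, seg_cup, seg_cup, cupFun_apply, seg_cup]
  exact seg_seg_seg_congr a b c (fun _ => rfl) (fun _ => rfl)
    (fun i => show n + (m + i.1) = m + n + i.1 by omega) rfl
    (show n + m = m + n from Nat.add_comm n m) _ _ _ _ _ _ _ _ _ _ _ _ x f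

theorem skip_val {n : ℕ} (i : Fin (n + 2)) (j : Fin (n + 1)) :
    (skip i j : ℕ) = if j.1 < i.1 then j.1 else j.1 + 1 := by
  change ((i.succAbove j : Fin (n + 2)) : ℕ) = _
  rw [Fin.succAbove]
  by_cases h : j.1 < i.1
  · have : j.castSucc < i := h
    simp [h, this]
  · have : ¬ j.castSucc < i := h
    simp [h, this]

theorem sum_split {M : Type*} [AddCommMonoid M] {a b N : ℕ} (h : a + b = N) (F : Fin N → M) :
    ∑ i, F i = ∑ i : Fin a, F ⟨i.1, by omega⟩ + ∑ i : Fin b, F ⟨a + i.1, by omega⟩ := by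
  subst h
  exact Fin.sum_univ_add F

theorem skip_cup_low {m n : ℕ} (ψ : Cochain k C m) (φ : Cochain k C n) (i : Fin (n + 1)) :
    op (skip (⟨i.1, by omega⟩ : Fin (m + n + 2))) (cup k C ψ φ) =
      cup k C ψ (op (skip i.castSucc) φ) := by
  rw [cup_apply, cup_apply]
  funext x; ext f
  rw [op_apply, seg_cup, cupFun_apply (n := n + 1), seg_op]
  refine seg_seg_congr ψ φ (fun j => ?_) (fun j => ?_) _ _ _ _ _ _ _ _ x f
  · exact (skip_val _ _).trans (skip_val i.castSucc j).symm
  · refine (skip_val _ _).trans ?_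
    change (if n + j.1 < i.1 then n + j.1 else n + j.1 + 1) = n + 1 + j.1
    rw [if_neg (by omega)]; omega

theorem skip_cup_high {m n : ℕ} (ψ : Cochain k C m) (φ : Cochain k C n) (i : Fin (m + 1)) :
    op (skip (⟨n + 1 + i.1, by omega⟩ : Fin (m + n + 2))) (cup k C ψ φ) =
      op (castHom (Nat.add_right_comm m 1 n)) (cup k C (op (skip i.succ) ψ) φ) := by
  rw [cup_apply, cup_apply]
  funext x; ext f
  rw [op_apply, seg_cup, op_apply (n := m + 1 + n), seg_cup, seg_op]
  refine seg_seg_congr ψ φ (fun j => ?_) (fun j => ?_) _ _ _ _ _ _ _ _ x f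
  · refine (skip_val _ _).trans ?_
    change (if j.1 < n + 1 + i.1 then j.1 else j.1 + 1) = j.1
    rw [if_pos (by omega)]
  · refine (skip_val _ _).trans ?_
    change (if n + j.1 < n + 1 + i.1 then n + j.1 else n + j.1 + 1) = n + (skip i.succ j).1
    rw [skip_val, Fin.val_succ]
    split_ifs <;> omega

theorem skip_cup_mid {m n : ℕ} (ψ : Cochain k C m) (φ : Cochain k C n) :
    cup k C ψ (op (skip (Fin.last (n + 1))) φ) =
      op (castHom (Nat.add_right_comm m 1 n)) (cup k C (op (skip 0) ψ) φ) := by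
  rw [cup_apply, cup_apply]
  funext x; ext f
  rw [cupFun_apply (n := n + 1), seg_op, op_apply (n := m + 1 + n), seg_cup, seg_op]
  refine seg_seg_congr ψ φ (fun j => ?_) (fun j => ?_) _ _ _ _ _ _ _ _ x f
  · change (skip (Fin.last (n + 1)) j).1 = j.1
    exact (skip_val _ j).trans (if_pos (show j.1 < n + 1 from j.2))
  · change n + 1 + j.1 = n + (skip 0 j).1
    rw [skip_val, if_neg (by simp)]; omega

theorem coboundary_apply {n : ℕ} (φ : Cochain k C n) :
    coboundary n φ = ∑ i : Fin (n + 2), (-1 : k) ^ (i : ℕ) • op (skip i) φ := by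
  simp [coboundary]

theorem sum_signs {M : Type*} [AddCommGroup M] [Module k M] {m n : ℕ} (S q : M)
    (Q : Fin m → M) :
    S + ∑ i : Fin m, (-1 : k) ^ (n + 1 + (i : ℕ)) • Q i =
      S + (-1 : k) ^ (n + 1) • q + (-1 : k) ^ n • (q + ∑ i : Fin m, (-1 : k) ^ (i.1 + 1) • Q i) := by
  rw [smul_add, Finset.smul_sum, add_assoc]
  congr 1
  rw [← add_assoc, ← add_smul, pow_succ, mul_neg_one, neg_add_cancel, zero_smul, zero_add]
  refine Finset.sum_congr rfl fun i _ => ?_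
  rw [smul_smul, ← pow_add]
  congr 2
  omega

theorem coboundary_cup {m n : ℕ} (ψ : Cochain k C m) (φ : Cochain k C n) :
    coboundary (m + n) (cup k C ψ φ) = cup k C ψ (coboundary n φ) +
      (-1 : k) ^ n • cast (congrArg (Cochain k C) (Nat.add_right_comm m 1 n))
        (cup k C (coboundary m ψ) φ) := by
  have hL : coboundary (m + n) (cup k C ψ φ) =
      ∑ i : Fin (n + 1), (-1 : k) ^ (i : ℕ) • cup k C ψ (op (skip i.castSucc) φ) +
      ∑ i : Fin (m + 1), (-1 : k) ^ (n + 1 + (i : ℕ)) •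
        op (castHom (Nat.add_right_comm m 1 n)) (cup k C (op (skip i.succ) ψ) φ) := by
    rw [coboundary_apply, sum_split (show (n + 1) + (m + 1) = m + n + 2 by omega)]
    congr 1
    · exact Finset.sum_congr rfl fun i _ => by rw [skip_cup_low]
    · exact Finset.sum_congr rfl fun i _ => by rw [skip_cup_high]
  have hR1 : cup k C ψ (coboundary n φ) =
      ∑ i : Fin (n + 1), (-1 : k) ^ (i : ℕ) • cup k C ψ (op (skip i.castSucc) φ) +
      (-1 : k) ^ (n + 1) • cup k C ψ (op (skip (Fin.last (n + 1))) φ) := by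
    rw [coboundary_apply, Fin.sum_univ_castSucc, map_add, map_sum, map_smul]
    simp only [map_smul, Fin.val_castSucc, Fin.val_last]
  have hR2 : op (castHom (Nat.add_right_comm m 1 n)) (cup k C (coboundary m ψ) φ) =
      op (castHom (Nat.add_right_comm m 1 n)) (cup k C (op (skip 0) ψ) φ) +
      ∑ i : Fin (m + 1), (-1 : k) ^ (i.1 + 1) •
        op (castHom (Nat.add_right_comm m 1 n)) (cup k C (op (skip i.succ) ψ) φ) := by
    rw [coboundary_apply, Fin.sum_univ_succ]
    simp only [map_add, map_sum, map_smul, LinearMap.add_apply, LinearMap.sum_apply,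
      LinearMap.smul_apply, Fin.val_succ, Fin.val_zero, pow_zero, one_smul]
  rw [cast_eq_op (Nat.add_right_comm m 1 n), hL, hR1, hR2, skip_cup_mid]
  exact sum_signs _ _ _

variable (k C) in
/-- The differential graded algebra `C^•(C)` of Hochschild-Mitchell cochains. -/
noncomputable def cochains : DGAlgebra.{uk, max u v} k where
  X n := Cochain k C n
  d n := coboundary n
  one := unitCochain k C
  mul := cup k C
  one_mul := unit_cup
  mul_one := cup_unit
  mul_assoc := cup_assoc
  d_d n φ := coboundary_coboundary n φ
  d_mul := coboundary_cup

end Cup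

section Functoriality

variable {k : Type uk} [Field k] {C : Type u} [Category.{v} C] [Preadditive C] [Linear k C]
  {D : Type uG} [Category.{w} D] [Preadditive D] [Linear k D]
  (F : C ⥤ D) [F.Additive] [F.Linear k] [F.Full] [F.Faithful]

variable (k) in
/-- The isomorphism on morphism spaces given by a fully faithful `k`-linear functor. -/
noncomputable def homEquiv (x y : C) : (x ⟶ y) ≃ₗ[k] (F.obj x ⟶ F.obj y) :=
  LinearEquiv.ofBijective (F.mapLinearMap k) ⟨F.map_injective, F.map_surjective⟩

/-- The pull-back of cochains along a fully faithful `k`-linear functor `F`: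
`(F^* φ)(f 0, …) = F⁻¹ (φ (F (f 0), …))`. -/
noncomputable def pullFun {n : ℕ} : Cochain k D n →ₗ[k] Cochain k C n where
  toFun φ := fun x =>
    (homEquiv k F (x 0) (x (Fin.last n))).symm.toLinearMap.compMultilinearMap
      ((φ (fun i => F.obj (x i))).compLinearMap (fun _ => F.mapLinearMap k))
  map_add' φ ψ := by
    funext x; ext f; simp
  map_smul' c φ := by
    funext x; ext f; simp

theorem map_pullFun {n : ℕ} (φ : Cochain k D n) (x : Fin (n + 1) → C) (f : Str x) :
    F.map (pullFun F φ x f) = φ (fun i => F.obj (x i)) (fun i => F.map (f i)) :=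
  (homEquiv k F _ _).apply_symm_apply _

theorem map_chain {n : ℕ} (x : Fin (n + 1) → C) (f : Str x) {a b : Fin (n + 1)} (h : a ≤ b) :
    F.map (chain x f h) = chain (fun i => F.obj (x i)) (fun i => F.map (f i)) h := by
  refine chain_induction x f a
    (fun b h q => F.map q = chain (fun i => F.obj (x i)) (fun i => F.map (f i)) h) ?_ ?_ h
  · rw [chain_self, F.map_id]
  · intro i h h' ih
    rw [F.map_comp, ih, ← chain_succ (fun i => F.obj (x i)) (fun i => F.map (f i)) i
      (Fin.castSucc_lt_succ).le, chain_comp]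

theorem map_seg {n N : ℕ} (φ : Cochain k D n) (ρ : Fin (n + 1) →o Fin (N + 1))
    {a b : Fin (N + 1)} (ha : a ≤ ρ 0) (hb : ρ (Fin.last n) ≤ b) (x : Fin (N + 1) → C)
    (f : Str x) :
    F.map (seg (pullFun F φ) ρ ha hb x f) =
      seg φ ρ ha hb (fun i => F.obj (x i)) (fun i => F.map (f i)) := by
  have : (fun i => F.map (pull ρ x f i)) =
      pull ρ (fun i => F.obj (x i)) (fun i => F.map (f i)) := by
    funext i; exact map_chain F x f _
  rw [seg, F.map_comp, F.map_comp, map_chain, map_chain, map_pullFun, this, seg]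

theorem pullFun_op {m n : ℕ} (σ : Fin (n + 1) →o Fin (m + 1)) (φ : Cochain k D n) :
    pullFun F (op σ φ) = op σ (pullFun F φ) := by
  funext x; ext f
  apply F.map_injective
  rw [map_pullFun, op_apply, op_apply, map_seg]

theorem pullFun_coboundary {n : ℕ} (φ : Cochain k D n) :
    pullFun F (coboundary n φ) = coboundary n (pullFun F φ) := by
  rw [coboundary_apply, coboundary_apply, map_sum]
  refine Finset.sum_congr rfl fun i _ => ?_
  rw [map_smul, pullFun_op]

theorem pullFun_unit : pullFun F (unitCochain k D) = unitCochain k C := by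
  funext x; ext f
  apply F.map_injective
  exact (map_pullFun F _ x f).trans (F.map_id _).symm

theorem pullFun_cup {m n : ℕ} (ψ : Cochain k D m) (φ : Cochain k D n) :
    pullFun F (cup k D ψ φ) = cup k C (pullFun F ψ) (pullFun F φ) := by
  rw [cup_apply, cup_apply]
  funext x; ext f
  apply F.map_injective
  rw [map_pullFun, cupFun_apply, cupFun_apply, F.map_comp, map_seg, map_seg]

/-- The pull-back of cochains along a fully faithful `k`-linear functor is a morphism of
DG-algebras. -/
noncomputable def pullback : DGHom (cochains k D) (cochains k C) where
  f n := pullFun F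
  map_d n φ := pullFun_coboundary F φ
  map_one := pullFun_unit F
  map_mul ψ φ := pullFun_cup F ψ φ

end Functoriality

section Action

variable (k : Type uk) [Field k] (G : Type uG) [Group G] (C : Type u) [Category.{v} C]
  [Preadditive C] [Linear k C] [MulAction G C]

/-- A `G`-`k`-category: a `k`-category with an action of `G` on its objects and compatible
`k`-linear maps `f ↦ s f`, `Hom(x, y) → Hom(s x, s y)`, such that each `s` acts by a functor,
`1 f = f` and `(s t) f = s (t f)`. -/
class GCategory where
  act : ∀ (s : G) {x y : C}, (x ⟶ y) →ₗ[k] (s • x ⟶ s • y)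
  act_id : ∀ (s : G) (x : C), act s (𝟙 x) = 𝟙 (s • x)
  act_comp : ∀ (s : G) {x y z : C} (f : x ⟶ y) (g : y ⟶ z), act s (f ≫ g) = act s f ≫ act s g
  one_act : ∀ {x y : C} (f : x ⟶ y), HEq (act 1 f) f
  mul_act : ∀ (s t : G) {x y : C} (f : x ⟶ y), HEq (act (s * t) f) (act s (act t f))

variable {G C}
variable [GCategory k G C]

/-- The action of `s` on morphisms. -/
abbrev act (s : G) {x y : C} : (x ⟶ y) →ₗ[k] (s • x ⟶ s • y) := GCategory.act s

theorem act_heq (s : G) {x y x' y' : C} (hx : x = x') (hy : y = y') {f : x ⟶ y} {g : x' ⟶ y'}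
    (h : HEq f g) : HEq (act k s f) (act k s g) := by
  subst hx hy; rw [eq_of_heq h]

theorem act_heq' {s t : G} (h : s = t) {x y : C} (f : x ⟶ y) : HEq (act k s f) (act k t f) := by
  subst h; rfl

theorem act_inv_act (s : G) {x y : C} (f : x ⟶ y) : HEq (act k s⁻¹ (act k s f)) f :=
  (GCategory.mul_act s⁻¹ s f).symm.trans
    ((act_heq' k (inv_mul_cancel s) f).trans (GCategory.one_act f))

variable (C) in
/-- The endofunctor given by the action of `s`. -/
def actFunctor (s : G) : C ⥤ C where
  obj x := s • x
  map f := act k s f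
  map_id x := GCategory.act_id s x
  map_comp f g := GCategory.act_comp s f g

instance (s : G) : (actFunctor k C s).Additive where
  map_add {_ _ f g} := map_add (act k s) f g

instance (s : G) : (actFunctor k C s).Linear k where
  map_smul f r := map_smul (act k s) r f

instance (s : G) : (actFunctor k C s).Faithful where
  map_injective {x y f g} h := by
    have h' : act k s f = act k s g := h
    refine eq_of_heq ((act_inv_act k s f).symm.trans ?_)
    rw [h']
    exact act_inv_act k s g

theorem exists_heq {x y x' y' : C} (hx : x = x') (hy : y = y') (g : x' ⟶ y') :
    ∃ f : x ⟶ y, HEq f g := by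
  subst hx hy; exact ⟨g, HEq.rfl⟩

instance (s : G) : (actFunctor k C s).Full where
  map_surjective {x y} g := by
    obtain ⟨f, hf⟩ := exists_heq (inv_smul_smul s x).symm (inv_smul_smul s y).symm (act k s⁻¹ g)
    refine ⟨f, eq_of_heq ?_⟩
    refine (act_heq k s (inv_smul_smul s x).symm (inv_smul_smul s y).symm hf).trans ?_
    have := act_inv_act k s⁻¹ g
    rwa [inv_inv] at this

variable (C) in
/-- The action of `s` on cochains, `(s.φ)(f 0, …) = s (φ (s⁻¹ (f 0), …))`: here
`s : Hom(s⁻¹ x, s⁻¹ y) → Hom(x, y)` is expressed as the inverse of the map given by `s⁻¹`. -/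
noncomputable def cochainAct (s : G) : DGHom (cochains k C) (cochains k C) :=
  pullback (actFunctor k C s⁻¹)

variable (G C) in
/-- The `G`-invariant cochains: `s.φ = φ` for all `s`. -/
noncomputable def invariantSub : (cochains k C).SubDG where
  S n :=
    { carrier := {φ | ∀ s : G, (cochainAct k C s).f n φ = φ}
      zero_mem' := fun s => map_zero _
      add_mem' := fun h h' s => by rw [map_add, h s, h' s]
      smul_mem' := fun c φ h s => by rw [map_smul, h s] }
  one_mem s := (cochainAct k C s).map_one
  d_mem n φ h s := by rw [(cochainAct k C s).map_d, h s]
  mul_mem a b ha hb s := by rw [(cochainAct k C s).map_mul, ha s, hb s]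

variable (G C) in
/-- The DG-algebra `C^•(C)^G` of invariant cochains. -/
noncomputable def invariantCochains : DGAlgebra.{uk, max u v} k :=
  (cochains k C).sub (invariantSub k G C)

variable (G C) in
/-- The inclusion `C^•(C)^G → C^•(C)`. -/
noncomputable def invariantIncl : DGHom (invariantCochains k G C) (cochains k C) :=
  (cochains k C).subIncl (invariantSub k G C)

variable (G C) in
/-- The algebra `HH^*(C)^G` of invariants of the Hochschild-Mitchell cohomology. -/
noncomputable def invariantHH : Subalgebra k (cochains k C).HAlg where
  carrier := {z | ∀ s : G, (cochainAct k C s).mapHAlg z = z}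
  mul_mem' h h' s := by rw [map_mul, h s, h' s]
  add_mem' h h' s := by rw [map_add, h s, h' s]
  algebraMap_mem' r s := AlgHom.commutes _ r

end Action

section Graded

variable (k : Type uk) [Field k] (G : Type uG) [Group G] (B : Type u) [Category.{v} B]
  [Preadditive B] [Linear k B]

open scoped Classical in
/-- A `G`-graded `k`-category: `Hom(x, y) = ⨁ s, Hom(x, y)^s` with
`Hom(y, z)^t ∘ Hom(x, y)^s ⊆ Hom(x, z)^(t s)`. (Identities are then homogeneous of degree `1`.) -/
class GradedCategory where
  deg : ∀ x y : B, G → Submodule k (x ⟶ y)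
  isInternal : ∀ x y : B, DirectSum.IsInternal (deg x y)
  comp_mem : ∀ {x y z : B} {s t : G} {f : x ⟶ y} {g : y ⟶ z},
    f ∈ deg x y s → g ∈ deg y z t → f ≫ g ∈ deg x z (t * s)
  id_mem : ∀ x : B, 𝟙 x ∈ deg x x 1

/-- The product `s (n-1) ⋯ s 1 s 0`. -/
def degProd {G : Type uG} [Group G] {n : ℕ} (s : Fin n → G) : G := (List.ofFn s).reverse.prod

theorem degProd_zero {G : Type uG} [Group G] (s : Fin 0 → G) : degProd s = 1 := by
  simp [degProd]

theorem degProd_succ {G : Type uG} [Group G] {n : ℕ} (s : Fin (n + 1) → G) :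
    degProd s = s (Fin.last n) * degProd (fun i : Fin n => s i.castSucc) := by
  rw [degProd, degProd, List.ofFn_succ', List.concat_eq_append, List.reverse_append]
  simp

theorem degProd_telescope {G : Type uG} [Group G] {n : ℕ} (p : Fin (n + 1) → G) :
    degProd (fun i : Fin n => p i.succ * (p i.castSucc)⁻¹) = p (Fin.last n) * (p 0)⁻¹ := by
  induction n with
  | zero => rw [degProd_zero]; exact (mul_inv_cancel _).symm
  | succ n ih =>
    rw [degProd_succ, Fin.succ_last]
    refine (congrArg (p (Fin.last (n + 1)) * (p (Fin.last n).castSucc)⁻¹ * ·)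
      (ih (fun i => p i.castSucc))).trans ?_
    rw [mul_assoc, inv_mul_cancel_left, Fin.castSucc_zero]

variable {B}

/-- A cochain is of class `1` if it maps homogeneous morphisms `f 0, …, f (n-1)` of degrees
`s 0, …, s (n-1)` to a homogeneous morphism of degree `s (n-1) ⋯ s 0`. -/
def IsClassOne [GradedCategory k G B] {n : ℕ} (φ : Cochain k B n) : Prop :=
  ∀ (x : Fin (n + 1) → B) (s : Fin n → G) (f : Str x),
    (∀ i, f i ∈ GradedCategory.deg (k := k) (x i.castSucc) (x i.succ) (s i)) →
      φ x f ∈ GradedCategory.deg (k := k) (x 0) (x (Fin.last n)) (degProd s)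

variable [GradedCategory k G B]

theorem chain_mem {n : ℕ} (x : Fin (n + 1) → B) (f : Str x) (p : Fin (n + 1) → G)
    (hf : ∀ i, f i ∈ GradedCategory.deg (k := k) (x i.castSucc) (x i.succ)
      (p i.succ * (p i.castSucc)⁻¹)) {a b : Fin (n + 1)} (h : a ≤ b) :
    chain x f h ∈ GradedCategory.deg (k := k) (x a) (x b) (p b * (p a)⁻¹) := by
  refine chain_induction x f a
    (fun b h q => q ∈ GradedCategory.deg (k := k) (x a) (x b) (p b * (p a)⁻¹)) ?_ ?_ h
  · rw [mul_inv_cancel]; exact GradedCategory.id_mem _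
  · intro i h h' ih
    have := GradedCategory.comp_mem ih (hf i)
    rwa [mul_assoc, inv_mul_cancel_left] at this

theorem seg_mem {n N : ℕ} {φ : Cochain k B n} (hφ : IsClassOne k G φ)
    (ρ : Fin (n + 1) →o Fin (N + 1)) {a b : Fin (N + 1)} (ha : a ≤ ρ 0)
    (hb : ρ (Fin.last n) ≤ b) (x : Fin (N + 1) → B) (f : Str x) (p : Fin (N + 1) → G)
    (hf : ∀ i, f i ∈ GradedCategory.deg (k := k) (x i.castSucc) (x i.succ)
      (p i.succ * (p i.castSucc)⁻¹)) :
    seg φ ρ ha hb x f ∈ GradedCategory.deg (k := k) (x a) (x b) (p b * (p a)⁻¹) := by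
  have h1 := hφ (fun i => x (ρ i)) (fun i => p (ρ i.succ) * (p (ρ i.castSucc))⁻¹) (pull ρ x f)
    (fun i => chain_mem k G x f p hf _)
  rw [degProd_telescope (fun i => p (ρ i))] at h1
  have h2 := GradedCategory.comp_mem (GradedCategory.comp_mem (chain_mem k G x f p hf ha) h1)
    (chain_mem k G x f p hf hb)
  rw [seg, ← Category.assoc]
  convert h2 using 1
  group

theorem exists_potential {n : ℕ} (s : Fin n → G) :
    ∃ p : Fin (n + 1) → G, (∀ i, p i.succ * (p i.castSucc)⁻¹ = s i) ∧
      p (Fin.last n) * (p 0)⁻¹ = degProd s := by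
  have : ∃ p : Fin (n + 1) → G, ∀ i, p i.succ * (p i.castSucc)⁻¹ = s i := by
    induction n with
    | zero => exact ⟨fun _ => 1, fun i => i.elim0⟩
    | succ n ih =>
      obtain ⟨p, hp⟩ := ih (fun i => s i.castSucc)
      refine ⟨Fin.snoc p (s (Fin.last n) * p (Fin.last n)), fun i => ?_⟩
      induction i using Fin.lastCases with
      | last => rw [Fin.succ_last, Fin.snoc_last, Fin.snoc_castSucc, mul_inv_cancel_right]
      | cast i => rw [← hp i, Fin.succ_castSucc, Fin.snoc_castSucc, Fin.snoc_castSucc]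
  obtain ⟨p, hp⟩ := this
  refine ⟨p, hp, ?_⟩
  rw [← degProd_telescope, funext hp]

theorem isClassOne_of_potential {n : ℕ} {φ : Cochain k B n}
    (h : ∀ (x : Fin (n + 1) → B) (f : Str x) (p : Fin (n + 1) → G),
      (∀ i, f i ∈ GradedCategory.deg (k := k) (x i.castSucc) (x i.succ)
        (p i.succ * (p i.castSucc)⁻¹)) →
      φ x f ∈ GradedCategory.deg (k := k) (x 0) (x (Fin.last n)) (p (Fin.last n) * (p 0)⁻¹)) :
    IsClassOne k G φ := by
  intro x s f hf
  obtain ⟨p, hp, hp'⟩ := exists_potential G s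
  rw [← hp']
  exact h x f p fun i => by rw [hp]; exact hf i

theorem isClassOne_op {m n : ℕ} (σ : Fin (n + 1) →o Fin (m + 1)) {φ : Cochain k B n}
    (hφ : IsClassOne k G φ) : IsClassOne k G (op σ φ) :=
  isClassOne_of_potential k G fun x f p hf => seg_mem k G hφ σ _ _ x f p hf

theorem isClassOne_cup {m n : ℕ} {ψ : Cochain k B m} {φ : Cochain k B n}
    (hψ : IsClassOne k G ψ) (hφ : IsClassOne k G φ) : IsClassOne k G (cup k B ψ φ) :=
  isClassOne_of_potential k G fun x f p hf => by
    rw [cup_apply, cupFun_apply]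
    have := GradedCategory.comp_mem
      (seg_mem k G hφ (front m n) (Fin.zero_le _) (front_last_le m n) x f p hf)
      (seg_mem k G hψ (back m n) (mid_le_back m n) (Fin.le_last _) x f p hf)
    rwa [mul_assoc, inv_mul_cancel_left] at this

variable (B) in
/-- The subspaces of cochains of class `1`. -/
def classOneSubmodule (n : ℕ) : Submodule k (Cochain k B n) where
  carrier := {φ | IsClassOne k G φ}
  zero_mem' _ _ _ _ := Submodule.zero_mem _
  add_mem' h h' x s f hf := Submodule.add_mem _ (h x s f hf) (h' x s f hf)
  smul_mem' c _ h x s f hf := Submodule.smul_mem _ c (h x s f hf)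

theorem isClassOne_coboundary {n : ℕ} {φ : Cochain k B n} (hφ : IsClassOne k G φ) :
    IsClassOne k G (coboundary n φ) := by
  rw [coboundary_apply]
  exact Submodule.sum_mem (classOneSubmodule k G B (n + 1)) fun i _ =>
    Submodule.smul_mem _ _ (isClassOne_op k G (skip i) hφ)

variable (B) in
/-- The sub-DG-algebra of cochains of class `1`. -/
noncomputable def classOneSub : (cochains k B).SubDG where
  S := classOneSubmodule k G B
  one_mem x s f _ := by
    rw [degProd_zero]
    exact GradedCategory.id_mem (x 0)
  d_mem _ _ h := isClassOne_coboundary k G h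
  mul_mem _ _ h h' := isClassOne_cup k G h h'

variable (B) in
/-- The DG-algebra `C^•_{1}(B)` of cochains of a graded category attached to the trivial conjugacy
class. Its cohomology algebra is `HH^*_{1}(B)`. -/
noncomputable def classOneCochains : DGAlgebra.{uk, max u v} k :=
  (cochains k B).sub (classOneSub k G B)

variable (P : ObjectProperty B)

open scoped Classical in
theorem isInternal_comap {M N : Type*} [AddCommGroup M] [Module k M] [AddCommGroup N] [Module k N]
    (e : M ≃ₗ[k] N) (W : G → Submodule k N) (h : DirectSum.IsInternal W) :
    DirectSum.IsInternal (fun s => (W s).comap e.toLinearMap) := by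
  rw [DirectSum.isInternal_submodule_iff_iSupIndep_and_iSup_eq_top] at h ⊢
  refine ⟨(iSupIndep_map_orderIso_iff (Submodule.orderIsoMapComap e).symm).2 h.1, ?_⟩
  exact ((Submodule.orderIsoMapComap e).symm.map_iSup W).symm.trans
    ((congrArg _ h.2).trans (map_top _))

/-- A full subcategory of a graded category is graded. -/
instance fullSubcategoryGraded : GradedCategory k G P.FullSubcategory where
  deg x y s := (GradedCategory.deg (k := k) x.obj y.obj s).comap (P.ι.mapLinearMap k)
  isInternal x y := isInternal_comap k G (homEquiv k P.ι x y) _ (GradedCategory.isInternal _ _)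
  comp_mem hf hg := GradedCategory.comp_mem (k := k) (G := G) hf hg
  id_mem x := GradedCategory.id_mem (k := k) (G := G) x.obj

/-- Restriction of cochains of class `1` to a full subcategory. -/
noncomputable def classOneRestrict :
    DGHom (classOneCochains k G B) (classOneCochains k G P.FullSubcategory) :=
  (pullback P.ι).restrict (classOneSub k G B) (classOneSub k G P.FullSubcategory)
    (fun n φ h x s f hf => by
      refine (Submodule.mem_comap).2 ?_
      refine Eq.mpr (congrArg (· ∈ GradedCategory.deg (k := k) _ _ (degProd s))
        (map_pullFun P.ι φ x f)) ?_
      exact h (fun i => P.ι.obj (x i)) s (fun i => P.ι.map (f i)) hf)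

end Graded

section Skew

variable (k : Type uk) [Field k] (G : Type uG) [Group G] (C : Type u) [Category.{v} C]
  [Preadditive C] [Linear k C] [MulAction G C] [GCategory k G C]

/-- The objects of the skew category `C[G]`: the objects of `C`. -/
@[ext]
structure Skew (k : Type uk) (G : Type uG) (C : Type u) : Type u where
  obj : C

variable {C}

/-- The morphisms `x ⟶ y` of `C[G]`: `⨁ s, Hom(s x, y)`. -/
abbrev SkewHom (x y : C) : Type (max uG v) := ⨁ s : G, (s • x ⟶ y)

/-- The composite `g ∘ (t f) : (t s) x ⟶ z` in `C` of homogeneous morphisms `f : s x ⟶ y` and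
`g : t y ⟶ z`; the `eqToHom` identifies `(t s) x` with `t (s x)`. -/
noncomputable def homogComp {x y z : C} (s t : G) :
    (s • x ⟶ y) →ₗ[k] (t • y ⟶ z) →ₗ[k] ((t * s) • x ⟶ z) :=
  LinearMap.mk₂ k (fun f g => eqToHom (mul_smul t s x) ≫ act k t f ≫ g)
    (fun f f' g => by simp) (fun c f g => by simp) (fun f g g' => by simp)
    (fun c f g => by simp)

open scoped Classical in
/-- Composition in `C[G]`, the bilinear extension of `homogComp`. -/
noncomputable def skewComp (x y z : C) :
    SkewHom G x y →ₗ[k] SkewHom G y z →ₗ[k] SkewHom G x z :=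
  DirectSum.toModule k G _ fun s => LinearMap.flip <|
    DirectSum.toModule k G _ fun t => LinearMap.flip <|
      (homogComp k G s t).compr₂ (DirectSum.lof k G (fun r : G => (r • x ⟶ z)) (t * s))

open scoped Classical in
theorem skewComp_lof {x y z : C} (s t : G) (f : s • x ⟶ y) (g : t • y ⟶ z) :
    skewComp k G x y z (DirectSum.lof k G _ s f) (DirectSum.lof k G _ t g) =
      DirectSum.lof k G (fun r : G => (r • x ⟶ z)) (t * s)
        (eqToHom (mul_smul t s x) ≫ act k t f ≫ g) := by
  simp [skewComp, homogComp]

open scoped Classical in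
/-- The identity of `x` in `C[G]`, homogeneous of degree `1`. -/
noncomputable def skewId (x : C) : SkewHom G x x :=
  DirectSum.lof k G (fun r : G => (r • x ⟶ x)) 1 (eqToHom (one_smul G x))

open scoped Classical in
theorem lof_eq {x z : C} {r r' : G} (h : r = r') {f : r • x ⟶ z} {f' : r' • x ⟶ z}
    (hf : HEq f f') : DirectSum.lof k G (fun r : G => (r • x ⟶ z)) r f =
      DirectSum.lof k G (fun r : G => (r • x ⟶ z)) r' f' := by
  subst h; rw [eq_of_heq hf]

theorem heq_eqToHom_comp {x x' y z : C} (h : x = x') {f : x' ⟶ y} {g : z ⟶ y} (hz : HEq f g) :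
    HEq (eqToHom h ≫ f) g := by
  subst h; rw [eqToHom_refl, Category.id_comp]; exact hz

theorem comp_heq {x y z x' y' : C} (hx : x = x') (hy : y = y') {f : x ⟶ y} {g : y ⟶ z}
    {f' : x' ⟶ y'} {g' : y' ⟶ z} (hf : HEq f f') (hg : HEq g g') : HEq (f ≫ g) (f' ≫ g') := by
  subst hx hy; rw [eq_of_heq hf, eq_of_heq hg]

theorem act_eqToHom_heq (s : G) {x y : C} (h : x = y) :
    HEq (act k s (eqToHom h)) (𝟙 (s • y)) := by
  subst h; rw [eqToHom_refl]; exact heq_of_eq (GCategory.act_id s x)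

theorem skewId_comp {x y : C} (f : SkewHom G x y) :
    skewComp k G x x y (skewId k G x) f = f := by
  classical
  suffices h : skewComp k G x x y (skewId k G x) = LinearMap.id by rw [h]; rfl
  refine DirectSum.linearMap_ext k fun s => LinearMap.ext fun f => ?_
  rw [LinearMap.comp_apply, LinearMap.comp_apply, LinearMap.id_apply, skewId, skewComp_lof]
  refine lof_eq k G (mul_one s) (heq_eqToHom_comp _ ?_)
  exact (comp_heq (x' := s • x) (f' := 𝟙 _) (g' := f) (by rw [one_smul]) rfl
    (act_eqToHom_heq k G s _) HEq.rfl).trans (heq_of_eq (Category.id_comp f))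

theorem skewComp_id {x y : C} (f : SkewHom G x y) :
    skewComp k G x y y f (skewId k G y) = f := by
  classical
  suffices h : (skewComp k G x y y).flip (skewId k G y) = LinearMap.id by
    exact congrArg (fun t => t f) h
  refine DirectSum.linearMap_ext k fun s => LinearMap.ext fun f => ?_
  rw [LinearMap.comp_apply, LinearMap.comp_apply, LinearMap.id_apply, LinearMap.flip_apply, skewId,
    skewComp_lof]
  refine lof_eq k G (one_mul s) (heq_eqToHom_comp _ ?_)
  refine (comp_heq (x' := s • x) (y' := y) (f' := f) (g' := 𝟙 y) (one_smul G _) (one_smul G _)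
    (GCategory.one_act f) ?_).trans (heq_of_eq (Category.comp_id f))
  have : ∀ {a b : C} (h : a = b), HEq (eqToHom h) (𝟙 b) := by
    intro a b h; subst h; rfl
  exact this _

theorem skewComp_assoc {x y z w : C} (f : SkewHom G x y) (g : SkewHom G y z)
    (h : SkewHom G z w) :
    skewComp k G x z w (skewComp k G x y z f g) h =
      skewComp k G x y w f (skewComp k G y z w g h) := by
  classical
  induction f using DirectSum.induction_on with
  | zero => simp
  | add f f' hf hf' => simp only [map_add, LinearMap.add_apply, hf, hf']
  | of s f =>
    induction g using DirectSum.induction_on with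
    | zero => simp
    | add g g' hg hg' => simp only [map_add, LinearMap.add_apply, hg, hg']
    | of t g =>
      induction h using DirectSum.induction_on with
      | zero => simp
      | add h h' hh hh' => simp only [map_add, hh, hh']
      | of r h =>
        simp only [← DirectSum.lof_eq_of k]
        rw [skewComp_lof, skewComp_lof, skewComp_lof, skewComp_lof]
        have h1 : HEq (act k r (eqToHom (mul_smul t s x) ≫ act k t f ≫ g) ≫ h)
            (act k r (act k t f) ≫ act k r g ≫ h) := by
          rw [GCategory.act_comp, GCategory.act_comp, Category.assoc, Category.assoc]
          exact (comp_heq (by rw [mul_smul]) rfl (act_eqToHom_heq k G r (mul_smul t s x))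
            HEq.rfl).trans (heq_of_eq (Category.id_comp _))
        have h2 : HEq (act k (r * t) f ≫ eqToHom (mul_smul r t y) ≫ act k r g ≫ h)
            (act k r (act k t f) ≫ act k r g ≫ h) :=
          comp_heq (mul_smul r t _) (mul_smul r t y) (GCategory.mul_act r t f)
            (heq_eqToHom_comp _ HEq.rfl)
        exact lof_eq k G (mul_assoc r t s).symm (heq_eqToHom_comp _ (h1.trans
          (heq_eqToHom_comp _ h2).symm))

noncomputable instance : Category.{max uG v} (Skew k G C) where
  Hom x y := SkewHom G x.obj y.obj
  id x := skewId k G x.obj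
  comp f g := skewComp k G _ _ _ f g
  id_comp f := skewId_comp k G f
  comp_id f := skewComp_id k G f
  assoc f g h := skewComp_assoc k G f g h

noncomputable instance : Preadditive (Skew k G C) where
  homGroup x y := inferInstanceAs (AddCommGroup (SkewHom G x.obj y.obj))
  add_comp x y z f f' g :=
    LinearMap.map_add₂ (skewComp k G x.obj y.obj z.obj) f f' g
  comp_add x y z f g g' := LinearMap.map_add (skewComp k G x.obj y.obj z.obj f) g g'

noncomputable instance : Linear k (Skew k G C) where
  homModule x y := inferInstanceAs (Module k (SkewHom G x.obj y.obj))
  smul_comp x y z c f g :=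
    LinearMap.map_smul₂ (skewComp k G x.obj y.obj z.obj) c f g
  comp_smul x y z f c g := LinearMap.map_smul (skewComp k G x.obj y.obj z.obj f) c g

open scoped Classical in
theorem isInternal_range_lof (N : G → Type v) [∀ s, AddCommGroup (N s)] [∀ s, Module k (N s)] :
    DirectSum.IsInternal (fun s => LinearMap.range (DirectSum.lof k G N s)) :=
  DirectSum.isInternal_submodule_of_iSupIndep_of_iSup_eq_top
    (by
      rw [iSupIndep_def]
      refine fun s => Submodule.disjoint_def.2 ?_
      rintro _ ⟨a, rfl⟩ h
      have hle : (⨆ j, ⨆ (_ : j ≠ s), LinearMap.range (DirectSum.lof k G N j)) ≤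
          LinearMap.ker (DirectSum.component k G N s) := by
        refine iSup₂_le fun j hj => ?_
        rintro _ ⟨b, rfl⟩
        rw [LinearMap.mem_ker, DirectSum.component.of]
        exact dif_neg hj
      have ha : a = 0 := by
        have h' := hle h
        rwa [LinearMap.mem_ker, DirectSum.component.lof_self] at h'
      rw [ha, map_zero])
    DFinsupp.iSup_range_lsingle

open scoped Classical in
/-- The grading of the skew category: `Hom_{C[G]}(x, y)^s = Hom_C(s x, y)`. -/
noncomputable instance : GradedCategory k G (Skew k G C) where
  deg x y s := LinearMap.range (DirectSum.lof k G (fun r : G => (r • x.obj ⟶ y.obj)) s)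
  isInternal x y := isInternal_range_lof k G _
  comp_mem := by
    rintro x y z s t _ _ ⟨f, rfl⟩ ⟨g, rfl⟩
    exact ⟨_, (skewComp_lof k G s t f g).symm⟩
  id_mem x := ⟨_, rfl⟩

/-- The full subcategory `C_T[G]` of `C[G]` with set of objects `T`. -/
abbrev SkewOn (T : Set C) : Type u :=
  ObjectProperty.FullSubcategory (fun x : Skew k G C => x.obj ∈ T)

/-- A transversal of an action of `G`: for each `x` there is a unique `u ∈ T` in the orbit
of `x`. -/
def IsTransversal (G : Type uG) [Group G] {E : Type u} [MulAction G E] (T : Set E) : Prop :=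
  ∀ x : E, ∃! u : E, u ∈ T ∧ ∃ s : G, x = s • u

end Skew

end HochschildMitchell

/-! In `C[G]` the morphisms of degree `1` form a copy of `C` (`skewIncl`), and each object `x` is
isomorphic to `s • x` by an isomorphism of degree `s` (`skewIso`). Conjugation with these
isomorphisms carries `f` to `s f`: the action of `G` on `C` becomes inner in `C[G]`.

A homogeneous string in `C[G]` is therefore a string of `C` in disguise. If its morphisms have
degrees `s i`, choose `p` with `(p (i+1))⁻¹ * p i = s i`; then conjugation with the isomorphisms `x
i ≅ p i • x i` gives a string `F` of `C` along `p i • x i` (`exists_skewStr`). The family `p` is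
unique up to a common left factor `t`, which replaces `F` by `t F`. So a cochain `φ` of `C`
prescribes consistent values on homogeneous strings of `C[G]` when it is invariant
(`skewConj_cochain_mul`). The resulting extension has class `1` and is determined by `φ`
(`IsSkewExt.unique`), whence a DG-morphism `skewExtHom` from the invariant cochains to the cochains
of class `1` of `C[G]`.

For a transversal `T`, let `A` be this extension followed by restriction to `C_T[G]`. It is
bijective in every degree. Injectivity: every object of `C` has the form `p • u` with `u ∈ T`, so
every value of `φ` is read off from the extension on `C_T[G]`. Surjectivity: freeness makes `p` and
`u` unique, so a cochain of class `1` on `C_T[G]` defines a cochain of `C`, which is invariant for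
the same reason that the extension is well defined.

Restriction from `C[G]` to `C_T[G]` loses no cohomology: a cocycle of class `1` that vanishes on
`C_T[G]` is a coboundary of class `1`. The proof moves each object into `T` by a homogeneous
isomorphism; conjugation with isomorphisms is homotopic to the identity through operators preserving
class `1` (`conjHomotopy_coboundary_add`). With the bijectivity of `A`, it follows that `skewExtHom`
is a quasi-isomorphism (`DGHom.mapH_bijective_of_comp`), and `e` is the inverse of the induced map.
It does not depend on `T`, and `H^*(A) ∘ e` is the map induced by restriction.

If invariants are exact, equivariant surjections stay surjective on invariants. For the differential
onto its image this makes `H^*` of the invariants inject into `HH^*(C)`; for the projection from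
cocycles to classes it makes the image all invariant classes. -/

namespace HochschildMitchell

/-! ### Conjugation of cochains by isomorphisms and its homotopy to the identity -/

section Conjugation

variable {k : Type uk} [Field k] {B : Type u} [Category.{v} B] [Preadditive B] [Linear k B]

/-- The string obtained from a string by conjugation with isomorphisms. -/
def conjStr {B : Type u} [Category.{v} B] {n : ℕ} {x y : Fin (n + 1) → B} (θ : ∀ i, x i ≅ y i)
    (f : Str x) : Str y :=
  fun i => (θ i.castSucc).inv ≫ f i ≫ (θ i.succ).hom

theorem chain_conjStr {B : Type u} [Category.{v} B] {n : ℕ} {x y : Fin (n + 1) → B}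
    (θ : ∀ i, x i ≅ y i) (f : Str x) {a b : Fin (n + 1)} (h : a ≤ b) :
    chain y (conjStr θ f) h = (θ a).inv ≫ chain x f h ≫ (θ b).hom := by
  refine chain_induction y (conjStr θ f) a
    (fun b h q => q = (θ a).inv ≫ chain x f h ≫ (θ b).hom) ?_ ?_ h
  · rw [chain_self, Category.id_comp, Iso.inv_hom_id]
  · intro i h h' ih
    rw [ih, conjStr, ← chain_comp x f h (Fin.castSucc_lt_succ (i := i)).le, chain_succ]
    simp

theorem pull_conjStr {B : Type u} [Category.{v} B] {m n : ℕ} (σ : Fin (n + 1) →o Fin (m + 1))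
    {x y : Fin (m + 1) → B} (θ : ∀ i, x i ≅ y i) (f : Str x) :
    pull σ y (conjStr θ f) = conjStr (fun i => θ (σ i)) (pull σ x f) := by
  funext i
  exact chain_conjStr θ f _

variable (r : B → B) (η : ∀ b, b ≅ r b)

/-- The isomorphism from `b` to `r b` or to `b`. -/
def selIso (c : Bool) (b : B) : b ≅ (bif c then r b else b) :=
  match c with
  | true => η b
  | false => Iso.refl b

/-- Evaluation of cochains on strings conjugated by the isomorphisms `b ≅ r b` at the places
marked by `ε`. -/
noncomputable def conjOp {n : ℕ} (ε : Fin (n + 1) → Bool) : Cochain k B n →ₗ[k] Cochain k B n where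
  toFun φ := fun x =>
    (Linear.homCongr k (selIso r η (ε 0) (x 0)).symm
      (selIso r η (ε (Fin.last n)) (x (Fin.last n))).symm).toLinearMap.compMultilinearMap
      ((φ fun i => bif ε i then r (x i) else x i).compLinearMap fun i =>
        (Linear.homCongr k (selIso r η (ε i.castSucc) (x i.castSucc))
          (selIso r η (ε i.succ) (x i.succ))).toLinearMap)
  map_add' φ ψ := by
    funext x; ext f; simp
  map_smul' c φ := by
    funext x; ext f; simp

theorem conjOp_apply {n : ℕ} (ε : Fin (n + 1) → Bool) (φ : Cochain k B n) (x : Fin (n + 1) → B)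
    (f : Str x) :
    conjOp r η ε φ x f = (selIso r η (ε 0) (x 0)).hom ≫
      φ (fun i => bif ε i then r (x i) else x i)
        (conjStr (fun i => selIso r η (ε i) (x i)) f) ≫
      (selIso r η (ε (Fin.last n)) (x (Fin.last n))).inv := by
  have e : (fun i => (Linear.homCongr k (selIso r η (ε i.castSucc) (x i.castSucc))
          (selIso r η (ε i.succ) (x i.succ))) (f i)) =
      conjStr (fun i => selIso r η (ε i) (x i)) f := by
    funext i
    simp [conjStr, Linear.homCongr_apply]
  simp only [conjOp, LinearMap.coe_mk, AddHom.coe_mk]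
  rw [LinearMap.compMultilinearMap_apply, MultilinearMap.compLinearMap_apply,
    LinearEquiv.coe_coe, Linear.homCongr_apply, Iso.symm_inv, Iso.symm_hom, Category.assoc, ← e]
  rfl

/-- The conjugating isomorphisms at places not hit by `σ` cancel, either inside the composites of
the string or against the outer isomorphisms at the two ends. Only those at the places `σ i`
survive. -/
theorem conjOp_op {m n : ℕ} (ε : Fin (m + 1) → Bool) (σ : Fin (n + 1) →o Fin (m + 1))
    (φ : Cochain k B n) :
    conjOp r η ε (op σ φ) = op σ (conjOp r η (fun i => ε (σ i)) φ) := by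
  funext x; ext f
  rw [conjOp_apply, op_apply, op_apply, seg, seg, conjOp_apply, chain_conjStr, chain_conjStr,
    pull_conjStr]
  simp

theorem conjOp_false {n : ℕ} (ε : Fin (n + 1) → Bool) (hε : ∀ i, ε i = false)
    (φ : Cochain k B n) : conjOp r η ε φ = φ := by
  obtain rfl : ε = fun _ => false := funext hε
  funext x; ext f
  rw [conjOp_apply]
  have : conjStr (fun i => selIso r η false (x i)) f = f := by
    funext i
    exact (Category.id_comp _).trans (Category.comp_id _)
  rw [this]
  exact (Category.id_comp _).trans (Category.comp_id _)

/-- The monotone map `{0, …, n} → {0, …, n + 1}` that skips `j`. -/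
def face {n : ℕ} (j : ℕ) : Fin (n + 1) →o Fin (n + 2) :=
  ⟨fun l => ⟨if l.1 < j then l.1 else l.1 + 1, by split_ifs <;> omega⟩, fun a b h => by
    rw [Fin.le_def] at h ⊢
    dsimp only
    split_ifs <;> omega⟩

/-- The monotone map `{0, …, n + 1} → {0, …, n}` that repeats `i`. -/
def degen {n : ℕ} (i : ℕ) : Fin (n + 2) →o Fin (n + 1) :=
  -- The `min` only keeps the value in range when `i > n`; for `i ≤ n` it has no effect.
  ⟨fun l => ⟨if l.1 ≤ i then min l.1 n else l.1 - 1, by split_ifs <;> omega⟩, fun a b h => by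
    rw [Fin.le_def] at h ⊢
    dsimp only
    split_ifs <;> omega⟩

/-- With natural number indices the simplicial identities below become linear arithmetic with case
splits. -/
theorem skip_eq_face {n : ℕ} (j : Fin (n + 2)) : skip j = face j.1 :=
  OrderHom.ext _ _ (funext fun l => Fin.ext (skip_val j l))

theorem coboundary_eq_sum_face {n : ℕ} (φ : Cochain k B n) :
    coboundary n φ = ∑ j ∈ Finset.range (n + 2), (-1 : k) ^ j • op (face j) φ := by
  rw [coboundary_apply, ← Fin.sum_univ_eq_sum_range (fun j => (-1 : k) ^ j • op (face j) φ)]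
  exact Finset.sum_congr rfl fun j _ => by rw [skip_eq_face]

/-- Conjugation at the first `t` places. -/
noncomputable def conjBelow {n : ℕ} (t : ℕ) : Cochain k B n →ₗ[k] Cochain k B n :=
  conjOp r η (fun i => decide (i.1 < t))

/-- The homotopy between the identity and conjugation at all places. -/
noncomputable def conjHomotopy (n : ℕ) : Cochain k B (n + 1) →ₗ[k] Cochain k B n :=
  -- The prism operator: the `i`-th term evaluates `φ` on `r x 0 ⟶ ⋯ ⟶ r x i ⟶ x i ⟶ ⋯ ⟶ x n`. The
  -- repeated place `i` is marked only once, so the identity of `x i` becomes the inverse of `η (x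
  -- i)`.
  ∑ i ∈ Finset.range (n + 1), (-1 : k) ^ i • (op (degen i)).comp (conjBelow r η (i + 1))

theorem conjHomotopy_apply {n : ℕ} (φ : Cochain k B (n + 1)) :
    conjHomotopy r η n φ =
      ∑ i ∈ Finset.range (n + 1), (-1 : k) ^ i • op (degen i) (conjBelow r η (i + 1) φ) := by
  simp [conjHomotopy]

/-- The combinatorics of the prism, with `T` standing for the terms of `h d` and `U` for those of `d
h`. The two diagonals `j = i` and `j = i + 1` carry opposite signs and telescope; the terms below
and above them cancel against the two halves of the `U` sum. -/
theorem sum_homotopy {M : Type*} [AddCommGroup M] [Module k M] (n : ℕ) (T U : ℕ → ℕ → M)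
    (q : ℕ → M) (h0 : ∀ i ≤ n, T i i = q i) (h1 : ∀ i ≤ n, T i (i + 1) = q (i + 1))
    (h2 : ∀ i j, i < n → j ≤ i → T (i + 1) j = U i j)
    (h3 : ∀ i j, i < j → j ≤ n → T i (j + 1) = U i j) :
    ∑ i ∈ Finset.range (n + 1), ∑ j ∈ Finset.range (n + 2), (-1 : k) ^ (i + j) • T i j +
      ∑ j ∈ Finset.range (n + 1), ∑ i ∈ Finset.range n, (-1 : k) ^ (i + j) • U i j =
      q 0 - q (n + 1) := by
  have split : ∀ i ∈ Finset.range (n + 1),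
      ∑ j ∈ Finset.range (n + 2), (-1 : k) ^ (i + j) • T i j =
      (q i - q (i + 1)) +
      (∑ j ∈ Finset.range (n + 2), (if j < i then (-1 : k) ^ (i + j) • T i j else 0) +
      ∑ j ∈ Finset.range (n + 2), (if i + 1 < j then (-1 : k) ^ (i + j) • T i j else 0)) := by
    intro i hi
    rw [Finset.mem_range] at hi
    have e : q i - q (i + 1) =
        ∑ j ∈ Finset.range (n + 2), ((if j = i then q i else 0) +
          (if j = i + 1 then - q (i + 1) else 0)) := by
      rw [Finset.sum_add_distrib, Finset.sum_ite_eq', Finset.sum_ite_eq',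
        if_pos (Finset.mem_range.2 (by omega)), if_pos (Finset.mem_range.2 (by omega)),
        sub_eq_add_neg]
    rw [e, ← Finset.sum_add_distrib, ← Finset.sum_add_distrib]
    refine Finset.sum_congr rfl fun j _ => ?_
    rcases lt_trichotomy j i with hj | rfl | hj
    · simp [hj, hj.ne, show j ≠ i + 1 by omega, show ¬ i + 1 < j by omega]
    · rw [h0 j (by omega)]
      simp [← two_mul, pow_mul]
    · rcases (show i + 1 ≤ j from hj).eq_or_lt with rfl | hj'
      · rw [h1 i (by omega)]
        simp [← add_assoc, ← two_mul, pow_succ, pow_mul]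
      · simp [hj', hj'.ne', show ¬ j < i by omega, show j ≠ i by omega]
  rw [Finset.sum_congr rfl split, Finset.sum_add_distrib, Finset.sum_add_distrib,
    Finset.sum_range_sub' q (n + 1)]
  -- Below the diagonal the shift `i ↦ i + 1` matches `T` with `U` and changes the sign.
  have hA : ∑ i ∈ Finset.range (n + 1), ∑ j ∈ Finset.range (n + 2),
      (if j < i then (-1 : k) ^ (i + j) • T i j else 0) =
      ∑ i ∈ Finset.range n, ∑ j ∈ Finset.range (n + 1),
        (if j ≤ i then -((-1 : k) ^ (i + j) • U i j) else 0) := by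
    rw [Finset.sum_range_succ']
    simp only [Nat.not_lt_zero, if_false, Finset.sum_const_zero, add_zero]
    refine Finset.sum_congr rfl fun i hi => ?_
    rw [Finset.mem_range] at hi
    rw [Finset.sum_range_succ _ (n + 1), if_neg (by omega), add_zero]
    refine Finset.sum_congr rfl fun j _ => ?_
    by_cases hj : j ≤ i
    · rw [if_pos hj, if_pos (by omega), h2 i j hi hj, show i + 1 + j = i + j + 1 by omega,
        pow_succ, mul_neg_one, neg_smul]
    · rw [if_neg hj, if_neg (by omega)]
  -- Above the diagonals the shift is in `j`; the row `i = n` is empty.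
  have hB : ∑ i ∈ Finset.range (n + 1), ∑ j ∈ Finset.range (n + 2),
      (if i + 1 < j then (-1 : k) ^ (i + j) • T i j else 0) =
      ∑ i ∈ Finset.range n, ∑ j ∈ Finset.range (n + 1),
        (if j ≤ i then 0 else -((-1 : k) ^ (i + j) • U i j)) := by
    rw [Finset.sum_range_succ]
    have hl : ∑ j ∈ Finset.range (n + 2),
        (if n + 1 < j then (-1 : k) ^ (n + j) • T n j else 0) = 0 :=
      Finset.sum_eq_zero fun j hj => if_neg (by rw [Finset.mem_range] at hj; omega)
    rw [hl, add_zero]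
    refine Finset.sum_congr rfl fun i hi => ?_
    rw [Finset.sum_range_succ', if_neg (by omega), add_zero]
    refine Finset.sum_congr rfl fun j hj' => ?_
    rw [Finset.mem_range] at hj'
    by_cases hj : j ≤ i
    · rw [if_pos hj, if_neg (by omega)]
    · rw [if_neg hj, if_pos (by omega), h3 i j (by omega) (by omega), ← add_assoc,
        pow_succ, mul_neg_one, neg_smul]
  rw [hA, hB, ← Finset.sum_add_distrib, Finset.sum_comm (s := Finset.range (n + 1)), add_assoc,
    ← Finset.sum_add_distrib]
  refine (congrArg (_ + ·) (Finset.sum_eq_zero fun i _ => ?_)).trans (add_zero _)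
  rw [← Finset.sum_add_distrib, ← Finset.sum_add_distrib]
  refine Finset.sum_eq_zero fun j _ => ?_
  split_ifs <;> simp

/-- Removing a place `j ≤ i` removes one of the `i + 1` marked places; removing a later place leaves
their number unchanged. -/
theorem op_degen_conjBelow_op_face {n : ℕ} (i j : ℕ) (φ : Cochain k B n) :
    op (degen i) (conjBelow r η (i + 1) (op (face j) φ)) =
      op ((degen i).comp (face j)) (conjBelow r η (if j ≤ i then i else i + 1) φ) := by
  rw [conjBelow, conjOp_op, op_comp, conjBelow]
  congr 4
  funext l
  rw [decide_eq_decide]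
  change (if l.1 < j then l.1 else l.1 + 1) < i + 1 ↔ _
  split_ifs <;> omega

theorem op_congr {m n : ℕ} {σ τ : Fin (n + 1) →o Fin (m + 1)} (h : ∀ i, (σ i : ℕ) = τ i)
    (φ : Cochain k B n) : op σ φ = op τ φ := by
  obtain rfl : σ = τ := OrderHom.ext _ _ (funext fun i => Fin.ext (h i))
  rfl

theorem degen_face_val {n : ℕ} (i j : ℕ) (l : Fin (n + 1)) :
    ((degen i).comp (face j) l : ℕ) =
      if (if l.1 < j then l.1 else l.1 + 1) ≤ i then min (if l.1 < j then l.1 else l.1 + 1) n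
      else (if l.1 < j then l.1 else l.1 + 1) - 1 := rfl

theorem face_degen_val {n : ℕ} (i j : ℕ) (l : Fin (n + 2)) :
    ((face j).comp (degen (n := n) i) l : ℕ) =
      if (if l.1 ≤ i then min l.1 n else l.1 - 1) < j
      then (if l.1 ≤ i then min l.1 n else l.1 - 1)
      else (if l.1 ≤ i then min l.1 n else l.1 - 1) + 1 := rfl

theorem op_degen_face_self {n : ℕ} {i j : ℕ} (hi : i ≤ n) (hj : j = i ∨ j = i + 1)
    (φ : Cochain k B n) : op ((degen i).comp (face j)) φ = φ := by
  refine Eq.trans (op_congr (fun l => ?_) φ) (op_id φ)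
  rw [degen_face_val]
  change _ = l.1
  have := l.2
  split_ifs <;> omega

theorem conjHomotopy_coboundary {n : ℕ} (φ : Cochain k B n) :
    conjHomotopy r η n (coboundary n φ) =
      ∑ i ∈ Finset.range (n + 1), ∑ j ∈ Finset.range (n + 2), (-1 : k) ^ (i + j) •
        op ((degen i).comp (face j)) (conjBelow r η (if j ≤ i then i else i + 1) φ) := by
  rw [conjHomotopy_apply, coboundary_eq_sum_face]
  refine Finset.sum_congr rfl fun i _ => ?_
  rw [map_sum, map_sum, Finset.smul_sum]
  refine Finset.sum_congr rfl fun j _ => ?_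
  rw [map_smul, map_smul, smul_smul, ← pow_add, op_degen_conjBelow_op_face]

theorem coboundary_conjHomotopy {n : ℕ} (φ : Cochain k B (n + 1)) :
    coboundary n (conjHomotopy r η n φ) =
      ∑ j ∈ Finset.range (n + 2), ∑ i ∈ Finset.range (n + 1), (-1 : k) ^ (i + j) •
        op ((face j).comp (degen i)) (conjBelow r η (i + 1) φ) := by
  rw [conjHomotopy_apply, coboundary_eq_sum_face]
  refine Finset.sum_congr rfl fun j _ => ?_
  rw [map_sum, Finset.smul_sum]
  refine Finset.sum_congr rfl fun i _ => ?_
  rw [map_smul, smul_smul, ← pow_add, op_comp, add_comm j i]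

/-- Degree `0` of the homotopy formula, where the term `d h` is absent. -/
theorem conjHomotopy_coboundary_zero (φ : Cochain k B 0) :
    conjHomotopy r η 0 (coboundary 0 φ) = conjBelow r η 0 φ - conjBelow r η 1 φ := by
  rw [conjHomotopy_coboundary]
  have := sum_homotopy (k := k) 0
    (fun i j => op ((degen i).comp (face j)) (conjBelow r η (if j ≤ i then i else i + 1) φ))
    (fun _ _ => 0) (fun i => conjBelow r η i φ)
    (fun i hi => by rw [if_pos le_rfl, op_degen_face_self hi (Or.inl rfl)])
    (fun i hi => by rw [if_neg (by omega), op_degen_face_self hi (Or.inr rfl)])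
    (fun i j hi => absurd hi (Nat.not_lt_zero i)) (fun i j hi hj => by omega)
  simpa using this

/-- The homotopy formula `h d + d h = id - (conjugation at all places)`: on a cochain of degree `n +
1` all `n + 2` places are marked on the far side, and none on the near side. -/
theorem conjHomotopy_coboundary_add {n : ℕ} (φ : Cochain k B (n + 1)) :
    conjHomotopy r η (n + 1) (coboundary (n + 1) φ) + coboundary n (conjHomotopy r η n φ) =
      conjBelow r η 0 φ - conjBelow r η (n + 2) φ := by
  rw [conjHomotopy_coboundary, coboundary_conjHomotopy]
  refine sum_homotopy (k := k) (n + 1) _ _ (fun i => conjBelow r η i φ)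
    (fun i hi => by rw [if_pos le_rfl, op_degen_face_self hi (Or.inl rfl)])
    (fun i hi => by rw [if_neg (by omega), op_degen_face_self hi (Or.inr rfl)]) ?_ ?_
  · intro i j hi hj
    rw [if_pos (by omega)]
    refine op_congr (fun l => ?_) _
    rw [degen_face_val, face_degen_val]
    have := l.2
    split_ifs <;> omega
  · intro i j hi hj
    rw [if_neg (by omega)]
    refine op_congr (fun l => ?_) _
    rw [degen_face_val, face_degen_val]
    have := l.2
    split_ifs <;> omega

theorem conjBelow_zero {n : ℕ} (φ : Cochain k B n) : conjBelow r η 0 φ = φ :=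
  conjOp_false r η _ (fun _ => by simp) φ

-- Conjugation by homogeneous isomorphisms multiplies the potential of a homogeneous string on the
-- left by the degree `t (x i)` at each marked place. These factors telescope and are undone by the
-- outer isomorphisms.
variable (k) in
theorem isClassOne_conjOp (G : Type uG) [Group G] [GradedCategory k G B] (t : B → G)
    (hη : ∀ b, (η b).hom ∈ GradedCategory.deg (k := k) b (r b) (t b))
    (hη' : ∀ b, (η b).inv ∈ GradedCategory.deg (k := k) (r b) b (t b)⁻¹) {n : ℕ}
    (ε : Fin (n + 1) → Bool) {φ : Cochain k B n} (hφ : IsClassOne k G φ) :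
    IsClassOne k G (conjOp r η ε φ) := by
  have hs : ∀ c b, (selIso r η c b).hom ∈
      GradedCategory.deg (k := k) b (bif c then r b else b) (bif c then t b else 1) := by
    rintro (_ | _) b
    · exact GradedCategory.id_mem b
    · exact hη b
  have hs' : ∀ c b, (selIso r η c b).inv ∈
      GradedCategory.deg (k := k) (bif c then r b else b) b (bif c then t b else 1)⁻¹ := by
    rintro (_ | _) b
    · change 𝟙 b ∈ GradedCategory.deg (k := k) b b (1 : G)⁻¹
      rw [inv_one]; exact GradedCategory.id_mem b
    · exact hη' b
  refine isClassOne_of_potential k G fun x f p hf => ?_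
  rw [conjOp_apply]
  have h1 := hφ (fun i => bif ε i then r (x i) else x i)
    (fun i => ((bif ε i.succ then t (x i.succ) else 1) * p i.succ) *
      ((bif ε i.castSucc then t (x i.castSucc) else 1) * p i.castSucc)⁻¹)
    (conjStr (fun i => selIso r η (ε i) (x i)) f) (fun i => by
      have := GradedCategory.comp_mem (hs' (ε i.castSucc) (x i.castSucc))
        (GradedCategory.comp_mem (hf i) (hs (ε i.succ) (x i.succ)))
      rw [conjStr]
      convert this using 1
      group)
  rw [degProd_telescope (fun i => (bif ε i then t (x i) else 1) * p i)] at h1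
  have := GradedCategory.comp_mem (hs (ε 0) (x 0))
    (GradedCategory.comp_mem h1 (hs' (ε (Fin.last n)) (x (Fin.last n))))
  convert this using 1
  group

theorem isClassOne_conjHomotopy (G : Type uG) [Group G] [GradedCategory k G B] (t : B → G)
    (hη : ∀ b, (η b).hom ∈ GradedCategory.deg (k := k) b (r b) (t b))
    (hη' : ∀ b, (η b).inv ∈ GradedCategory.deg (k := k) (r b) b (t b)⁻¹) {n : ℕ}
    {φ : Cochain k B (n + 1)} (hφ : IsClassOne k G φ) :
    IsClassOne k G (conjHomotopy r η n φ) := by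
  rw [conjHomotopy_apply]
  exact Submodule.sum_mem (classOneSubmodule k G B n) fun i _ =>
    Submodule.smul_mem _ _ (isClassOne_op k G _ (isClassOne_conjOp k r η G t hη hη' _ hφ))

/-- Since `t > n`, every place is marked, so `φ` is evaluated only on strings of objects `r (x i)`,
all of which lie in `P`. -/
theorem conjBelow_eq_zero (P : ObjectProperty B) (hr : ∀ b, P (r b)) {n t : ℕ} (ht : n < t)
    {φ : Cochain k B n} (hφ : pullFun P.ι φ = 0) : conjBelow r η t φ = 0 := by
  have e : (fun i : Fin (n + 1) => decide (i.1 < t)) = fun _ => true := by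
    funext i
    have := i.2
    simp only [decide_eq_true_eq]; omega
  rw [conjBelow, e]
  funext x; ext f
  rw [conjOp_apply]
  have h := map_pullFun P.ι φ (fun i => ⟨r (x i), hr (x i)⟩)
    (fun i => P.ι.preimage (conjStr (fun i => selIso r η true (x i)) f i))
  rw [hφ] at h
  simp only [Functor.map_preimage] at h
  have h' : φ (fun i => r (x i)) (conjStr (fun i => selIso r η true (x i)) f) = 0 :=
    h.symm.trans (P.ι.map_zero _ _)
  refine (congrArg (fun q => (selIso r η true (x 0)).hom ≫ q ≫
    (selIso r η true (x (Fin.last n))).inv) h').trans ?_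
  simp

/-- If every object is isomorphic, by a homogeneous isomorphism, to an object of the full
subcategory `P`, then a cocycle of class `1` which vanishes on `P` is the coboundary of a cochain
of class `1`. -/
theorem mem_Bd_of_restrict_eq_zero (G : Type uG) [Group G] [GradedCategory k G B] (t : B → G)
    (hη : ∀ b, (η b).hom ∈ GradedCategory.deg (k := k) b (r b) (t b))
    (hη' : ∀ b, (η b).inv ∈ GradedCategory.deg (k := k) (r b) b (t b)⁻¹)
    (P : ObjectProperty B) (hr : ∀ b, P (r b)) {n : ℕ} (φ : (classOneCochains k G B).X n)
    (hφ : φ ∈ (classOneCochains k G B).Z n) (h0 : (classOneRestrict k G P).f n φ = 0) :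
    φ ∈ (classOneCochains k G B).Bd n := by
  obtain ⟨φ, hc⟩ := φ
  change Cochain k B n at φ
  have hφ' : coboundary n φ = 0 := congrArg Subtype.val hφ
  have h0' : pullFun P.ι φ = 0 := congrArg Subtype.val h0
  cases n with
  | zero =>
    -- The only coboundary of degree `0` is zero, and the homotopy formula indeed gives `φ = 0`.
    have h := conjHomotopy_coboundary_zero r η φ
    rw [hφ', map_zero, conjBelow_zero, conjBelow_eq_zero r η P hr one_pos h0', sub_zero] at h
    exact Subtype.ext h.symm
  | succ n =>
    have h := conjHomotopy_coboundary_add r η φ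
    rw [hφ', map_zero, conjBelow_zero, conjBelow_eq_zero r η P hr (by omega) h0', sub_zero,
      zero_add] at h
    exact ⟨⟨conjHomotopy r η n φ, isClassOne_conjHomotopy r η G t hη hη' hc⟩, Subtype.ext h⟩

end Conjugation

/-! ### The category `C` inside `C[G]` and the homogeneous isomorphisms from `x` to `s • x` -/

section SkewInclusion

variable (k : Type uk) [Field k] {G : Type uG} [Group G] {C : Type u} [Category.{v} C]
  [Preadditive C] [Linear k C] [MulAction G C] [GCategory k G C]

open scoped Classical in
/-- The homogeneous morphism of degree `s` of `C[G]` given by a morphism of `C`. -/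
noncomputable def homog (s : G) {x y : C} : (s • x ⟶ y) →ₗ[k] ((⟨x⟩ : Skew k G C) ⟶ ⟨y⟩) :=
  DirectSum.lof k G (fun r : G => (r • x ⟶ y)) s

theorem homog_comp {x y z : C} (s t : G) (f : s • x ⟶ y) (g : t • y ⟶ z) :
    homog k s f ≫ homog k t g = homog k (t * s) (eqToHom (mul_smul t s x) ≫ act k t f ≫ g) :=
  skewComp_lof k G s t f g

theorem homog_congr {x y : C} {s t : G} (h : s = t) {f : s • x ⟶ y} {g : t • x ⟶ y}
    (hf : HEq f g) : homog k s f = homog k t g :=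
  lof_eq k G h hf

theorem homog_mem (s : G) {x y : C} (f : s • x ⟶ y) :
    homog k s f ∈ GradedCategory.deg (k := k) (⟨x⟩ : Skew k G C) ⟨y⟩ s :=
  ⟨f, rfl⟩

theorem homog_comp_one {x y z : C} (s : G) (f : s • x ⟶ y) (g : y ⟶ z) :
    homog k s f ≫ homog k (1 : G) (eqToHom (one_smul G y) ≫ g) = homog k s (f ≫ g) := by
  rw [homog_comp]
  refine homog_congr k (one_mul s) (heq_eqToHom_comp _ ?_)
  exact comp_heq (one_smul G _) (one_smul G _) (GCategory.one_act f)
    (heq_eqToHom_comp _ HEq.rfl)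

theorem one_comp_homog {x y z : C} (s : G) (f : x ⟶ y) (g : s • y ⟶ z) :
    homog k (1 : G) (eqToHom (one_smul G x) ≫ f) ≫ homog k s g = homog k s (act k s f ≫ g) := by
  rw [homog_comp]
  refine homog_congr k (mul_one s) (heq_eqToHom_comp _ ?_)
  refine comp_heq (congrArg (s • ·) (one_smul G x)) rfl ?_ HEq.rfl
  exact act_heq k s (one_smul G x) rfl (heq_eqToHom_comp _ HEq.rfl)

variable (G) in
/-- The inclusion of `C` in `C[G]` as the subcategory of morphisms of degree `1`. -/
noncomputable def skewIncl {x y : C} : (x ⟶ y) →ₗ[k] ((⟨x⟩ : Skew k G C) ⟶ ⟨y⟩) :=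
  (homog k (1 : G)).comp (Linear.leftComp k y (eqToHom (one_smul G x)))

theorem skewIncl_apply {x y : C} (f : x ⟶ y) :
    skewIncl k G f = homog k (1 : G) (eqToHom (one_smul G x) ≫ f) := rfl

theorem skewIncl_id (x : C) : skewIncl k G (𝟙 x) = 𝟙 (⟨x⟩ : Skew k G C) := by
  rw [skewIncl_apply, Category.comp_id]; rfl

theorem skewIncl_comp {x y z : C} (f : x ⟶ y) (g : y ⟶ z) :
    skewIncl k G (f ≫ g) = skewIncl k G f ≫ skewIncl k G g := by
  simp only [skewIncl_apply]
  rw [homog_comp_one, Category.assoc]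

theorem skewIncl_mem {x y : C} (f : x ⟶ y) :
    skewIncl k G f ∈ GradedCategory.deg (k := k) (⟨x⟩ : Skew k G C) ⟨y⟩ (1 : G) :=
  homog_mem k 1 _

variable (G) in
open scoped Classical in
/-- The projection of the morphisms of `C[G]` to those of degree `1`. -/
noncomputable def degOne (x y : C) : ((⟨x⟩ : Skew k G C) ⟶ ⟨y⟩) →ₗ[k] (x ⟶ y) :=
  (Linear.leftComp k y (eqToHom (one_smul G x).symm)).comp
    (DirectSum.component k G (fun r : G => (r • x ⟶ y)) 1)

theorem degOne_homog {x y : C} (f : (1 : G) • x ⟶ y) :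
    degOne k G x y (homog k (1 : G) f) = eqToHom (one_smul G x).symm ≫ f := by
  classical
  exact congrArg (eqToHom (one_smul G x).symm ≫ ·) 
    (DirectSum.component.lof_self k (M := fun r : G => (r • x ⟶ y)) 1 f)

theorem degOne_skewIncl {x y : C} (f : x ⟶ y) : degOne k G x y (skewIncl k G f) = f := by
  rw [skewIncl_apply, degOne_homog]; simp

theorem skewIncl_degOne {x y : C} {m : (⟨x⟩ : Skew k G C) ⟶ ⟨y⟩}
    (hm : m ∈ GradedCategory.deg (k := k) (⟨x⟩ : Skew k G C) ⟨y⟩ (1 : G)) :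
    skewIncl k G (degOne k G x y m) = m := by
  obtain ⟨f, rfl⟩ := hm
  change skewIncl k G (degOne k G x y (homog k 1 f)) = homog k 1 f
  rw [degOne_homog, skewIncl_apply]; simp

theorem skewIncl_injective {x y : C} {f g : x ⟶ y}
    (h : skewIncl k G f = skewIncl k G g) : f = g := by
  rw [← degOne_skewIncl k (G := G) f, h, degOne_skewIncl]

/-- The isomorphism `x ⟶ s x` of degree `s` in `C[G]`. -/
noncomputable def skewIso (s : G) (x : C) : (⟨x⟩ : Skew k G C) ≅ ⟨s • x⟩ where
  hom := homog k s (𝟙 _)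
  inv := homog k s⁻¹ (eqToHom (inv_smul_smul s x))
  hom_inv_id := by
    rw [homog_comp]
    refine homog_congr k (inv_mul_cancel s) (heq_eqToHom_comp _ ?_)
    rw [GCategory.act_id, Category.id_comp]
    exact (eqToHom_heq_id_cod _ _ _).trans (eqToHom_heq_id_cod _ _ _).symm
  inv_hom_id := by
    rw [homog_comp]
    refine homog_congr k (mul_inv_cancel s) (heq_eqToHom_comp _ ?_)
    rw [Category.comp_id]
    exact (act_eqToHom_heq k G s _).trans (eqToHom_heq_id_cod _ _ _).symm

theorem skewIso_hom_mem (s : G) (x : C) : (skewIso k s x).hom ∈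
    GradedCategory.deg (k := k) (⟨x⟩ : Skew k G C) ⟨s • x⟩ s :=
  homog_mem k s _

theorem skewIso_inv_mem (s : G) (x : C) : (skewIso k s x).inv ∈
    GradedCategory.deg (k := k) (⟨s • x⟩ : Skew k G C) ⟨x⟩ s⁻¹ :=
  homog_mem k s⁻¹ _

/-- This is the sense in which the action of `G` becomes inner: conjugation by `skewIso` realizes `f
↦ s f`. -/
theorem skewIso_naturality (s : G) {x y : C} (f : x ⟶ y) :
    skewIncl k G f ≫ (skewIso k s y).hom =
      (skewIso k s x).hom ≫ skewIncl k G (act k s f) := by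
  change _ ≫ homog k s _ = homog k s _ ≫ _
  rw [skewIncl_apply, skewIncl_apply, homog_comp_one, one_comp_homog, Category.comp_id,
    Category.id_comp]

/-- The isomorphisms are multiplicative in the group element, up to the identification of `(t * s) •
x` with `t • s • x`. This controls the effect of translating a potential. -/
theorem skewIso_mul (s t : G) (x : C) :
    (skewIso k s x).hom ≫ (skewIso k t (s • x)).hom =
      (skewIso k (t * s) x).hom ≫ skewIncl k G (eqToHom (mul_smul t s x)) := by
  change homog k s _ ≫ homog k t _ = homog k (t * s) _ ≫ _
  rw [skewIncl_apply, homog_comp_one, homog_comp, GCategory.act_id, Category.comp_id,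
    Category.comp_id, Category.id_comp]

variable {n : ℕ}

/-- The string of `C[G]` obtained from a string of `C` along `p • x` by conjugation with the
isomorphisms `x i ⟶ p i • x i`; its morphisms have degree `(p (i + 1))⁻¹ * p i`. -/
noncomputable def skewStr (x : Fin (n + 1) → C) (p : Fin (n + 1) → G)
    (F : Str (fun i => p i • x i)) : Str (fun i => (⟨x i⟩ : Skew k G C)) :=
  conjStr (fun i => (skewIso k (p i) (x i)).symm) (fun i => skewIncl k G (F i))

theorem skewStr_apply (x : Fin (n + 1) → C) (p : Fin (n + 1) → G)
    (F : Str (fun i => p i • x i)) (i : Fin n) :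
    skewStr k x p F i = (skewIso k (p i.castSucc) (x i.castSucc)).hom ≫
      skewIncl k G (F i) ≫ (skewIso k (p i.succ) (x i.succ)).inv := rfl

theorem conj_mem {x y : C} (p q : G) (f : p • x ⟶ q • y) :
    (skewIso k p x).hom ≫ skewIncl k G f ≫ (skewIso k q y).inv ∈
      GradedCategory.deg (k := k) (⟨x⟩ : Skew k G C) ⟨y⟩ (q⁻¹ * p) := by
  have := GradedCategory.comp_mem (skewIso_hom_mem k p x)
    (GradedCategory.comp_mem (skewIncl_mem k (G := G) f) (skewIso_inv_mem k q y))
  rwa [mul_one] at this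

/-- Conjugation changes the degree from `s` to `q * s * p⁻¹ = 1`, so the conjugated morphism comes
from `C` and the projection to degree `1` loses nothing. -/
theorem degOne_conj_mem {x y : C} {s p q : G} (h : q⁻¹ * p = s) {m : (⟨x⟩ : Skew k G C) ⟶ ⟨y⟩}
    (hm : m ∈ GradedCategory.deg (k := k) (⟨x⟩ : Skew k G C) ⟨y⟩ s) :
    (skewIso k p x).hom ≫ skewIncl k G
        (degOne k G _ _ ((skewIso k p x).inv ≫ m ≫ (skewIso k q y).hom)) ≫
      (skewIso k q y).inv = m := by
  have := GradedCategory.comp_mem (skewIso_inv_mem k p x)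
    (GradedCategory.comp_mem hm (skewIso_hom_mem k q y))
  rw [← h, mul_inv_cancel_left, mul_inv_cancel] at this
  rw [skewIncl_degOne k this]
  simp

/-- Every homogeneous string of `C[G]` comes from a string of `C`. -/
theorem exists_skewStr (x : Fin (n + 1) → C) (p : Fin (n + 1) → G)
    (f : Str (fun i => (⟨x i⟩ : Skew k G C)))
    (hf : ∀ i : Fin n, f i ∈ GradedCategory.deg (k := k) (⟨x i.castSucc⟩ : Skew k G C)
      ⟨x i.succ⟩ ((p i.succ)⁻¹ * p i.castSucc)) :
    ∃ F : Str (fun i => p i • x i), skewStr k x p F = f :=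
  ⟨fun i => degOne k G _ _ ((skewIso k (p i.castSucc) (x i.castSucc)).inv ≫ f i ≫
    (skewIso k (p i.succ) (x i.succ)).hom), funext fun i => degOne_conj_mem k rfl (hf i)⟩

/-- Inverses appear because a morphism of `C` from `p • x` to `q • y`, seen as a morphism from `x`
to `y` in `C[G]`, has degree `q⁻¹ * p`. -/
theorem exists_inv_potential (s : Fin n → G) :
    ∃ p : Fin (n + 1) → G, (∀ i : Fin n, (p i.succ)⁻¹ * p i.castSucc = s i) ∧
      (p (Fin.last n))⁻¹ * p 0 = degProd s := by
  obtain ⟨p, hp, hp'⟩ := exists_potential G s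
  exact ⟨fun i => (p i)⁻¹, fun i => by rw [inv_inv, hp], by rw [inv_inv, hp']⟩

theorem chain_skewIncl (x : Fin (n + 1) → C) (F : Str x) {a b : Fin (n + 1)} (h : a ≤ b) :
    chain (fun i => (⟨x i⟩ : Skew k G C)) (fun i => skewIncl k G (F i)) h =
      skewIncl k G (chain x F h) := by
  refine chain_induction x F a (fun b h q => chain (fun i => (⟨x i⟩ : Skew k G C))
    (fun i => skewIncl k G (F i)) h = skewIncl k G q) ?_ ?_ h
  · rw [chain_self, skewIncl_id]
  · intro i h h' ih
    rw [skewIncl_comp, ← ih, ← chain_comp _ _ h (Fin.castSucc_lt_succ (i := i)).le, chain_succ]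

theorem chain_skewStr (x : Fin (n + 1) → C) (p : Fin (n + 1) → G)
    (F : Str (fun i => p i • x i)) {a b : Fin (n + 1)} (h : a ≤ b) :
    chain (fun i => (⟨x i⟩ : Skew k G C)) (skewStr k x p F) h =
      (skewIso k (p a) (x a)).hom ≫ skewIncl k G (chain (fun i => p i • x i) F h) ≫
        (skewIso k (p b) (x b)).inv := by
  rw [skewStr, chain_conjStr, chain_skewIncl]
  rfl

theorem pull_skewStr {m : ℕ} (σ : Fin (n + 1) →o Fin (m + 1)) (x : Fin (m + 1) → C)
    (p : Fin (m + 1) → G) (F : Str (fun i => p i • x i)) :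
    pull σ (fun i => (⟨x i⟩ : Skew k G C)) (skewStr k x p F) =
      skewStr k (fun i => x (σ i)) (fun i => p (σ i)) (pull σ (fun i => p i • x i) F) := by
  funext i
  exact chain_skewStr k x p F _

end SkewInclusion

/-! ### Maps induced on cohomology and a criterion for quasi-isomorphisms -/

section DGGeneral

variable {k : Type uk} [Field k]

theorem DGAlgebra.cls_eq_zero_iff (A : DGAlgebra.{uk, w} k) {n : ℕ} (z : A.Z n) :
    A.cls n z = 0 ↔ (z : A.X n) ∈ A.Bd n :=
  Submodule.Quotient.mk_eq_zero _

namespace DGHom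

variable {A : DGAlgebra.{uk, w} k} {B : DGAlgebra.{uk, w'} k} {E : DGAlgebra.{uk, v} k}

theorem map_mem_Z (F : DGHom A B) {n : ℕ} {a : A.X n} (ha : a ∈ A.Z n) : F.f n a ∈ B.Z n := by
  have ha' : A.d n a = 0 := ha
  change B.d n (F.f n a) = 0
  rw [← F.map_d, ha', map_zero]

theorem mapH_cls (F : DGHom A B) {n : ℕ} (z : A.Z n) :
    F.mapH n (A.cls n z) = B.cls n ⟨F.f n z.1, F.map_mem_Z z.2⟩ := rfl

theorem mapH_comp (g : DGHom B E) (f : DGHom A B) {n : ℕ} (y : A.H n) :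
    (g.comp f).mapH n y = g.mapH n (f.mapH n y) := by
  obtain ⟨z, rfl⟩ := A.cls_surjective n y
  rfl

theorem mapH_id {n : ℕ} (y : A.H n) : (DGHom.id A).mapH n y = y := by
  obtain ⟨z, rfl⟩ := A.cls_surjective n y
  rfl

theorem mapHAlg_comp (g : DGHom B E) (f : DGHom A B) (z : A.HAlg) :
    (g.comp f).mapHAlg z = g.mapHAlg (f.mapHAlg z) := by
  induction z using DirectSum.induction_on with
  | zero => simp
  | of n y => rw [mapHAlg_of, mapHAlg_of, mapHAlg_of, mapH_comp]
  | add y z hy hz => simp only [map_add, hy, hz]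

theorem mapHAlg_apply (F : DGHom A B) (z : A.HAlg) (n : ℕ) : F.mapHAlg z n = F.mapH n (z n) := by
  induction z using DirectSum.induction_on with
  | zero => simp
  | of m y =>
    rw [mapHAlg_of]
    by_cases h : m = n
    · subst h; rw [DirectSum.of_eq_same, DirectSum.of_eq_same]
    · rw [DirectSum.of_eq_of_ne _ _ _ (Ne.symm h), DirectSum.of_eq_of_ne _ _ _ (Ne.symm h),
        map_zero]
  | add y z hy hz => simp only [map_add, DirectSum.add_apply, hy, hz]

theorem mapHAlg_injective (F : DGHom A B) (h : ∀ n, Function.Injective (F.mapH n)) :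
    Function.Injective F.mapHAlg := by
  intro y z hyz
  refine DFinsupp.ext fun n => h n ?_
  rw [← mapHAlg_apply, hyz, mapHAlg_apply]

/-- A class all of whose components come from `A` comes from `A`. -/
theorem exists_mapHAlg_eq (F : DGHom A B) (z : B.HAlg) (h : ∀ n, ∃ y, F.mapH n y = z n) :
    ∃ y, F.mapHAlg y = z := by
  classical
  choose y hy using h
  refine ⟨∑ n ∈ z.support, DirectSum.of A.H n (y n), ?_⟩
  rw [map_sum]
  simp only [mapHAlg_of, hy]
  exact DirectSum.sum_support_of z

theorem mapHAlg_bijective (F : DGHom A B) (h : ∀ n, Function.Bijective (F.mapH n)) :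
    Function.Bijective F.mapHAlg :=
  ⟨F.mapHAlg_injective fun n => (h n).1,
    fun z => F.exists_mapHAlg_eq z fun n => (h n).2 (z n)⟩

/-- The inverse of a bijective morphism of DG-algebras. -/
noncomputable def inverse (F : DGHom A B) (h : ∀ n, Function.Bijective (F.f n)) : DGHom B A where
  f n := (LinearEquiv.ofBijective (F.f n) (h n)).symm.toLinearMap
  map_d n b := by
    obtain ⟨a, rfl⟩ := (h n).2 b
    apply (h (n + 1)).1
    have e : ∀ (m : ℕ) (c : B.X m), F.f m ((LinearEquiv.ofBijective (F.f m) (h m)).symm c) = c :=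
      fun m c => (LinearEquiv.ofBijective (F.f m) (h m)).apply_symm_apply c
    simp only [LinearEquiv.coe_coe]
    rw [e, F.map_d, e]
  map_one := by
    apply (h 0).1
    exact ((LinearEquiv.ofBijective (F.f 0) (h 0)).apply_symm_apply _).trans F.map_one.symm
  map_mul {m n} a b := by
    apply (h (m + n)).1
    have e : ∀ (m : ℕ) (c : B.X m), F.f m ((LinearEquiv.ofBijective (F.f m) (h m)).symm c) = c :=
      fun m c => (LinearEquiv.ofBijective (F.f m) (h m)).apply_symm_apply c
    simp only [LinearEquiv.coe_coe]
    rw [e, F.map_mul, e, e]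

theorem inverse_comp (F : DGHom A B) (h : ∀ n, Function.Bijective (F.f n)) :
    (F.inverse h).comp F = DGHom.id A :=
  DGHom.ext (funext fun n => LinearMap.ext fun a =>
    (LinearEquiv.ofBijective (F.f n) (h n)).symm_apply_apply a)

theorem comp_inverse (F : DGHom A B) (h : ∀ n, Function.Bijective (F.f n)) :
    F.comp (F.inverse h) = DGHom.id B :=
  DGHom.ext (funext fun n => LinearMap.ext fun a =>
    (LinearEquiv.ofBijective (F.f n) (h n)).apply_symm_apply a)

/-- If `R ∘ F` is an isomorphism and cocycles killed by `R` are coboundaries, then `F` induces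
isomorphisms on cohomology. -/
theorem mapH_bijective_of_comp (F : DGHom A B) (R : DGHom B E)
    (h : ∀ n, Function.Bijective ((R.comp F).f n))
    (hR : ∀ (n : ℕ) (b : B.X n), b ∈ B.Z n → R.f n b = 0 → b ∈ B.Bd n) (n : ℕ) :
    Function.Bijective (F.mapH n) := by
  constructor
  -- A left inverse on cohomology is `H((R F)⁻¹) ∘ H(R)`.
  · refine Function.LeftInverse.injective
      (g := fun y => ((R.comp F).inverse h).mapH n (R.mapH n y)) fun y => ?_
    dsimp only
    rw [← mapH_comp R F, ← mapH_comp, inverse_comp, mapH_id]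
  · intro y
    obtain ⟨z, rfl⟩ := B.cls_surjective n y
    have hZ := ((R.comp F).inverse h).map_mem_Z (R.map_mem_Z z.2)
    -- The preimage of the class of `z` is the class of `a = (R F)⁻¹ (R z)`: the cocycle `F a - z`
    -- is killed by `R`, hence a coboundary.
    refine ⟨A.cls n ⟨_, hZ⟩, ?_⟩
    rw [mapH_cls, ← sub_eq_zero, ← map_sub, DGAlgebra.cls_eq_zero_iff]
    refine hR n _ (Submodule.coe_mem _) ?_
    have e : R.f n (F.f n (((R.comp F).inverse h).f n (R.f n z.1))) = R.f n z.1 :=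
      (LinearEquiv.ofBijective ((R.comp F).f n) (h n)).apply_symm_apply _
    rw [Submodule.coe_sub, map_sub, e, sub_self]

end DGHom

end DGGeneral

/-! ### Cohomology of invariants when the invariants functor is exact -/

section Exact

variable {k : Type uk} [Field k] {G : Type uG} [Group G]

/-- If the invariants functor is exact, then a surjective equivariant map is surjective on
invariants. -/
theorem exists_invariant_preimage
    (hex : exactFunctor (Rep.{max uk uG w} k G) (ModuleCat.{max uk uG w} k)
      (Rep.invariantsFunctor k G))
    {V W : Type w} [AddCommGroup V] [Module k V] [AddCommGroup W] [Module k W]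
    (ρ : Representation k G V) (ρ' : Representation k G W) (f : V →ₗ[k] W)
    (hf : ∀ g x, f (ρ g x) = ρ' g (f x)) (hsurj : Function.Surjective f) (y : W)
    (hy : ∀ g, ρ' g y = y) : ∃ x, (∀ g, ρ g x = x) ∧ f x = y := by
  -- Exactness is assumed for representations in a possibly larger universe, so the spaces and their
  -- actions are first lifted there.
  let V' := ULift.{max uk uG w} V
  let W' := ULift.{max uk uG w} W
  let eV : V ≃ₗ[k] V' := ULift.moduleEquiv.symm
  let eW : W ≃ₗ[k] W' := ULift.moduleEquiv.symm
  let σ : Representation k G V' := (eV.conjRingEquiv : _ →* _).comp ρ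
  let σ' : Representation k G W' := (eW.conjRingEquiv : _ →* _).comp ρ'
  let f' : V' →ₗ[k] W' := eW.toLinearMap.comp (f.comp eV.symm.toLinearMap)
  have hf' : ∀ g x, f' (σ g x) = σ' g (f' x) := fun g x =>
    congrArg eW (hf g (eV.symm x))
  let F : Rep.of σ ⟶ Rep.of σ' := Rep.ofHom (f'.intertwiningMap_of_isIntertwiningMap _ _ hf')
  have hF : Epi F := (Rep.epi_iff_surjective F).2 fun y => by
    obtain ⟨x, hx⟩ := hsurj (eW.symm y)
    exact ⟨eV x, congrArg eW hx⟩
  -- Only right exactness is needed: preserving finite colimits implies preserving epimorphisms.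
  have : Limits.PreservesFiniteColimits (Rep.invariantsFunctor.{max uk uG w} k G) := hex.2
  have hE : Epi ((Rep.invariantsFunctor k G).map F) := inferInstance
  obtain ⟨x, hx⟩ := (ModuleCat.epi_iff_surjective _).1 hE
    ⟨eW y, fun g => congrArg eW (hy g)⟩
  refine ⟨eV.symm x.1, fun g => congrArg eV.symm (x.2 g), ?_⟩
  exact congrArg (fun t => eW.symm t.1) hx

variable (A : DGAlgebra.{uk, w} k) (α : G → DGHom A A) (h1 : α 1 = DGHom.id A)
  (hmul : ∀ s t, α (s * t) = (α s).comp (α t))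

/-- The representations of `G` on the terms of a DG-algebra with an action of `G`. -/
def actRep (n : ℕ) : Representation k G (A.X n) where
  toFun s := (α s).f n
  map_one' := by rw [h1]; rfl
  map_mul' s t := by rw [hmul]; rfl

/-- The representations of `G` on the cohomology of a DG-algebra with an action of `G`. -/
def actRepH (n : ℕ) : Representation k G (A.H n) where
  toFun s := (α s).mapH n
  map_one' := LinearMap.ext fun y => by rw [h1]; exact DGHom.mapH_id y
  map_mul' s t := LinearMap.ext fun y => by rw [hmul]; exact DGHom.mapH_comp _ _ y

/-- The representation of `G` on an invariant subspace. -/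
def restrictRep {V : Type w} [AddCommGroup V] [Module k V] (ρ : Representation k G V)
    (S : Submodule k V) (hS : ∀ g, ∀ x ∈ S, ρ g x ∈ S) : Representation k G S where
  toFun s := (ρ s).restrict (hS s)
  map_one' := LinearMap.ext fun x => Subtype.ext (by simp)
  map_mul' s t := LinearMap.ext fun x => Subtype.ext (by simp)

-- An invariant cocycle that bounds in `A` must bound an invariant element. This is surjectivity on
-- invariants for `d`, viewed as an equivariant map onto its image; degree `0` has no nonzero
-- coboundaries.
include h1 hmul in
theorem mapH_subIncl_injective
    (hex : exactFunctor (Rep.{max uk uG w} k G) (ModuleCat.{max uk uG w} k)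
      (Rep.invariantsFunctor k G)) (P : A.SubDG)
    (hP : ∀ (n : ℕ) (a : A.X n), a ∈ P.S n ↔ ∀ s, (α s).f n a = a) (n : ℕ) :
    Function.Injective ((A.subIncl P).mapH n) := by
  rw [injective_iff_map_eq_zero]
  intro y hy
  obtain ⟨z, rfl⟩ := (A.sub P).cls_surjective n y
  rw [DGHom.mapH_cls, DGAlgebra.cls_eq_zero_iff] at hy
  rw [DGAlgebra.cls_eq_zero_iff]
  obtain ⟨z, hz⟩ := z
  change z.1 ∈ A.Bd n at hy
  cases n with
  | zero =>
    have hy' : z.1 = 0 := hy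
    exact Subtype.ext hy'
  | succ n =>
    have hS : ∀ s, ∀ x ∈ LinearMap.range (A.d n), (α s).f (n + 1) x ∈ LinearMap.range (A.d n) := by
      rintro s _ ⟨c, rfl⟩
      exact ⟨(α s).f n c, (DGHom.map_d _ _ _).symm⟩
    obtain ⟨x, hx, hxz⟩ := exists_invariant_preimage hex (actRep A α h1 hmul n)
      (restrictRep (actRep A α h1 hmul (n + 1)) (LinearMap.range (A.d n)) hS)
      (A.d n).rangeRestrict (fun s x => Subtype.ext ((α s).map_d n x).symm)
      (A.d n).surjective_rangeRestrict ⟨z.1, hy⟩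
      (fun s => Subtype.ext ((hP _ _).1 z.2 s))
    exact ⟨⟨x, (hP n x).2 hx⟩, Subtype.ext (show A.d n x = z.1 from congrArg Subtype.val hxz)⟩

-- An invariant class has an invariant representative: surjectivity on invariants for the projection
-- from cocycles to cohomology.
include h1 hmul in
theorem exists_mapH_subIncl_eq
    (hex : exactFunctor (Rep.{max uk uG w} k G) (ModuleCat.{max uk uG w} k)
      (Rep.invariantsFunctor k G)) (P : A.SubDG)
    (hP : ∀ (n : ℕ) (a : A.X n), a ∈ P.S n ↔ ∀ s, (α s).f n a = a) (n : ℕ) (y : A.H n)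
    (hy : ∀ s, (α s).mapH n y = y) : ∃ x, (A.subIncl P).mapH n x = y := by
  obtain ⟨z, hz, hzy⟩ := exists_invariant_preimage hex
    (restrictRep (actRep A α h1 hmul n) (A.Z n) fun s _ hx => (α s).map_mem_Z hx)
    (actRepH A α h1 hmul n) (A.cls n) (fun s x => rfl) (A.cls_surjective n) y hy
  refine ⟨(A.sub P).cls n ⟨⟨z.1, (hP n _).2 fun s => congrArg Subtype.val (hz s)⟩,
    Subtype.ext z.2⟩, hzy⟩

end Exact

/-! ### The group action on cochains and invariance as equivariance -/

section Invariant

variable {k : Type uk} [Field k] {G : Type uG} [Group G] {C : Type u} [Category.{v} C]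
  [Preadditive C] [Linear k C]

theorem pullback_congr {D : Type uG} [Category.{w} D] [Preadditive D] [Linear k D] {F F' : C ⥤ D}
    (h : F = F') [F.Additive] [F.Linear k] [F.Full] [F.Faithful]
    [F'.Additive] [F'.Linear k] [F'.Full] [F'.Faithful] :
    pullback (k := k) F = pullback F' := by
  subst h; rfl

theorem pullback_id : pullback (k := k) (𝟭 C) = DGHom.id (cochains k C) := by
  refine DGHom.ext (funext fun n => LinearMap.ext fun φ => ?_)
  funext x; ext f
  exact map_pullFun (𝟭 C) φ x f

theorem pullback_comp (F H : C ⥤ C) [F.Additive] [F.Linear k] [F.Full] [F.Faithful]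
    [H.Additive] [H.Linear k] [H.Full] [H.Faithful] :
    pullback (k := k) (F ⋙ H) = (pullback F).comp (pullback H) := by
  refine DGHom.ext (funext fun n => LinearMap.ext fun φ => ?_)
  funext x; ext f
  apply (F ⋙ H).map_injective
  refine (map_pullFun (F ⋙ H) φ x f).trans (Eq.symm ?_)
  change H.map (F.map (pullFun F (pullFun H φ) x f)) = _
  exact (congrArg H.map (map_pullFun F (pullFun H φ) x f)).trans (map_pullFun H φ _ _)

variable [MulAction G C] [GCategory k G C] {n : ℕ}

theorem actFunctor_one : actFunctor k C (1 : G) = 𝟭 C :=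
  Functor.hext (one_smul G) fun _ _ f => GCategory.one_act f

theorem actFunctor_mul (s t : G) : actFunctor k C (s * t) = actFunctor k C t ⋙ actFunctor k C s :=
  Functor.hext (mul_smul s t) fun _ _ f => GCategory.mul_act s t f

theorem cochainAct_one : cochainAct k C (1 : G) = DGHom.id (cochains k C) :=
  (pullback_congr (F' := 𝟭 C) (by rw [inv_one, actFunctor_one])).trans pullback_id

/-- Pull-back reverses composition, and the inverse in the definition of the action reverses it
back. -/
theorem cochainAct_mul (s t : G) :
    cochainAct k C (s * t) = (cochainAct k C s).comp (cochainAct k C t) :=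
  (pullback_congr (F' := actFunctor k C s⁻¹ ⋙ actFunctor k C t⁻¹)
    (by rw [mul_inv_rev, actFunctor_mul])).trans (pullback_comp _ _)

/-- The fixed-point condition involves the inverse of a functor on morphism spaces; equivariance of
the values is the form in which it is used and verified. -/
theorem invariant_iff (φ : Cochain k C n) :
    (∀ s : G, (cochainAct k C s).f n φ = φ) ↔ ∀ (t : G) (y : Fin (n + 1) → C) (F : Str y),
      φ (fun i => t • y i) (fun i => act k t (F i)) = act k t (φ y F) := by
  constructor
  · intro h t y F
    have h' : pullFun (actFunctor k C t) φ = φ := by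
      have h1 : cochainAct k C t⁻¹ = pullback (actFunctor k C t) :=
        pullback_congr (by rw [inv_inv])
      have h2 := h t⁻¹
      rw [h1] at h2
      exact h2
    have := map_pullFun (actFunctor k C t) φ y F
    rw [h'] at this
    exact this.symm
  · intro h s
    funext x; ext f
    apply (actFunctor k C s⁻¹).map_injective
    exact (map_pullFun (actFunctor k C s⁻¹) φ x f).trans (h s⁻¹ x f)

/-- Transport along equalities of objects, needed since `(t * p) • x` and `t • p • x` are only
propositionally equal. -/
theorem cochain_eqToHom (φ : Cochain k C n) {y y' : Fin (n + 1) → C} (h : ∀ i, y' i = y i)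
    (F : Str y) :
    φ y' (fun i => eqToHom (h i.castSucc) ≫ F i ≫ eqToHom (h i.succ).symm) =
      eqToHom (h 0) ≫ φ y F ≫ eqToHom (h (Fin.last n)).symm := by
  obtain rfl : y' = y := funext h
  simp

end Invariant

/-! ### Cochains are determined by homogeneous strings -/

section Homogeneous

variable {k : Type uk} [Field k] {G : Type uG} [Group G] {B : Type u} [Category.{v} B]
  [Preadditive B] [Linear k B] [GradedCategory k G B] {n : ℕ}

theorem exists_sum_homogeneous {x y : B} (f : x ⟶ y) :
    ∃ (A : Finset G) (g : G → (x ⟶ y)),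
      (∀ s, g s ∈ GradedCategory.deg (k := k) x y s) ∧ ∑ s ∈ A, g s = f := by
  classical
  have h : f ∈ ⨆ s : G, GradedCategory.deg (k := k) x y s := by
    rw [(GradedCategory.isInternal (k := k) x y).submodule_iSup_eq_top]
    exact Submodule.mem_top
  obtain ⟨g, hg, hgf⟩ := (Submodule.mem_iSup_iff_exists_finsupp _ _).1 h
  exact ⟨g.support, g, hg, hgf⟩

variable (k G) in
/-- Cochains which agree on strings of homogeneous morphisms are equal. -/
theorem cochain_ext_homogeneous {φ ψ : Cochain k B n}
    (h : ∀ (x : Fin (n + 1) → B) (s : Fin n → G) (f : Str x),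
      (∀ i, f i ∈ GradedCategory.deg (k := k) (x i.castSucc) (x i.succ) (s i)) →
        φ x f = ψ x f) : φ = ψ := by
  classical
  funext x; ext f
  choose A g hg hgf using fun i : Fin n => exists_sum_homogeneous (k := k) (G := G) (f i)
  obtain rfl : (fun i => ∑ s ∈ A i, g i s) = f := funext hgf
  rw [MultilinearMap.map_sum_finset, MultilinearMap.map_sum_finset]
  exact Finset.sum_congr rfl fun s _ => h x s _ fun i => hg i (s i)

end Homogeneous

/-! ### Extension of invariant cochains to `C[G]` -/

section SkewExtension

variable {k : Type uk} [Field k] {G : Type uG} [Group G] {C : Type u} [Category.{v} C]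
  [Preadditive C] [Linear k C] [MulAction G C] [GCategory k G C] {n : ℕ}

variable (k) in
/-- A morphism of `C` between `p x` and `q y`, conjugated to a morphism `x ⟶ y` of `C[G]`. -/
noncomputable def skewConj (p q : G) {x y : C} :
    (p • x ⟶ q • y) →ₗ[k] ((⟨x⟩ : Skew k G C) ⟶ ⟨y⟩) where
  toFun f := (skewIso k p x).hom ≫ skewIncl k G f ≫ (skewIso k q y).inv
  map_add' f g := by rw [map_add, Preadditive.add_comp, Preadditive.comp_add]
  map_smul' c f := by rw [map_smul, Linear.smul_comp, Linear.comp_smul]; rfl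

theorem skewConj_apply (p q : G) {x y : C} (f : p • x ⟶ q • y) :
    skewConj k p q f = (skewIso k p x).hom ≫ skewIncl k G f ≫ (skewIso k q y).inv := rfl

theorem skewConj_injective (p q : G) {x y : C} :
    Function.Injective (skewConj k p q : (p • x ⟶ q • y) → ((⟨x⟩ : Skew k G C) ⟶ ⟨y⟩)) := by
  intro f g h
  rw [skewConj_apply, skewConj_apply, cancel_epi, cancel_mono] at h
  exact skewIncl_injective k h

variable (k) in
/-- The component of `m : x ⟶ y` of the form `skewConj k p q f`. -/
noncomputable def skewUnconj (p q : G) {x y : C} :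
    ((⟨x⟩ : Skew k G C) ⟶ ⟨y⟩) →ₗ[k] (p • x ⟶ q • y) where
  toFun m := degOne k G _ _ ((skewIso k p x).inv ≫ m ≫ (skewIso k q y).hom)
  map_add' f g := by rw [Preadditive.add_comp, Preadditive.comp_add, map_add]
  map_smul' c f := by rw [Linear.smul_comp, Linear.comp_smul, map_smul]; rfl

theorem skewConj_skewUnconj {x y : C} {s p q : G} (h : q⁻¹ * p = s)
    {m : (⟨x⟩ : Skew k G C) ⟶ ⟨y⟩}
    (hm : m ∈ GradedCategory.deg (k := k) (⟨x⟩ : Skew k G C) ⟨y⟩ s) :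
    skewConj k p q (skewUnconj k p q m) = m :=
  degOne_conj_mem k h hm

theorem skewConj_mem (p q : G) {x y : C} (f : p • x ⟶ q • y) :
    skewConj k p q f ∈ GradedCategory.deg (k := k) (⟨x⟩ : Skew k G C) ⟨y⟩ (q⁻¹ * p) := by
  rw [skewConj_apply]
  exact conj_mem k p q f

theorem skewStr_eq (x : Fin (n + 1) → C) (p : Fin (n + 1) → G)
    (F : Str (fun i => p i • x i)) :
    skewStr k x p F = fun i => skewConj k (p i.castSucc) (p i.succ) (F i) :=
  funext fun i => (skewStr_apply k x p F i).trans (skewConj_apply _ _ _).symm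

/-- By `skewIso_mul` the isomorphism from `x` to `(t * p) • x` passes through `p • x`, and by
naturality the remaining conjugation by `t` turns `t f` back into `f`. Hence translating the
potential by `t` amounts to applying `t` to the string. -/
theorem skewConj_mul (t p q : G) {x y : C} (f : p • x ⟶ q • y) :
    skewConj k (t * p) (t * q)
        (eqToHom (mul_smul t p x) ≫ act k t f ≫ eqToHom (mul_smul t q y).symm) =
      skewConj k p q f := by
  have hx := skewIso_mul k p t x
  have hy := skewIso_mul k q t y
  have hx' : (skewIso k (t * p) x).hom ≫ skewIncl k G (eqToHom (mul_smul t p x)) =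
      (skewIso k p x).hom ≫ (skewIso k t (p • x)).hom := hx.symm
  have hy' : (skewIso k (t * q) y).hom = (skewIso k q y).hom ≫ (skewIso k t (q • y)).hom ≫
      skewIncl k G (eqToHom (mul_smul t q y).symm) := by
    rw [← Category.assoc, hy, Category.assoc, ← skewIncl_comp, eqToHom_trans, eqToHom_refl,
      skewIncl_id, Category.comp_id]
  rw [skewConj_apply, skewConj_apply, skewIncl_comp, skewIncl_comp]
  simp only [← Category.assoc]
  rw [Iso.comp_inv_eq, hx', hy']
  simp only [Category.assoc, Iso.inv_hom_id_assoc]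
  congr 1
  simp only [← Category.assoc]
  rw [skewIso_naturality]

/-- `Φ` is the extension of `φ` to `C[G]`: its values on homogeneous strings are given by those
of `φ` through conjugation with the isomorphisms `x ⟶ s x` of `C[G]`. -/
def IsSkewExt (φ : Cochain k C n) (Φ : Cochain k (Skew k G C) n) : Prop :=
  ∀ (x : Fin (n + 1) → C) (p : Fin (n + 1) → G) (F : Str (fun i => p i • x i)),
    Φ (fun i => ⟨x i⟩) (skewStr k x p F) =
      skewConj k (p 0) (p (Fin.last n)) (φ (fun i => p i • x i) F)

/-- Where two conjugated pieces meet, an isomorphism is followed by its inverse, so conjugation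
passes through the composites before and after the cochain. All DG compatibilities of the extension
rest on this. -/
theorem IsSkewExt.seg_eq {φ : Cochain k C n} {Φ : Cochain k (Skew k G C) n} (h : IsSkewExt φ Φ)
    {N : ℕ} (ρ : Fin (n + 1) →o Fin (N + 1)) {a b : Fin (N + 1)} (ha : a ≤ ρ 0)
    (hb : ρ (Fin.last n) ≤ b) (x : Fin (N + 1) → C) (p : Fin (N + 1) → G)
    (F : Str (fun i => p i • x i)) :
    seg Φ ρ ha hb (fun i => (⟨x i⟩ : Skew k G C)) (skewStr k x p F) =
      skewConj k (p a) (p b) (seg φ ρ ha hb (fun i => p i • x i) F) := by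
  have := h (fun i => x (ρ i)) (fun i => p (ρ i)) (pull ρ (fun i => p i • x i) F)
  rw [skewConj_apply] at this
  rw [seg, chain_skewStr, chain_skewStr, pull_skewStr, this, seg, skewConj_apply, skewIncl_comp,
    skewIncl_comp]
  simp only [Category.assoc, Iso.inv_hom_id_assoc]

theorem IsSkewExt.op_eq {φ : Cochain k C n} {Φ : Cochain k (Skew k G C) n} (h : IsSkewExt φ Φ)
    {m : ℕ} (σ : Fin (n + 1) →o Fin (m + 1)) : IsSkewExt (op σ φ) (op σ Φ) :=
  fun x p F => h.seg_eq σ _ _ x p F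

theorem IsSkewExt.add {φ ψ : Cochain k C n} {Φ Ψ : Cochain k (Skew k G C) n}
    (h : IsSkewExt φ Φ) (h' : IsSkewExt ψ Ψ) : IsSkewExt (φ + ψ) (Φ + Ψ) := fun x p F => by
  refine (congrArg₂ (· + ·) (h x p F) (h' x p F)).trans ?_
  rw [← map_add]; rfl

theorem IsSkewExt.smul {φ : Cochain k C n} {Φ : Cochain k (Skew k G C) n}
    (h : IsSkewExt φ Φ) (c : k) : IsSkewExt (c • φ) (c • Φ) := fun x p F => by
  refine (congrArg (c • ·) (h x p F)).trans ?_
  rw [← map_smul]; rfl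

theorem IsSkewExt.zero : IsSkewExt (0 : Cochain k C n) (0 : Cochain k (Skew k G C) n) :=
  fun _ _ _ => (map_zero _).symm

theorem IsSkewExt.sum {ι : Type*} (S : Finset ι) {φ : ι → Cochain k C n}
    {Φ : ι → Cochain k (Skew k G C) n} (h : ∀ i ∈ S, IsSkewExt (φ i) (Φ i)) :
    IsSkewExt (∑ i ∈ S, φ i) (∑ i ∈ S, Φ i) := by
  classical
  induction S using Finset.induction_on with
  | empty => exact IsSkewExt.zero
  | insert a S ha ih =>
    rw [Finset.sum_insert ha, Finset.sum_insert ha]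
    exact (h a (Finset.mem_insert_self a S)).add
      (ih fun i hi => h i (Finset.mem_insert_of_mem hi))

theorem IsSkewExt.coboundary_eq {φ : Cochain k C n} {Φ : Cochain k (Skew k G C) n}
    (h : IsSkewExt φ Φ) : IsSkewExt (coboundary n φ) (coboundary n Φ) := by
  rw [coboundary_apply, coboundary_apply]
  exact IsSkewExt.sum _ fun i _ => (h.op_eq (skip i)).smul _

theorem IsSkewExt.cup_eq {m : ℕ} {ψ : Cochain k C m} {Ψ : Cochain k (Skew k G C) m}
    {φ : Cochain k C n} {Φ : Cochain k (Skew k G C) n} (h' : IsSkewExt ψ Ψ) (h : IsSkewExt φ Φ) :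
    IsSkewExt (cup k C ψ φ) (cup k (Skew k G C) Ψ Φ) := fun x p F => by
  rw [cup_apply, cup_apply, cupFun_apply, cupFun_apply, h.seg_eq, h'.seg_eq]
  simp only [skewConj_apply, skewIncl_comp, Category.assoc, Iso.inv_hom_id_assoc]

theorem IsSkewExt.unit : IsSkewExt (unitCochain k C) (unitCochain k (Skew k G C)) :=
  fun x p F => by
  change 𝟙 (⟨x 0⟩ : Skew k G C) = skewConj k (p 0) (p 0) (𝟙 (p 0 • x 0))
  rw [skewConj_apply, skewIncl_id, Category.id_comp, Iso.hom_inv_id]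

/-- Every homogeneous string is some `skewStr` with potential `p`, and its value is a conjugate of a
morphism of `C`, of degree `(p n)⁻¹ * p 0`, which is the product of the degrees. -/
theorem IsSkewExt.isClassOne {φ : Cochain k C n} {Φ : Cochain k (Skew k G C) n}
    (h : IsSkewExt φ Φ) : IsClassOne k G Φ := by
  intro x s f hf
  obtain ⟨p, hp, hp'⟩ := exists_inv_potential s
  obtain ⟨F, rfl⟩ := exists_skewStr k (fun i => (x i).obj) p f fun i => by rw [hp]; exact hf i
  rw [← hp']
  refine Eq.mpr (congrArg (· ∈ _) (h (fun i => (x i).obj) p F)) ?_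
  exact skewConj_mem _ _ _

/-- The strings `skewStr` exhaust the homogeneous ones. Uniqueness reduces linearity of the
extension, and its compatibility with `d`, unit and product, to the fact that these operations
preserve `IsSkewExt`. -/
theorem IsSkewExt.unique {φ : Cochain k C n} {Φ Φ' : Cochain k (Skew k G C) n}
    (h : IsSkewExt φ Φ) (h' : IsSkewExt φ Φ') : Φ = Φ' := by
  refine cochain_ext_homogeneous k G fun x s f hf => ?_
  obtain ⟨p, hp, -⟩ := exists_inv_potential s
  obtain ⟨F, rfl⟩ := exists_skewStr k (fun i => (x i).obj) p f fun i => by rw [hp]; exact hf i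
  exact (h _ p F).trans (h' _ p F).symm

/-- The values of a cochain on the conjugates of a string by `p` and by `t p` agree if the cochain
is invariant, and conversely. -/
theorem skewConj_cochain_mul {φ : Cochain k C n} (t : G) (x : Fin (n + 1) → C)
    (p : Fin (n + 1) → G) (F : Str (fun i => p i • x i)) (F' : Str (fun i => (t * p i) • x i))
    (h : skewStr k x (fun i => t * p i) F' = skewStr k x p F) :
    skewConj k (t * p 0) (t * p (Fin.last n)) (φ (fun i => (t * p i) • x i) F') =
        skewConj k (p 0) (p (Fin.last n)) (φ (fun i => p i • x i) F) ↔
      φ (fun i => t • p i • x i) (fun i => act k t (F i)) = act k t (φ (fun i => p i • x i) F) := by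
  -- Conjugation is injective, so `F'` can only be `t F`, up to identification of objects.
  have hF' : F' = fun i => eqToHom (mul_smul t _ _) ≫ act k t (F i) ≫
      eqToHom (mul_smul t _ _).symm := by
    funext i
    refine skewConj_injective _ _ ((congrFun ((skewStr_eq _ _ _).symm.trans h) i).trans ?_)
    exact (congrFun (skewStr_eq x p F) i).trans (skewConj_mul t _ _ _).symm
  rw [← skewConj_mul t (p 0) (p (Fin.last n)), (skewConj_injective (k := k) _ _).eq_iff, hF']
  refine (Eq.congr_left (cochain_eqToHom φ (fun i => mul_smul t (p i) (x i))
    (fun i => act k t (F i)))).trans ?_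
  rw [cancel_epi, cancel_mono]

open scoped Classical in
/-- The extension of an invariant cochain to a cochain of `C[G]`. -/
noncomputable def skewExt (φ : Cochain k C n) : Cochain k (Skew k G C) n := fun x =>
  MultilinearMap.fromDFinsuppEquiv (M := fun (i : Fin n) (s : G) =>
      (s • (x i.castSucc).obj ⟶ (x i.succ).obj)) (fun _ => G) k fun s =>
    -- A potential is chosen for each family of degrees, which gives a cochain for every `φ`. Its
    -- values are independent of this choice when `φ` is invariant.
    let p := (exists_inv_potential s).choose
    (skewConj k (x := (x 0).obj) (y := (x (Fin.last n)).obj)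
        (p 0) (p (Fin.last n))).compMultilinearMap
      ((φ fun i => p i • (x i).obj).compLinearMap fun i =>
        (skewUnconj k (x := (x i.castSucc).obj) (y := (x i.succ).obj)
          (p i.castSucc) (p i.succ)).comp (homog k (s i)))

/-- The existential hides the chosen potential and keeps only the properties that determine it up to
translation. -/
theorem skewExt_homog (φ : Cochain k C n) (x : Fin (n + 1) → C) (s : Fin n → G)
    (f : ∀ i : Fin n, s i • x i.castSucc ⟶ x i.succ) :
    ∃ (p : Fin (n + 1) → G) (F : Str (fun i => p i • x i)),
      (∀ i : Fin n, (p i.succ)⁻¹ * p i.castSucc = s i) ∧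
      skewStr k x p F = (fun i => homog k (s i) (f i)) ∧
      skewExt φ (fun i => (⟨x i⟩ : Skew k G C)) (fun i => homog k (s i) (f i)) =
        skewConj k (p 0) (p (Fin.last n)) (φ (fun i => p i • x i) F) := by
  classical
  let p := (exists_inv_potential s).choose
  have hp := (exists_inv_potential s).choose_spec.1
  refine ⟨p, fun i => skewUnconj k (p i.castSucc) (p i.succ) (homog k (s i) (f i)), hp, ?_, ?_⟩
  · rw [skewStr_eq]
    funext i
    exact skewConj_skewUnconj (hp i) (homog_mem k (s i) (f i))
  · exact MultilinearMap.fromDFinsuppEquiv_single (M := fun (i : Fin n) (s : G) =>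
      (s • x i.castSucc ⟶ x i.succ)) (κ := fun _ => G) (R := k) _ s f

theorem isSkewExt_skewExt {φ : Cochain k C n} (hφ : ∀ s : G, (cochainAct k C s).f n φ = φ) :
    IsSkewExt φ (skewExt (G := G) φ) := by
  intro x p F
  have hf : ∀ i : Fin n, ∃ g : ((p i.succ)⁻¹ * p i.castSucc) • x i.castSucc ⟶ x i.succ,
      homog k _ g = skewStr k x p F i := fun i => conj_mem k _ _ _
  choose f hf using hf
  obtain ⟨q, F', hq, hF', h⟩ := skewExt_homog φ x _ f
  rw [funext hf] at h hF'
  rw [h]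
  -- Equality of the degrees `(q (i+1))⁻¹ * q i` and `(p (i+1))⁻¹ * p i` says that `q i * (p i)⁻¹`
  -- does not depend on `i`.
  have ht : ∀ i, q i = (q 0 * (p 0)⁻¹) * p i := by
    intro i
    induction i using Fin.induction with
    | zero => simp
    | succ i ih =>
      have h1 := hq i
      rw [ih, inv_mul_eq_iff_eq_mul] at h1
      have : q i.succ = q 0 * (p 0)⁻¹ * p i.castSucc * ((p i.succ)⁻¹ * p i.castSucc)⁻¹ := by
        rw [h1]; group
      rw [this]; group
  generalize q 0 * (p 0)⁻¹ = t at ht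
  obtain rfl : q = fun i => t * p i := funext ht
  exact (skewConj_cochain_mul t x p F F' hF').2 ((invariant_iff φ).1 hφ t _ F)

variable (k G C) in
/-- The extension of invariant cochains to `C[G]`, as a morphism of DG-algebras. -/
noncomputable def skewExtHom :
    DGHom (invariantCochains k G C) (classOneCochains k G (Skew k G C)) where
  f n :=
    { toFun := fun φ => ⟨skewExt φ.1, (isSkewExt_skewExt φ.2).isClassOne⟩
      map_add' := fun φ ψ => Subtype.ext <|
        (isSkewExt_skewExt (φ + ψ).2).unique
          ((isSkewExt_skewExt φ.2).add (isSkewExt_skewExt ψ.2))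
      map_smul' := fun c φ => Subtype.ext <|
        (isSkewExt_skewExt (c • φ).2).unique ((isSkewExt_skewExt φ.2).smul c) }
  map_d _ φ := Subtype.ext <|
    (isSkewExt_skewExt ((invariantCochains k G C).d _ φ).2).unique
      (isSkewExt_skewExt φ.2).coboundary_eq
  map_one := Subtype.ext <|
    (isSkewExt_skewExt (invariantCochains k G C).one.2).unique IsSkewExt.unit
  map_mul ψ φ := Subtype.ext <|
    (isSkewExt_skewExt ((invariantCochains k G C).mul ψ φ).2).unique
      ((isSkewExt_skewExt ψ.2).cup_eq (isSkewExt_skewExt φ.2))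

end SkewExtension
-- Transversals: comparison of invariant cochains with cochains of `C_T[G]`
section Transversal

theorem exists_isTransversal (G : Type uG) [Group G] (E : Type u) [MulAction G E] :
    ∃ T : Set E, IsTransversal G T := by
  refine ⟨Set.range (Quotient.out : MulAction.orbitRel.Quotient G E → E), fun x => ?_⟩
  have hrel : ∀ y : E, (∃ s : G, x = s • y) ↔
      (Quotient.mk (MulAction.orbitRel G E) x) = Quotient.mk (MulAction.orbitRel G E) y := by
    intro y
    rw [Quotient.eq]
    exact ⟨fun ⟨s, hs⟩ => ⟨s, hs.symm⟩, fun ⟨s, hs⟩ => ⟨s, hs.symm⟩⟩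
  refine ⟨(Quotient.mk (MulAction.orbitRel G E) x).out, ⟨⟨_, rfl⟩, ?_⟩, ?_⟩
  · rw [hrel, Quotient.out_eq]
  · rintro _ ⟨⟨q, rfl⟩, h⟩
    rw [hrel, Quotient.out_eq] at h
    rw [h]

theorem IsTransversal.exists_smul_eq {G : Type uG} [Group G] {C : Type u} [MulAction G C]
    {T : Set C} (hT : IsTransversal G T) {n : ℕ} (y : Fin (n + 1) → C) :
    ∃ (u : Fin (n + 1) → C) (p : Fin (n + 1) → G), (∀ i, u i ∈ T) ∧ y = fun i => p i • u i := by
  choose u hu _ using hT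
  choose p hp using fun x => (hu x).2
  exact ⟨fun i => u (y i), fun i => p (y i), fun i => (hu (y i)).1, funext fun i => hp (y i)⟩

variable {k : Type uk} [Field k] {G : Type uG} [Group G] {C : Type u} [Category.{v} C]
  [Preadditive C] [Linear k C] [MulAction G C] [GCategory k G C] {n : ℕ} {T : Set C}

/-- The sequence of objects of `C_T[G]` given by a sequence of elements of `T`. -/
def skewOn (u : Fin (n + 1) → C) (hu : ∀ i, u i ∈ T) (i : Fin (n + 1)) : SkewOn k G T :=
  ⟨⟨u i⟩, hu i⟩

variable (k G T) in
/-- The inclusion of `C_T[G]` in `C[G]`. -/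
noncomputable abbrev skewOnIncl : SkewOn k G T ⥤ Skew k G C :=
  ObjectProperty.ι (fun x : Skew k G C => x.obj ∈ T)

/-- The string of `C_T[G]` with given image in `C[G]`. -/
noncomputable def skewOnStr (u : Fin (n + 1) → C) (hu : ∀ i, u i ∈ T)
    (f : Str (fun i => (⟨u i⟩ : Skew k G C))) : Str (skewOn (k := k) (G := G) u hu) :=
  fun i => (homEquiv k (skewOnIncl k G T) (skewOn u hu i.castSucc) (skewOn u hu i.succ)).symm (f i)

theorem map_skewOnStr (u : Fin (n + 1) → C) (hu : ∀ i, u i ∈ T)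
    (f : Str (fun i => (⟨u i⟩ : Skew k G C))) (i : Fin n) :
    (skewOnIncl k G T).map (skewOnStr u hu f i) = f i :=
  (homEquiv k (skewOnIncl k G T) (skewOn u hu i.castSucc) (skewOn u hu i.succ)).apply_symm_apply
    (f i)

/-- Every string of `C` runs along objects `p i • u i` with `u i ∈ T`; its conjugate lies in
`C_T[G]`, where the extension vanishes, and conjugation is injective. Freeness plays no role here.
-/
theorem skewExt_injective (hT : IsTransversal G T) :
    Function.Injective (((classOneRestrict k G (fun x : Skew k G C => x.obj ∈ T)).comp
      (skewExtHom k G C)).f n) := by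
  rw [injective_iff_map_eq_zero]
  rintro ⟨φ, hφ⟩ h
  change Cochain k C n at φ
  have h0 : pullFun (skewOnIncl k G T) (skewExt (G := G) φ) = 0 := congrArg Subtype.val h
  refine Subtype.ext (show φ = 0 from ?_)
  funext y; ext F
  obtain ⟨u, p, hu, rfl⟩ := hT.exists_smul_eq y
  apply skewConj_injective (k := k) (p 0) (p (Fin.last n))
  have h1 := isSkewExt_skewExt hφ u p F
  have h2 := map_pullFun (skewOnIncl k G T) (skewExt (G := G) φ) (skewOn u hu)
    (skewOnStr u hu (skewStr k u p F))
  rw [h0] at h2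
  simp only [map_skewOnStr] at h2
  refine h1.symm.trans (h2.symm.trans ?_)
  exact ((skewOnIncl k G T).map_zero _ _).trans (map_zero _).symm

/-- Transport of morphisms along equalities of objects. -/
def eqConj {a b a' b' : C} (h : a = b) (h' : a' = b') : (a ⟶ a') →ₗ[k] (b ⟶ b') where
  toFun f := eqToHom h.symm ≫ f ≫ eqToHom h'
  map_add' f g := by simp
  map_smul' c f := by simp

theorem eqConj_rfl {a b : C} (f : a ⟶ b) : eqConj (k := k) rfl rfl f = f := by
  simp [eqConj]

/-- The multilinear map obtained from a cochain of `C_T[G]` by conjugation to objects `y i` in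
the orbits of the objects `u i` of `T`. -/
noncomputable def orbitEval (ψ : Cochain k (SkewOn k G T) n) (y u : Fin (n + 1) → C)
    (p : Fin (n + 1) → G) (hu : ∀ i, u i ∈ T) (h : ∀ i, y i = p i • u i) :
    MultilinearMap k (fun i : Fin n => (y i.castSucc ⟶ y i.succ)) (y 0 ⟶ y (Fin.last n)) :=
  ((eqConj (h 0).symm (h (Fin.last n)).symm).comp ((skewUnconj k (p 0) (p (Fin.last n))).comp
    ((skewOnIncl k G T).mapLinearMap k))).compMultilinearMap
    ((ψ (skewOn u hu)).compLinearMap fun i =>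
      (homEquiv k (skewOnIncl k G T) (skewOn u hu i.castSucc)
        (skewOn u hu i.succ)).symm.toLinearMap.comp
        ((skewConj k (p i.castSucc) (p i.succ)).comp (eqConj (h i.castSucc) (h i.succ))))

theorem orbitEval_rfl (ψ : Cochain k (SkewOn k G T) n) (u : Fin (n + 1) → C)
    (p : Fin (n + 1) → G) (hu : ∀ i, u i ∈ T) (F : Str (fun i => p i • u i)) :
    orbitEval ψ (fun i => p i • u i) u p hu (fun _ => rfl) F =
      skewUnconj k (p 0) (p (Fin.last n)) ((skewOnIncl k G T).map
        (ψ (skewOn u hu) (skewOnStr u hu (skewStr k u p F)))) := by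
  have e : (fun i : Fin n => (homEquiv k (skewOnIncl k G T) (skewOn u hu i.castSucc)
        (skewOn u hu i.succ)).symm (skewConj k (p i.castSucc) (p i.succ)
          (eqConj (k := k) rfl rfl (F i)))) = skewOnStr u hu (skewStr k u p F) := by
    funext i
    rw [eqConj_rfl, skewStr_eq]
    rfl
  rw [← e]
  exact eqConj_rfl (k := k) _

/-- The equalities `y i = p i • u i` are arguments of `orbitEval`, so the chosen `u` and `p` can be
replaced by given ones without moving `y`. -/
theorem orbitEval_congr (ψ : Cochain k (SkewOn k G T) n) (y : Fin (n + 1) → C)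
    {u u' : Fin (n + 1) → C} {p p' : Fin (n + 1) → G} (hu : ∀ i, u i ∈ T)
    (h : ∀ i, y i = p i • u i) (hu' : ∀ i, u' i ∈ T) (h' : ∀ i, y i = p' i • u' i) (eu : u = u')
    (ep : p = p') : orbitEval ψ y u p hu h = orbitEval ψ y u' p' hu' h' := by
  subst eu ep; rfl

/-- Class `1` gives the value exactly the degree of a morphism conjugated from one between `p 0 • u
0` and `p n • u n`. This is what allows it to be carried back to `C`. -/
theorem map_cochain_mem {ψ : Cochain k (SkewOn k G T) n} (hψ : IsClassOne k G ψ)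
    (u : Fin (n + 1) → C) (hu : ∀ i, u i ∈ T) (p : Fin (n + 1) → G)
    (F : Str (fun i => p i • u i)) :
    (skewOnIncl k G T).map (ψ (skewOn u hu) (skewOnStr u hu (skewStr k u p F))) ∈
      GradedCategory.deg (k := k) (⟨u 0⟩ : Skew k G C) ⟨u (Fin.last n)⟩
        ((p (Fin.last n))⁻¹ * p 0) := by
  have h := hψ (skewOn u hu) (fun i => (p i.succ)⁻¹ * p i.castSucc)
    (skewOnStr u hu (skewStr k u p F)) fun i => by
      refine Submodule.mem_comap.2 ?_
      refine Eq.mpr (congrArg (· ∈ GradedCategory.deg (k := k) (⟨u i.castSucc⟩ : Skew k G C)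
        ⟨u i.succ⟩ _) (map_skewOnStr u hu (skewStr k u p F) i)) ?_
      exact conj_mem k _ _ _
  have e := degProd_telescope (fun i => (p i)⁻¹)
  simp only [inv_inv] at e
  rw [e] at h
  exact h

/-- Every cochain of class `1` of `C_T[G]` comes from a cochain of `C`. -/
theorem exists_cochain_of_transversal (hfree : ∀ (s : G) (x : C), s • x = x → s = 1)
    (hT : IsTransversal G T) {ψ : Cochain k (SkewOn k G T) n} (hψ : IsClassOne k G ψ) :
    ∃ φ : Cochain k C n, ∀ (u : Fin (n + 1) → C) (hu : ∀ i, u i ∈ T) (p : Fin (n + 1) → G)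
      (F : Str (fun i => p i • u i)),
      skewConj k (p 0) (p (Fin.last n)) (φ (fun i => p i • u i) F) =
        (skewOnIncl k G T).map (ψ (skewOn u hu) (skewOnStr u hu (skewStr k u p F))) := by
  choose r hr hr' using hT
  choose g hg using fun x => (hr x).2
  refine ⟨fun y => orbitEval ψ y (fun i => r (y i)) (fun i => g (y i)) (fun i => (hr (y i)).1)
    (fun i => hg (y i)), fun u hu p F => ?_⟩
  -- The representative in `T` is recovered by uniqueness in the definition of a transversal.
  have hru : ∀ i, r (p i • u i) = u i := fun i => (hr' _ (u i) ⟨hu i, p i, rfl⟩).symm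
  -- The group element is recovered by freeness: two elements carrying `u i` to the same object
  -- differ by one that fixes `u i`.
  have hgp : ∀ i, g (p i • u i) = p i := fun i => by
    have h := hg (p i • u i)
    rw [hru, eq_comm, ← inv_smul_eq_iff, smul_smul] at h
    exact (inv_mul_eq_one.1 (hfree _ _ h)).symm
  have := orbitEval_congr ψ (fun i => p i • u i) (fun i => (hr (p i • u i)).1)
    (fun i => hg (p i • u i)) hu (fun _ => rfl) (funext hru) (funext hgp)
  dsimp only
  rw [this, orbitEval_rfl]
  exact skewConj_skewUnconj rfl (map_cochain_mem hψ u hu p F)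

theorem skewExt_surjective (hfree : ∀ (s : G) (x : C), s • x = x → s = 1)
    (hT : IsTransversal G T) :
    Function.Surjective (((classOneRestrict k G (fun x : Skew k G C => x.obj ∈ T)).comp
      (skewExtHom k G C)).f n) := by
  rintro ⟨ψ, hψ⟩
  change Cochain k (SkewOn k G T) n at ψ
  obtain ⟨φ, hφ⟩ := exists_cochain_of_transversal hfree hT hψ
  have hinv : ∀ s : G, (cochainAct k C s).f n φ = φ := by
    refine (invariant_iff φ).2 fun t y F => ?_
    obtain ⟨u, p, hu, rfl⟩ := hT.exists_smul_eq y
    -- The string `t F` has potential `t * p` and the same conjugate in `C_T[G]` as `F`. Both values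
    -- of `φ` thus come from a single value of `ψ`, which forces equivariance.
    let F' : Str (fun i => (t * p i) • u i) := fun i =>
      eqToHom (mul_smul t _ _) ≫ act k t (F i) ≫ eqToHom (mul_smul t _ _).symm
    have hF' : skewStr k u (fun i => t * p i) F' = skewStr k u p F := by
      rw [skewStr_eq, skewStr_eq]
      funext i
      exact skewConj_mul t _ _ _
    refine (skewConj_cochain_mul t u p F F' hF').1 ?_
    rw [hφ u hu p F, ← hF']
    exact hφ u hu (fun i => t * p i) F'
  refine ⟨⟨φ, hinv⟩, Subtype.ext
    (show pullFun (skewOnIncl k G T) (skewExt (G := G) φ) = ψ from ?_)⟩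
  refine cochain_ext_homogeneous k G fun x s f hf => ?_
  apply (skewOnIncl k G T).map_injective
  rw [map_pullFun]
  obtain ⟨p, hp, -⟩ := exists_inv_potential s
  obtain ⟨F, hF⟩ := exists_skewStr k (fun i => (x i).obj.obj) p
    (fun i => (skewOnIncl k G T).map (f i)) fun i => by rw [hp]; exact hf i
  have h1 := isSkewExt_skewExt hinv (fun i => (x i).obj.obj) p F
  have h2 := hφ (fun i => (x i).obj.obj) (fun i => (x i).property) p F
  -- The original homogeneous string is recovered, so the extension and `ψ` are compared at the same
  -- argument.
  have h3 : skewOnStr (fun i => (x i).obj.obj) (fun i => (x i).property)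
      (skewStr k (fun i => (x i).obj.obj) p F) = f := by
    rw [hF]
    funext i
    exact (homEquiv k (skewOnIncl k G T) _ _).symm_apply_apply (f i)
  rw [h3] at h2
  rw [hF] at h1
  exact h1.trans h2

theorem skewExt_bijective (hfree : ∀ (s : G) (x : C), s • x = x → s = 1)
    (hT : IsTransversal G T) (n : ℕ) :
    Function.Bijective (((classOneRestrict k G (fun x : Skew k G C => x.obj ∈ T)).comp
      (skewExtHom k G C)).f n) :=
  ⟨skewExt_injective hT, skewExt_surjective hfree hT⟩

/-- A cocycle of class `1` of `C[G]` which vanishes on `C_T[G]` is a coboundary. -/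
theorem mem_Bd_of_transversal (hT : IsTransversal G T) (n : ℕ)
    (φ : (classOneCochains k G (Skew k G C)).X n)
    (hφ : φ ∈ (classOneCochains k G (Skew k G C)).Z n)
    (h0 : (classOneRestrict k G (fun x : Skew k G C => x.obj ∈ T)).f n φ = 0) :
    φ ∈ (classOneCochains k G (Skew k G C)).Bd n := by
  have hs : ∀ x : C, ∃ s : G, s • x ∈ T := fun x => by
    obtain ⟨u, ⟨hu, s, hs⟩, -⟩ := hT x
    exact ⟨s⁻¹, by rwa [hs, inv_smul_smul]⟩
  choose s hs using hs
  exact mem_Bd_of_restrict_eq_zero (fun b : Skew k G C => ⟨s b.obj • b.obj⟩)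
    (fun b => skewIso k (s b.obj) b.obj) G (fun b => s b.obj)
    (fun b => skewIso_hom_mem k _ _) (fun b => skewIso_inv_mem k _ _) _ (fun b => hs b.obj)
    φ hφ h0

/-- Some transversal is needed to run the comparison, but the map itself does not involve it. -/
theorem mapH_skewExtHom_bijective (hfree : ∀ (s : G) (x : C), s • x = x → s = 1) (n : ℕ) :
    Function.Bijective ((skewExtHom k G C).mapH n) := by
  obtain ⟨T, hT⟩ := exists_isTransversal G C
  exact (skewExtHom k G C).mapH_bijective_of_comp _ (skewExt_bijective hfree hT)
    (mem_Bd_of_transversal hT) n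

end Transversal

/-! ### The map from cohomology of invariants to invariant cohomology -/

section InvariantCohomology

variable (k : Type uk) [Field k] (G : Type uG) [Group G] (C : Type u) [Category.{v} C]
  [Preadditive C] [Linear k C] [MulAction G C] [GCategory k G C]

/-- The algebra morphism `H^*(C^•(C)^G) → HH^*(C)^G` induced by the inclusion. -/
noncomputable def invariantInclHH : (invariantCochains k G C).HAlg →ₐ[k] invariantHH k G C :=
  (invariantIncl k G C).mapHAlg.codRestrict (invariantHH k G C) fun z s => by
    rw [← DGHom.mapHAlg_comp]
    refine congrArg (fun F : DGHom _ _ => F.mapHAlg z) ?_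
    exact DGHom.ext (funext fun n => LinearMap.ext fun φ => φ.2 s)

theorem invariantInclHH_bijective
    (hex : exactFunctor (Rep.{max uk uG u v} k G) (ModuleCat.{max uk uG u v} k)
      (Rep.invariantsFunctor k G)) :
    Function.Bijective (invariantInclHH k G C) := by
  constructor
  · intro y z h
    refine (invariantIncl k G C).mapHAlg_injective (fun n => ?_) (congrArg Subtype.val h)
    exact mapH_subIncl_injective (cochains k C) (fun s : G => cochainAct k C s) cochainAct_one
      cochainAct_mul hex (invariantSub k G C) (fun _ _ => Iff.rfl) n
  · rintro ⟨z, hz⟩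
    obtain ⟨y, hy⟩ := (invariantIncl k G C).exists_mapHAlg_eq z fun n =>
      exists_mapH_subIncl_eq (cochains k C) (fun s : G => cochainAct k C s) cochainAct_one
        cochainAct_mul hex (invariantSub k G C) (fun _ _ => Iff.rfl) n (z n) fun s => by
          rw [← DGHom.mapHAlg_apply, hz s]
    exact ⟨y, Subtype.ext hy⟩

end InvariantCohomology

end HochschildMitchell

/-! ### The theorem -/

theorem mainTheorem5 {k : Type uk} [Field k] {G : Type uG} [Group G] {C : Type u}
    [Category.{v} C] [Preadditive C] [Linear k C] [MulAction G C]
    [HochschildMitchell.GCategory k G C]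
    (hfree : ∀ (s : G) (x : C), s • x = x → s = 1) :
    ∃ e : (HochschildMitchell.classOneCochains k G (HochschildMitchell.Skew k G C)).HAlg ≃ₐ[k]
        (HochschildMitchell.invariantCochains k G C).HAlg,
      -- `e` preserves the cohomological degree
      (∀ (n : ℕ)
        (z : (HochschildMitchell.classOneCochains k G (HochschildMitchell.Skew k G C)).H n),
        ∃ y : (HochschildMitchell.invariantCochains k G C).H n,
          e (DirectSum.of _ n z) = DirectSum.of _ n y) ∧
      -- for every transversal, `e` is restriction followed by the inverse of the isomorphism
      -- induced by `A`
      (∀ T : Set C, HochschildMitchell.IsTransversal G T →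
        ∃ (A : HochschildMitchell.DGHom (HochschildMitchell.invariantCochains k G C)
              (HochschildMitchell.classOneCochains k G (HochschildMitchell.SkewOn k G T)))
          (B : HochschildMitchell.DGHom
              (HochschildMitchell.classOneCochains k G (HochschildMitchell.SkewOn k G T))
              (HochschildMitchell.invariantCochains k G C)),
          B.comp A = HochschildMitchell.DGHom.id _ ∧ A.comp B = HochschildMitchell.DGHom.id _ ∧
          ∀ z, A.mapHAlg (e z) =
            (HochschildMitchell.classOneRestrict k G
              (fun x : HochschildMitchell.Skew k G C => x.obj ∈ T)).mapHAlg z) ∧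
      -- the second isomorphism, when the invariants functor is exact
      (exactFunctor (Rep.{max uk uG u v} k G) (ModuleCat.{max uk uG u v} k)
          (Rep.invariantsFunctor k G) →
        ∃ e' : (HochschildMitchell.classOneCochains k G (HochschildMitchell.Skew k G C)).HAlg ≃ₐ[k]
            HochschildMitchell.invariantHH k G C,
          ∀ z, (e' z : (HochschildMitchell.cochains k C).HAlg) =
            (HochschildMitchell.invariantIncl k G C).mapHAlg (e z)) := by
  open HochschildMitchell in
  have hbij := mapH_skewExtHom_bijective (k := k) hfree
  -- Extension of cochains goes from invariants to `C[G]`, so `e` is the inverse of the isomorphism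
  -- it induces.
  let E := AlgEquiv.ofBijective (skewExtHom k G C).mapHAlg
    ((skewExtHom k G C).mapHAlg_bijective hbij)
  refine ⟨E.symm, fun n z => ?_, fun T hT => ?_, fun hex => ?_⟩
  · obtain ⟨y, rfl⟩ := (hbij n).2 z
    refine ⟨y, E.symm_apply_eq.2 ?_⟩
    exact ((skewExtHom k G C).mapHAlg_of n y).symm
  · have hA := skewExt_bijective (k := k) hfree hT
    refine ⟨_, DGHom.inverse _ hA, DGHom.inverse_comp _ hA, DGHom.comp_inverse _ hA, fun z => ?_⟩
    rw [DGHom.mapHAlg_comp]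
    exact congrArg _ (E.apply_symm_apply z)
  · exact ⟨E.symm.trans (AlgEquiv.ofBijective _ (invariantInclHH_bijective k G C hex)),
      fun z => rfl⟩
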